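/- Let $X=(Y,A,Z)\in\mathbb R\times\{0,1\}\times\mathbb R^d$ have law $P_0$, let $X_1,X_2,\dots$ be i.i.d. from $P_0$, write $Pf=\int f\,dP$, and let $\mathbb P_n$ and $Q_n$ be the empirical distributions of $X_1,\dots,X_n$ and of $Z_1,\dots,Z_n$. Put $\pi_0=P_0(A=1)$, $g_0(z)=P_0(A=1\mid Z=z)$, $\mu_0(z)=E_0(Y\mid A=0,Z=z)$, and let the parameter of interest be the G-computed conditional mean $\psi_0=E_0[\mu_0(Z)\mid A=1]$. For functions $\mu,g$ of $z$ and numbers $\pi,\psi$ put $$\phi_{\psi,\mu,g,\pi}(y,a,z)=\frac{I(a=0)\,g(z)}{\pi[1-g(z)]}[y-\mu(z)]+\frac{I(a=1)}{\pi}[\mu(z)-\psi],\qquad \phi_0=\phi_{\psi_0,\mu_0,g_0,\pi_0}.$$ Let $\mu_n$ and $g_n$ be estimators of $\mu_0$ and $g_0$ (random measurable functions of $z$), and put $\pi_n=\int g_n\,dQ_n$, $\bar\pi_n=\frac1n\sum_{i=1}^n A_i$ and $\phi_{\psi,n}=\phi_{\psi,\mu_n,g_n,\pi_n}$. All probability limits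 below are in outer probability; "with probability tending to one" means that the outer probability of the complement tends to zero. A class of functions is $P_0$-Donsker if it consists of measurable, $P_0$-square-integrable functions and its empirical process $f\mapsto n^{1/2}(\mathbb P_n-P_0)f$ (with almost surely bounded paths) converges weakly, in the sense of outer expectations, in the space of bounded functions on the class to a tight Borel limit. An estimator $T_n$ of $\psi_0$ is asymptotically linear with influence function $\phi_0$ if $P_0\phi_0=0$, $P_0\phi_0^2<\infty$ and $T_n=\psi_0+\mathbb P_n\phi_0+o_{P_0^*}(n^{-1/2})$. Assume that 1. each of $\mu_n$, $g_n$ and $(y,a,z)\mapsto(1-a)\,y\,g_n(z)/[1-g_n(z)]$, as a function of $(y,a,z)$, falls in some $P_0$-Donsker class with probability tending to one; 2. $E_0(Y^2)<\infty$; 3. there are constants $0<a<b<1$ and $M\in\mathbb R$ such that $P_0(g_0(Z)\in(a,b))=1$ and, for every $n$, almost surely: $g_n(z)\in(a,b)$ and $|\mu_n(z)|\le M$ for almost every $z$ under the law of $Z$, and also for $z=Z_1,\dots,Z_n$; 4. $\|g_n-g_0\|_{L_2(P_0)}=o_{P_0^*}(1)$ and $\|\mu_n-\mu_0\|_{L_2(P_0)}=o_{P_0^*}(1)$;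 5. $P_0\{(g_n-g_0)(\mu_n-\mu_0)/(1-g_n)\}=o_{P_0^*}(n^{-1/2})$. Then the following hold. (i) The estimating equations-based estimator, i.e. the root $\psi$ of $\mathbb P_n\phi_{\psi,n}=0$, $$\psi_{n,2}=\frac1n\sum_{i=1}^n\left\{\frac{I(A_i=0)\,g_n(Z_i)}{\bar\pi_n[1-g_n(Z_i)]}[Y_i-\mu_n(Z_i)]+\frac{I(A_i=1)}{\bar\pi_n}\mu_n(Z_i)\right\},$$ is asymptotically linear with influence function $\phi_0$. (ii) Let $\psi_n=\int\mu_n g_n\pi_n^{-1}\,dQ_n$. If in addition $(\pi_n-\pi_0)(\psi_n-\psi_0)=o_{P_0^*}(n^{-1/2})$, then the one-step estimator $\psi_n+\mathbb P_n\phi_{\psi_n,n}$ is asymptotically linear with influence function $\phi_0$. (iii) Let instead $\psi_n=\frac1n\sum_{i=1}^n I(A_i=1)\mu_n(Z_i)/\pi_n$. If in addition $(\pi_n-\pi_0)(\psi_n-\psi_0)=o_{P_0^*}(n^{-1/2})$, then the one-step estimator $\psi_n+\mathbb P_n\phi_{\psi_n,n}$, which for this $\psi_n$ equals $$\frac1n\sum_{i=1}^n\left\{\frac{I(A_i=0)\,g_n(Z_i)}{\pi_n[1-g_n(Z_i)]}[Y_i-\mu_n(Z_i)]+\left[2-\frac{\bar\pi_n}{\pi_n}\right]\frac{I(A_i=1)}{\pi_n}\mu_n(Z_i)\right\},$$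 is asymptotically linear with influence function $\phi_0$. -/

import Mathlib

open MeasureTheory ProbabilityTheory Filter Topology
open scoped ENNReal

noncomputable section

namespace GComp

/-! ### Outer expectation, outer probability, weak convergence, Donsker classes -/

/-- Outer expectation `E^* f` of a bounded, possibly non-measurable function: the infimum of `E U`
over the integrable measurable `U` with `U ≥ f` almost surely. -/
def outerExp {Ω : Type*} [MeasurableSpace Ω] (P : Measure Ω) (f : Ω → ℝ) : ℝ :=
  sInf {c : ℝ | ∃ U : Ω → ℝ, Measurable U ∧ Integrable U P ∧ (∀ᵐ ω ∂P, f ω ≤ U ω) ∧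
    c = ∫ ω, U ω ∂P}

/-- `G n ⇝ L`: the outer expectation of `h (G n)` tends to `∫ h dL` for every bounded continuous
`h`; the maps `G n` may be non-measurable, `L` is the (Borel) law of the limit. -/
def WeakConvOuter {Ω D : Type*} [MeasurableSpace Ω] [TopologicalSpace D] {mD : MeasurableSpace D}
    (P : Measure Ω) (G : ℕ → Ω → D) (L : Measure D) : Prop :=
  ∀ h : BoundedContinuousFunction D ℝ,
    Tendsto (fun n => outerExp P (fun ω => h (G n ω))) atTop (𝓝 (∫ z, h z ∂L))

/-- The Banach space `ℓ^∞(F)` of bounded real functions on the class `F`, with supremum norm. -/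
abbrev Linf {S : Type*} (F : Set (S → ℝ)) : Type _ := lp (fun _ : F => ℝ) ∞

open Classical in
/-- A function on `F` as an element of `ℓ^∞(F)` (and `0` if it is unbounded). -/
def toLinf {S : Type*} (F : Set (S → ℝ)) (z : F → ℝ) : Linf F :=
  if h : Memℓp z ∞ then ⟨z, h⟩ else 0

/-- The empirical mean `ℙ_n f` over the first `n` observations of the sequence `s`. -/
def empMean {S : Type*} (s : ℕ → S) (n : ℕ) (f : S → ℝ) : ℝ :=
  (∑ i ∈ Finset.range n, f (s i)) / n

/-- The empirical process `𝔾_n f = n^{1/2} (ℙ_n - P) f`. -/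
def empProc {S : Type*} [MeasurableSpace S] (P : Measure S) (s : ℕ → S) (n : ℕ) (f : S → ℝ) : ℝ :=
  √(n : ℝ) * (empMean s n f - ∫ x, f x ∂P)

/-- `F` is a `P`-Donsker class: its members are measurable and square integrable, the sample paths
`f ↦ 𝔾_n f` are almost surely bounded on `F`, and, on the product space `(S^∞, P^∞)`, `𝔾_n`
converges weakly in `ℓ^∞(F)` to a tight Borel limit. -/
def IsDonsker {S : Type*} [MeasurableSpace S] (P : Measure S) [IsProbabilityMeasure P]
    (F : Set (S → ℝ)) : Prop :=
  (∀ f ∈ F, Measurable f ∧ MemLp f 2 P) ∧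
  (∀ n : ℕ, ∀ᵐ s ∂(Measure.infinitePi fun _ : ℕ => P),
    Memℓp (fun f : F => empProc P s n (f : S → ℝ)) ∞) ∧
  ∃ L : @Measure (Linf F) (borel (Linf F)), L Set.univ = 1 ∧ IsTightMeasureSet {L} ∧
    WeakConvOuter (Measure.infinitePi fun _ : ℕ => P)
      (fun n s => toLinf F fun f : F => empProc P s n (f : S → ℝ)) L

/-- `N n = o_{P^*}(1)` for a sequence of non-negative maps, in outer probability (a measure of
Mathlib, applied to a non-measurable set, is the outer measure). -/
def OuterLittleOOne {Ω : Type*} [MeasurableSpace Ω] (P : Measure Ω) (N : ℕ → Ω → ℝ≥0∞) : Prop :=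
  ∀ ε : ℝ≥0∞, 0 < ε → Tendsto (fun n => P {ω | ε ≤ N n ω}) atTop (𝓝 0)

/-- `R n = o_{P^*}(n^{-1/2})`. -/
def OuterLittleORootN {Ω : Type*} [MeasurableSpace Ω] (P : Measure Ω) (R : ℕ → Ω → ℝ) : Prop :=
  OuterLittleOOne P fun n ω => ENNReal.ofReal (√(n : ℝ) * |R n ω|)

/-- The events `E n` hold with probability tending to one: the outer probability of the complement
of `E n` tends to zero. -/
def WithProbTendstoOne {Ω : Type*} [MeasurableSpace Ω] (P : Measure Ω) (E : ℕ → Set Ω) : Prop :=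
  Tendsto (fun n => P (E n)ᶜ) atTop (𝓝 0)

/-- The estimator `T n` of `θ`, based on the observations `X 0, X 1, …` with law `P₀`, is
asymptotically linear with influence function `φ`:
`P₀ φ = 0`, `P₀ φ² < ∞` and `T n = θ + ℙ_n φ + o_{P^*}(n^{-1/2})`. -/
def AsympLinear {Ω S : Type*} [MeasurableSpace Ω] [MeasurableSpace S] (P : Measure Ω)
    (P₀ : Measure S) (X : ℕ → Ω → S) (T : ℕ → Ω → ℝ) (θ : ℝ) (φ : S → ℝ) : Prop :=
  MemLp φ 2 P₀ ∧ ∫ x, φ x ∂P₀ = 0 ∧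
    OuterLittleORootN P fun n ω => T n ω - (θ + empMean (fun i => X i ω) n φ)

/-! ### The G-computed conditional mean -/

/-- An observation `(Y, A, Z)`: outcome, treatment indicator (`true` for `A = 1`), covariates. -/
abbrev Obs (d : ℕ) : Type := ℝ × Bool × (Fin d → ℝ)

/-- `I(a = 1)`. -/
def treated {d : ℕ} (x : Obs d) : ℝ := if x.2.1 = true then 1 else 0

/-- `I(a = 0)`. -/
def control {d : ℕ} (x : Obs d) : ℝ := if x.2.1 = true then 0 else 1

/-- The propensity score `g_P(z) = P(A = 1 ∣ Z = z)`. -/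
def propensity {d : ℕ} (P : Measure (Obs d)) [IsFiniteMeasure P] (z : Fin d → ℝ) : ℝ :=
  (condDistrib (fun x : Obs d => x.2.1) (fun x : Obs d => x.2.2) P z).real {true}

/-- The outcome regression `μ_P(z) = E_P(Y ∣ A = 0, Z = z)`. -/
def outcomeReg {d : ℕ} (P : Measure (Obs d)) [IsFiniteMeasure P] (z : Fin d → ℝ) : ℝ :=
  ∫ y, y ∂(condDistrib (fun x : Obs d => x.1) (fun x : Obs d => x.2) P (false, z))

/-- `π_P = P(A = 1)`. -/
def treatProb {d : ℕ} (P : Measure (Obs d)) : ℝ := P.real {x | x.2.1 = true}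

/-- The G-computed conditional mean `ψ(P) = E_P[μ_P(Z) ∣ A = 1]`. -/
def gMean {d : ℕ} (P : Measure (Obs d)) [IsFiniteMeasure P] : ℝ :=
  ∫ x, outcomeReg P x.2.2 ∂(P[|{x : Obs d | x.2.1 = true}])

/-- The function `φ_{ψ,η}` for `η` given by `μ`, `g` and `π`:
`(y,a,z) ↦ I(a=0) g(z) / (π [1 - g(z)]) [y - μ(z)] + I(a=1) / π [μ(z) - ψ]`. -/
def infl {d : ℕ} (μ g : (Fin d → ℝ) → ℝ) (π ψ : ℝ) (x : Obs d) : ℝ :=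
  control x * g x.2.2 / (π * (1 - g x.2.2)) * (x.1 - μ x.2.2) + treated x / π * (μ x.2.2 - ψ)

/-- The influence function `φ_P` of the G-computed conditional mean. -/
def inflAt {d : ℕ} (P : Measure (Obs d)) [IsFiniteMeasure P] : Obs d → ℝ :=
  infl (outcomeReg P) (propensity P) (treatProb P) (gMean P)

/-- The weighted outcome map `(y,a,z) ↦ (1 - a) y g(z) / [1 - g(z)]`. -/
def weightedOutcome {d : ℕ} (g : (Fin d → ℝ) → ℝ) (x : Obs d) : ℝ :=
  control x * x.1 * g x.2.2 / (1 - g x.2.2)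

/-- `π_n = ∫ g dQ_n`, with `Q_n` the empirical distribution of the covariates. -/
def piHat {d : ℕ} (g : (Fin d → ℝ) → ℝ) (s : ℕ → Obs d) (n : ℕ) : ℝ :=
  empMean s n fun x => g x.2.2

/-- The proportion `\bar π_n` of treated observations. -/
def piBar {d : ℕ} (s : ℕ → Obs d) (n : ℕ) : ℝ := empMean s n treated

/-- The plug-in estimator `ψ(η_n) = ∫ μ g π_n⁻¹ dQ_n`. -/
def plugIn {d : ℕ} (μ g : (Fin d → ℝ) → ℝ) (s : ℕ → Obs d) (n : ℕ) : ℝ :=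
  empMean s n fun x => μ x.2.2 * g x.2.2 * (piHat g s n)⁻¹

/-- The one-step estimator `ψ(η_n) + ℙ_n φ_{η_n}`. -/
def oneStep {d : ℕ} (μ g : (Fin d → ℝ) → ℝ) (s : ℕ → Obs d) (n : ℕ) : ℝ :=
  plugIn μ g s n + empMean s n (infl μ g (piHat g s n) (plugIn μ g s n))

/-- The variant `n⁻¹ ∑ I(A_i = 1) μ(Z_i) / π_n` of the plug-in estimator. -/
def plugInTreated {d : ℕ} (μ g : (Fin d → ℝ) → ℝ) (s : ℕ → Obs d) (n : ℕ) : ℝ :=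
  empMean s n fun x => treated x / piHat g s n * μ x.2.2

/-- The one-step estimator in closed form, with `2 - \bar π_n / π_n` as the weight of the second
term; it is the one-step correction of `plugInTreated`, see `oneStepTreated_eq`. -/
def oneStepTreated {d : ℕ} (μ g : (Fin d → ℝ) → ℝ) (s : ℕ → Obs d) (n : ℕ) : ℝ :=
  empMean s n fun x =>
    control x * g x.2.2 / (piHat g s n * (1 - g x.2.2)) * (x.1 - μ x.2.2) +
      (2 - piBar s n / piHat g s n) * (treated x / piHat g s n) * μ x.2.2

/-- The estimating equations-based estimator, the root `ψ` of `ℙ_n φ_{ψ,η_n} = 0`, in closed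
form; see `estEq_iff`. -/
def estEq {d : ℕ} (μ g : (Fin d → ℝ) → ℝ) (s : ℕ → Obs d) (n : ℕ) : ℝ :=
  empMean s n fun x =>
    control x * g x.2.2 / (piBar s n * (1 - g x.2.2)) * (x.1 - μ x.2.2) +
      treated x / piBar s n * μ x.2.2

theorem empMean_add {S : Type*} (s : ℕ → S) (n : ℕ) (f h : S → ℝ) :
    empMean s n (fun x => f x + h x) = empMean s n f + empMean s n h := by
  simp [empMean, Finset.sum_add_distrib, add_div]

theorem empMean_mul {S : Type*} (s : ℕ → S) (n : ℕ) (c : ℝ) (f : S → ℝ) :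
    empMean s n (fun x => c * f x) = c * empMean s n f := by
  simp [empMean, ← Finset.mul_sum, mul_div_assoc]

theorem empMean_infl {d : ℕ} (μ g : (Fin d → ℝ) → ℝ) (π ψ : ℝ) (s : ℕ → Obs d) (n : ℕ) :
    empMean s n (infl μ g π ψ) =
      π⁻¹ * empMean s n (fun x => control x * g x.2.2 / (1 - g x.2.2) * (x.1 - μ x.2.2)) +
        π⁻¹ * empMean s n (fun x => treated x * μ x.2.2) + (-(ψ * π⁻¹)) * piBar s n := by
  rw [piBar, ← empMean_mul, ← empMean_mul, ← empMean_mul, ← empMean_add, ← empMean_add]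
  congr 1
  funext x
  simp only [infl, div_eq_mul_inv, mul_inv]
  ring

/-- The closed-form one-step estimator is `ψ̃ + ℙ_n φ_{ψ̃,η_n}` for `ψ̃ = plugInTreated`. -/
theorem oneStepTreated_eq {d : ℕ} (μ g : (Fin d → ℝ) → ℝ) (s : ℕ → Obs d) (n : ℕ) :
    oneStepTreated μ g s n = plugInTreated μ g s n +
      empMean s n (infl μ g (piHat g s n) (plugInTreated μ g s n)) := by
  have h : plugInTreated μ g s n =
      (piHat g s n)⁻¹ * empMean s n (fun x => treated x * μ x.2.2) := by
    rw [plugInTreated, ← empMean_mul]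
    congr 1
    funext x
    simp only [div_eq_mul_inv]
    ring
  have h2 : oneStepTreated μ g s n = (piHat g s n)⁻¹ *
      empMean s n (fun x => control x * g x.2.2 / (1 - g x.2.2) * (x.1 - μ x.2.2)) +
      ((2 - piBar s n / piHat g s n) * (piHat g s n)⁻¹) *
        empMean s n (fun x => treated x * μ x.2.2) := by
    rw [← empMean_mul, ← empMean_mul, ← empMean_add, oneStepTreated]
    congr 1
    funext x
    simp only [div_eq_mul_inv, mul_inv]
    ring
  rw [empMean_infl, h2, h]
  simp only [div_eq_mul_inv]
  ring

/-- `estEq` is the unique root of the sample estimating function `ψ ↦ ℙ_n φ_{ψ,η_n}`. -/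
theorem estEq_iff {d : ℕ} (μ g : (Fin d → ℝ) → ℝ) (s : ℕ → Obs d) (n : ℕ)
    (hπ : piHat g s n ≠ 0) (hbar : piBar s n ≠ 0) (ψ : ℝ) :
    empMean s n (infl μ g (piHat g s n) ψ) = 0 ↔ ψ = estEq μ g s n := by
  have h2 : estEq μ g s n = (piBar s n)⁻¹ *
      empMean s n (fun x => control x * g x.2.2 / (1 - g x.2.2) * (x.1 - μ x.2.2)) +
      (piBar s n)⁻¹ * empMean s n (fun x => treated x * μ x.2.2) := by
    rw [← empMean_mul, ← empMean_mul, ← empMean_add, estEq]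
    congr 1
    funext x
    simp only [div_eq_mul_inv, mul_inv]
    ring
  rw [empMean_infl, h2]
  field_simp
  constructor <;> intro h <;> linarith

end GComp

end

open GComp

/-! Each of the three estimators is an explicit function of the empirical mean of one unnormalized
function, `score`, and of the normalizations `piHat` and `piBar`. Two facts about `score` carry the
theorem. First, its mean at arbitrary nuisance values differs from `treatProb * gMean` exactly by
the integral of (γ - g₀)(m - μ₀)/(1 - γ) (`integral_score`), which the product-rate hypothesis makes
o(n^{-1/2}). Second, the empirical process at the difference between the estimated and the true
score tends to zero. Together they give `RegularNuisance.tendsto_remainder`: plugging in the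
estimators changes the empirical mean by o(n^{-1/2}). Since the true score minus ψ₀ times the
treatment indicator has mean zero, a consistent estimate of π₀ in the denominator is also harmless
(`RegularNuisance.tendsto_normalization`). What is left over for a one-step estimator is (π_n - \bar
π_n)(ψ_n - ψ₀)/π_n, which the extra rate condition controls.

The work lies in the second fact. The score contains products and odds of the estimators, while the
Donsker hypotheses concern μ_n, g_n and the weighted outcome separately, and no measurability of
suprema is available. The permanence properties are therefore proved in a local form,
`StochEquicont`: L₂-smallness along a filter together with smallness of the empirical process, in
outer probability, uniformly over a member of the filter. A Donsker class supplies it by tightness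
of the limit (`IsDonsker.stochEquicont`). It passes through pointwise Lipschitz maps
(`StochEquicont.contraction`), hence to truncations, odds and, by polarization, bounded products.

The Lipschitz step converts a bound in outer probability for the original process into one for the
transformed process: pass to signed sums by splitting the sample according to the signs
(`signed_le`), compare signed sums for fixed data on the discrete cube (`card_exists_lt_rad_le`),
and return by `symmetrization`. Only probabilities are controlled, never expectations, so the cube
argument needs a Kahane-type inequality (`sum_iSup_le_of_card`), obtained from the Efron–Stein
inequality. To integrate over the data despite non-measurability, function values are rounded to a
grid, which leaves countably many events and allows their measurable hulls to be taken at once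
(`sum_rad_contraction_le`). -/

namespace GComp

/-! ### Rademacher averages over the discrete cube -/

/-- The sign attached to a Boolean. -/
def sgn (b : Bool) : ℝ := if b then 1 else -1

/-- The Rademacher sum `∑ ε_i u_i`. -/
def rad {ι : Type*} [Fintype ι] (ε : ι → Bool) (u : ι → ℝ) : ℝ := ∑ i, sgn (ε i) * u i

theorem sgn_not (b : Bool) : sgn (!b) = -sgn b := by cases b <;> simp [sgn]

theorem abs_sgn (b : Bool) : |sgn b| = 1 := by cases b <;> simp [sgn]

theorem sum_comp_flip {ι : Type*} [Fintype ι] [DecidableEq ι] (i : ι) (f : (ι → Bool) → ℝ) :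
    ∑ ε, f (Function.update ε i (!ε i)) = ∑ ε, f ε := by
  have hinv : Function.Involutive fun ε : ι → Bool => Function.update ε i (!ε i) := by
    intro ε
    simp
  exact Equiv.sum_comp hinv.toPerm f

theorem sum_comp_neg {ι : Type*} [Fintype ι] [DecidableEq ι] (f : (ι → Bool) → ℝ) :
    ∑ ε : ι → Bool, f (fun i => !ε i) = ∑ ε, f ε := by
  have hinv : Function.Involutive fun (ε : ι → Bool) (i : ι) => !ε i := by
    intro ε
    simp
  exact Equiv.sum_comp hinv.toPerm f

theorem rad_neg {ι : Type*} [Fintype ι] (ε : ι → Bool) (u : ι → ℝ) :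
    rad (fun i => !ε i) u = -rad ε u := by
  simp [rad, sgn_not]

theorem le_iSup_finite {κ : Type*} [Finite κ] (f : κ → ℝ) (t : κ) : f t ≤ ⨆ t, f t :=
  le_ciSup (Set.finite_range f).bddAbove t

/-! ### Comparison principles for suprema over finite families. -/

section Sup

variable {κ : Type*} [Finite κ] [Nonempty κ]

/-- Take maximizers `t₁`, `t₂` of the two suprema on the left. They are competitors on the right, in
this order or interchanged; the sign of `s * (y t₁ - y t₂)` decides which order turns the increment
of `y` into its absolute value. -/
theorem iSup_add_iSup_le (A x y : κ → ℝ) (s : ℝ) (hs : |s| = 1)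
    (h : ∀ t t', |x t - x t'| ≤ |y t - y t'|) :
    (⨆ t, (A t + s * x t)) + (⨆ t, (A t + -s * x t)) ≤
      (⨆ t, (A t + s * y t)) + ⨆ t, (A t + -s * y t) := by
  obtain ⟨t₁, h₁⟩ := exists_eq_ciSup_of_finite (f := fun t => A t + s * x t)
  obtain ⟨t₂, h₂⟩ := exists_eq_ciSup_of_finite (f := fun t => A t + -s * x t)
  rw [← h₁, ← h₂]
  have key : s * (x t₁ - x t₂) ≤ |s * (y t₁ - y t₂)| := by
    refine (le_abs_self _).trans ?_
    rw [abs_mul, abs_mul, hs, one_mul, one_mul]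
    exact h t₁ t₂
  rcases le_total 0 (s * (y t₁ - y t₂)) with h0 | h0
  · rw [abs_of_nonneg h0] at key
    have e₁ := le_iSup_finite (fun t => A t + s * y t) t₁
    have e₂ := le_iSup_finite (fun t => A t + -s * y t) t₂
    linarith
  · rw [abs_of_nonpos h0] at key
    have e₁ := le_iSup_finite (fun t => A t + s * y t) t₂
    have e₂ := le_iSup_finite (fun t => A t + -s * y t) t₁
    linarith

variable {ι : Type*} [Fintype ι] [DecidableEq ι]

theorem rad_update (ε : ι → Bool) (i : ι) (u : ι → ℝ) (b : Bool) :
    rad (Function.update ε i b) u = (∑ j ∈ Finset.univ.erase i, sgn (ε j) * u j) + sgn b * u i := by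
  rw [rad, ← Finset.sum_erase_add _ _ (Finset.mem_univ i)]
  congr 1
  · refine Finset.sum_congr rfl fun j hj => ?_
    rw [Function.update_of_ne (Finset.ne_of_mem_erase hj)]
  · simp

/-- Pairing each sign vector with its flip at `i` freezes all other coordinates, and each pair is an
instance of `iSup_add_iSup_le`. -/
theorem contraction_single (i : ι) (v w : κ → ι → ℝ) (hvw : ∀ t, ∀ j ≠ i, v t j = w t j)
    (h : ∀ t t', |v t i - v t' i| ≤ |w t i - w t' i|) :
    ∑ ε : ι → Bool, (⨆ t, rad ε (v t)) ≤ ∑ ε : ι → Bool, ⨆ t, rad ε (w t) := by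
  have e : ∀ u : κ → ι → ℝ, ∑ ε : ι → Bool, (⨆ t, rad ε (u t)) =
      (1 / 2) * ∑ ε : ι → Bool,
        ((⨆ t, rad ε (u t)) + ⨆ t, rad (Function.update ε i (!ε i)) (u t)) := by
    intro u
    rw [Finset.sum_add_distrib, sum_comp_flip i fun ε => ⨆ t, rad ε (u t)]
    ring
  rw [e, e]
  refine mul_le_mul_of_nonneg_left (Finset.sum_le_sum fun ε _ => ?_) (by norm_num)
  have r : ∀ (u : κ → ι → ℝ) t, rad ε (u t) =
      (∑ j ∈ Finset.univ.erase i, sgn (ε j) * u t j) + sgn (ε i) * u t i := by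
    intro u t
    rw [← rad_update, Function.update_eq_self]
  have r' : ∀ (u : κ → ι → ℝ) t, rad (Function.update ε i (!ε i)) (u t) =
      (∑ j ∈ Finset.univ.erase i, sgn (ε j) * u t j) + -sgn (ε i) * u t i := by
    intro u t
    rw [rad_update, sgn_not]
  have hA : ∀ t, ∑ j ∈ Finset.univ.erase i, sgn (ε j) * v t j =
      ∑ j ∈ Finset.univ.erase i, sgn (ε j) * w t j := fun t =>
    Finset.sum_congr rfl fun j hj => by rw [hvw t j (Finset.ne_of_mem_erase hj)]
  simp only [r, r', hA]
  exact iSup_add_iSup_le _ _ _ _ (abs_sgn _) h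

/-- The Ledoux–Talagrand comparison principle for Rademacher sums. -/
theorem contraction_sup (v w : κ → ι → ℝ)
    (h : ∀ t t' i, |v t i - v t' i| ≤ |w t i - w t' i|) :
    ∑ ε : ι → Bool, (⨆ t, rad ε (v t)) ≤ ∑ ε : ι → Bool, ⨆ t, rad ε (w t) := by
  -- The coordinates of `v` are exchanged for those of `w` one at a time.
  have key : ∀ J : Finset ι, ∑ ε : ι → Bool, (⨆ t, rad ε (v t)) ≤
      ∑ ε : ι → Bool, ⨆ t, rad ε (fun j => if j ∈ J then w t j else v t j) := by
    intro J
    induction J using Finset.induction_on with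
    | empty => simp
    | insert i J hi ih =>
      refine ih.trans (contraction_single i _ _ ?_ ?_)
      · intro t j hj
        simp [hj]
      · intro t t'
        simpa [hi] using h t t' i
  simpa using key Finset.univ

/-- The comparison principle for suprema of absolute values. -/
theorem contraction_abs (v w : κ → ι → ℝ)
    (h : ∀ t t' i, |v t i - v t' i| ≤ |w t i - w t' i|) (h0 : ∀ t i, |v t i| ≤ |w t i|) :
    ∑ ε : ι → Bool, (⨆ t, |rad ε (v t)|) ≤ 2 * ∑ ε : ι → Bool, ⨆ t, |rad ε (w t)| := by
  -- The zero vector joins the family, so both one-sided suprema are nonnegative and their sum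
  -- dominates the supremum of absolute values; the flip of all signs then gives the factor 2.
  -- Hypothesis `h0` is the increment condition against the new index.
  set v' : Option κ → ι → ℝ := fun o => o.elim 0 v
  set w' : Option κ → ι → ℝ := fun o => o.elim 0 w
  have hrad0 : ∀ ε : ι → Bool, rad ε 0 = 0 := fun ε => by simp [rad]
  have h1 : ∑ ε : ι → Bool, (⨆ t, |rad ε (v t)|) ≤
      ∑ ε : ι → Bool, ((⨆ o, rad ε (v' o)) + ⨆ o, rad (fun i => !ε i) (v' o)) := by
    refine Finset.sum_le_sum fun ε _ => ciSup_le fun t => ?_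
    have a1 : 0 ≤ ⨆ o, rad ε (v' o) :=
      (hrad0 ε).symm.le.trans (le_iSup_finite (fun o => rad ε (v' o)) none)
    have a2 : rad ε (v t) ≤ ⨆ o, rad ε (v' o) := le_iSup_finite (fun o => rad ε (v' o)) (some t)
    have a3 : 0 ≤ ⨆ o, rad (fun i => !ε i) (v' o) :=
      (hrad0 _).symm.le.trans (le_iSup_finite (fun o => rad (fun i => !ε i) (v' o)) none)
    have a4 : -rad ε (v t) ≤ ⨆ o, rad (fun i => !ε i) (v' o) :=
      (rad_neg ε (v t)).symm.le.trans
        (le_iSup_finite (fun o => rad (fun i => !ε i) (v' o)) (some t))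
    rw [abs_le]
    constructor <;> linarith
  rw [Finset.sum_add_distrib, sum_comp_neg fun ε => ⨆ o, rad ε (v' o)] at h1
  have h2 : ∑ ε : ι → Bool, (⨆ o, rad ε (v' o)) ≤ ∑ ε : ι → Bool, ⨆ o, rad ε (w' o) := by
    refine contraction_sup _ _ fun o o' i => ?_
    rcases o with _ | t <;> rcases o' with _ | t'
    · simp [v', w']
    · simpa [v', w'] using h0 t' i
    · simpa [v', w'] using h0 t i
    · exact h t t' i
  have h3 : ∑ ε : ι → Bool, (⨆ o, rad ε (w' o)) ≤ ∑ ε : ι → Bool, ⨆ t, |rad ε (w t)| := by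
    refine Finset.sum_le_sum fun ε _ => ciSup_le fun o => ?_
    rcases o with _ | t
    · obtain ⟨t⟩ := ‹Nonempty κ›
      simp only [w', Option.elim, hrad0]
      exact (abs_nonneg _).trans (le_iSup_finite (fun t => |rad ε (w t)|) t)
    · exact (le_abs_self _).trans (le_iSup_finite (fun t => |rad ε (w t)|) t)
  linarith

end Sup

/-! ### Moments, variance and quantiles on the discrete cube. -/

theorem sum_cube_succ {n : ℕ} (f : (Fin (n + 1) → Bool) → ℝ) :
    ∑ ε, f ε = ∑ ε : Fin n → Bool, (f (Fin.cons true ε) + f (Fin.cons false ε)) := by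
  rw [← (Fin.consEquiv fun _ => Bool).sum_comp, Fintype.sum_prod_type]
  simp [Fin.consEquiv, Finset.sum_add_distrib]

theorem rad_cons {n : ℕ} (b : Bool) (ε : Fin n → Bool) (u : Fin (n + 1) → ℝ) :
    rad (Fin.cons b ε) u = sgn b * u 0 + rad ε (fun i => u i.succ) := by
  simp [rad, Fin.sum_univ_succ]

theorem sum_rad_sq {n : ℕ} (u : Fin n → ℝ) :
    ∑ ε : Fin n → Bool, rad ε u ^ 2 = 2 ^ n * ∑ i, u i ^ 2 := by
  induction n with
  | zero => simp [rad]
  | succ n ih =>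
    have e : ∀ ε : Fin n → Bool, rad (Fin.cons true ε) u ^ 2 + rad (Fin.cons false ε) u ^ 2 =
        2 * u 0 ^ 2 + 2 * rad ε (fun i => u i.succ) ^ 2 := by
      intro ε
      simp only [rad_cons, sgn]
      norm_num
      ring
    rw [sum_cube_succ, Finset.sum_congr rfl fun ε _ => e ε, Finset.sum_add_distrib,
      ← Finset.mul_sum Finset.univ (fun ε => rad ε _ ^ 2), ih, Fin.sum_univ_succ]
    simp
    ring

theorem sum_rad_pow_four_le {n : ℕ} (u : Fin n → ℝ) :
    ∑ ε : Fin n → Bool, rad ε u ^ 4 ≤ 2 ^ n * (3 * (∑ i, u i ^ 2) ^ 2) := by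
  induction n with
  | zero => simp [rad]
  | succ n ih =>
    have e : ∀ ε : Fin n → Bool, rad (Fin.cons true ε) u ^ 4 + rad (Fin.cons false ε) u ^ 4 =
        2 * u 0 ^ 4 + 12 * u 0 ^ 2 * rad ε (fun i => u i.succ) ^ 2 +
          2 * rad ε (fun i => u i.succ) ^ 4 := by
      intro ε
      simp only [rad_cons, sgn]
      norm_num
      ring
    rw [sum_cube_succ, Finset.sum_congr rfl fun ε _ => e ε, Finset.sum_add_distrib,
      Finset.sum_add_distrib, ← Finset.mul_sum Finset.univ (fun ε => rad ε _ ^ 2),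
      ← Finset.mul_sum Finset.univ (fun ε => rad ε _ ^ 4), sum_rad_sq, Fin.sum_univ_succ]
    have h := ih fun i => u i.succ
    have hp : (0 : ℝ) ≤ 2 ^ n * u 0 ^ 4 := by positivity
    simp only [Finset.sum_const, Finset.card_univ, Fintype.card_fun, Fintype.card_bool,
      Fintype.card_fin, nsmul_eq_mul, Nat.cast_pow, Nat.cast_ofNat, pow_succ (2 : ℝ) n]
    nlinarith

/-- The Efron–Stein (Poincaré) inequality on the discrete cube. -/
theorem efron_stein {n : ℕ} (f : (Fin n → Bool) → ℝ) :
    2 ^ n * ∑ ε, f ε ^ 2 - (∑ ε, f ε) ^ 2 ≤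
      2 ^ n / 4 * ∑ i, ∑ ε, (f ε - f (Function.update ε i (!ε i))) ^ 2 := by
  induction n with
  | zero => simp
  | succ n ih =>
    set p : (Fin n → Bool) → ℝ := fun ε => f (Fin.cons true ε)
    set q : (Fin n → Bool) → ℝ := fun ε => f (Fin.cons false ε)
    have h0 : ∑ ε, (f ε - f (Function.update ε 0 (!ε 0))) ^ 2 = 2 * ∑ ε, (p ε - q ε) ^ 2 := by
      rw [sum_cube_succ, Finset.mul_sum]
      refine Finset.sum_congr rfl fun ε _ => ?_
      simp only [Fin.cons_zero, Bool.not_true, Bool.not_false, Fin.update_cons_zero, p, q]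
      ring
    have hs : ∀ i : Fin n, ∑ ε, (f ε - f (Function.update ε i.succ (!ε i.succ))) ^ 2 =
        ∑ ε, ((p ε - p (Function.update ε i (!ε i))) ^ 2 +
          (q ε - q (Function.update ε i (!ε i))) ^ 2) := by
      intro i
      rw [sum_cube_succ]
      refine Finset.sum_congr rfl fun ε _ => ?_
      simp only [Fin.cons_succ, p, q, ← Fin.cons_update]
    -- Averaging out the first coordinate leaves `p + q`, up to a factor, to which the induction
    -- applies; the variance in the first coordinate is exactly the `p - q` term, by the
    -- parallelogram identity `hsq`.
    have hg := ih fun ε => p ε + q ε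
    have hle : ∑ i, ∑ ε, (p ε + q ε -
          (p (Function.update ε i (!ε i)) + q (Function.update ε i (!ε i)))) ^ 2 ≤
        2 * ∑ i : Fin n, ∑ ε, ((p ε - p (Function.update ε i (!ε i))) ^ 2 +
          (q ε - q (Function.update ε i (!ε i))) ^ 2) := by
      simp only [Finset.mul_sum]
      refine Finset.sum_le_sum fun i _ => Finset.sum_le_sum fun ε _ => ?_
      nlinarith [sq_nonneg (p ε - p (Function.update ε i (!ε i)) -
        (q ε - q (Function.update ε i (!ε i))))]
    have hsq : ∑ ε, (p ε + q ε) ^ 2 + ∑ ε, (p ε - q ε) ^ 2 = 2 * ∑ ε, (p ε ^ 2 + q ε ^ 2) := by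
      rw [← Finset.sum_add_distrib, Finset.mul_sum]
      exact Finset.sum_congr rfl fun ε _ => by ring
    rw [Fin.sum_univ_succ, h0, Finset.sum_congr rfl fun i _ => hs i, sum_cube_succ,
      sum_cube_succ f]
    change 2 ^ (n + 1) * ∑ ε, (p ε ^ 2 + q ε ^ 2) - (∑ ε, (p ε + q ε)) ^ 2 ≤ _
    have hpos : (0 : ℝ) < 2 ^ n := by positivity
    rw [pow_succ]
    have := mul_le_mul_of_nonneg_left hle (show (0 : ℝ) ≤ 2 ^ n / 4 by positivity)
    nlinarith

/-- A Paley–Zygmund argument: since the fourth moment is at most three times the squared second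
moment, a Rademacher sum cannot be small on most of the cube unless its variance is small. -/
theorem sum_sq_le_of_card {n : ℕ} (u : Fin n → ℝ) (c : ℝ)
    (h : 12 * ((Finset.univ.filter fun ε : Fin n → Bool => c < |rad ε u|).card : ℝ) ≤ 2 ^ n) :
    ∑ i, u i ^ 2 ≤ 2 * c ^ 2 := by
  set s := ∑ i, u i ^ 2
  have hs : 0 ≤ s := Finset.sum_nonneg fun i _ => sq_nonneg _
  rcases hs.eq_or_lt with h0 | hpos
  · rw [← h0]; positivity
  have h2 := sum_rad_sq u
  have h4 := sum_rad_pow_four_le u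
  -- Where the sum exceeds `c` this is the arithmetic-geometric mean inequality. The weights are
  -- chosen so that averaging gives `s ≤ c² + s/4 + s/4`.
  have hpt : ∀ ε : Fin n → Bool, rad ε u ^ 2 ≤
      c ^ 2 + rad ε u ^ 4 / (12 * s) + 3 * s * (if c < |rad ε u| then 1 else 0) := by
    intro ε
    split_ifs with hc
    · have e : rad ε u ^ 4 / (12 * s) + 3 * s - rad ε u ^ 2 = (rad ε u ^ 2 - 6 * s) ^ 2 / (12 * s) := by
        field_simp
        ring
      have : 0 ≤ (rad ε u ^ 2 - 6 * s) ^ 2 / (12 * s) := by positivity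
      nlinarith [sq_nonneg c]
    · have h1 : rad ε u ^ 2 ≤ c ^ 2 := sq_le_sq' (by linarith [neg_abs_le (rad ε u)])
        ((le_abs_self _).trans (not_lt.1 hc))
      have : 0 ≤ rad ε u ^ 4 / (12 * s) := by positivity
      linarith
  have hsum := Finset.sum_le_sum fun ε (_ : ε ∈ Finset.univ) => hpt ε
  rw [Finset.sum_add_distrib, Finset.sum_add_distrib, h2, ← Finset.mul_sum, Finset.sum_boole,
    ← Finset.sum_div] at hsum
  have h4' : (∑ ε : Fin n → Bool, rad ε u ^ 4) / (12 * s) ≤ 2 ^ n * (s / 4) := by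
    rw [div_le_iff₀ (by positivity)]
    nlinarith
  simp only [Finset.sum_const, Finset.card_univ, Fintype.card_fun, Fintype.card_bool,
      Fintype.card_fin, nsmul_eq_mul, Nat.cast_pow, Nat.cast_ofNat] at hsum
  have hp : (0 : ℝ) < 2 ^ n := by positivity
  have h5 : 2 ^ n * s ≤ 2 ^ n * (2 * c ^ 2) := by nlinarith
  exact le_of_mul_le_mul_left h5 hp

/-- The variance of the supremum is governed by the largest variance in the family, with no
dependence on its cardinality: a downward jump under a flip is bounded through the single index that
attains the supremum. -/
theorem efron_stein_iSup {n : ℕ} {κ : Type*} [Finite κ] [Nonempty κ] (w : κ → Fin n → ℝ) (b : ℝ)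
    (hb : ∀ t, ∑ i, w t i ^ 2 ≤ b) :
    2 ^ n * ∑ ε : Fin n → Bool, (⨆ t, |rad ε (w t)|) ^ 2 -
      (∑ ε : Fin n → Bool, ⨆ t, |rad ε (w t)|) ^ 2 ≤ 2 ^ n * (2 ^ n * (2 * b)) := by
  set m : (Fin n → Bool) → ℝ := fun ε => ⨆ t, |rad ε (w t)|
  refine (efron_stein m).trans ?_
  have hd : ∀ ε : Fin n → Bool, ∑ i, (max (m ε - m (Function.update ε i (!ε i))) 0) ^ 2 ≤ 4 * b := by
    intro ε
    obtain ⟨t, ht⟩ := exists_eq_ciSup_of_finite (f := fun t => |rad ε (w t)|)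
    have h1 : ∀ i, (max (m ε - m (Function.update ε i (!ε i))) 0) ^ 2 ≤ 4 * w t i ^ 2 := by
      intro i
      have h2 : m ε - m (Function.update ε i (!ε i)) ≤ |2 * w t i| := by
        have h3 := le_iSup_finite (fun t => |rad (Function.update ε i (!ε i)) (w t)|) t
        have h4 : m ε = |rad ε (w t)| := ht.symm
        have h5 : rad ε (w t) - rad (Function.update ε i (!ε i)) (w t) = sgn (ε i) * (2 * w t i) := by
          conv_lhs => rw [← Function.update_eq_self i ε]
          rw [rad_update]
          simp only [Function.update_self, Function.update_idem]
          rw [rad_update, sgn_not]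
          ring
        have h6 := abs_sub_abs_le_abs_sub (rad ε (w t)) (rad (Function.update ε i (!ε i)) (w t))
        rw [h5, abs_mul, abs_sgn, one_mul] at h6
        rw [h4]
        linarith
      have h7 : max (m ε - m (Function.update ε i (!ε i))) 0 ≤ |2 * w t i| := max_le h2 (abs_nonneg _)
      calc _ ≤ |2 * w t i| ^ 2 := pow_le_pow_left₀ (le_max_right _ _) h7 2
        _ = 4 * w t i ^ 2 := by rw [sq_abs]; ring
    calc _ ≤ ∑ i, 4 * w t i ^ 2 := Finset.sum_le_sum fun i _ => h1 i
      _ ≤ 4 * b := by rw [← Finset.mul_sum]; linarith [hb t]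
  -- The flip exchanges positive and negative parts of the increment, so bounding the positive
  -- parts, as in `hd`, is enough.
  have hsymm : ∀ i, ∑ ε, (m ε - m (Function.update ε i (!ε i))) ^ 2 =
      2 * ∑ ε, (max (m ε - m (Function.update ε i (!ε i))) 0) ^ 2 := by
    intro i
    have h1 := sum_comp_flip i fun ε => (max (m ε - m (Function.update ε i (!ε i))) 0) ^ 2
    simp only [Function.update_self, Function.update_idem, Bool.not_not,
      Function.update_eq_self] at h1
    rw [two_mul]
    nth_rewrite 2 [← h1]
    rw [← Finset.sum_add_distrib]
    refine Finset.sum_congr rfl fun ε _ => ?_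
    rcases le_total (m ε) (m (Function.update ε i (!ε i))) with h | h
    · rw [max_eq_right (by linarith), max_eq_left (by linarith)]; ring
    · rw [max_eq_left (by linarith), max_eq_right (by linarith)]; ring
  rw [Finset.sum_congr rfl fun i _ => hsymm i, ← Finset.mul_sum, Finset.sum_comm]
  have := Finset.sum_le_sum fun ε (_ : ε ∈ Finset.univ) => hd ε
  simp only [Finset.sum_const, Finset.card_univ, Fintype.card_fun, Fintype.card_bool,
      Fintype.card_fin, nsmul_eq_mul, Nat.cast_pow, Nat.cast_ofNat] at this
  have hp : (0 : ℝ) < 2 ^ n := by positivity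
  nlinarith

/-- A Kahane-type inequality: a quantile of a Rademacher supremum controls its mean. -/
theorem sum_iSup_le_of_card {n : ℕ} {κ : Type*} [Finite κ] [Nonempty κ] (w : κ → Fin n → ℝ)
    (c : ℝ) (hc : 0 < c)
    (h : 12 * ((Finset.univ.filter fun ε : Fin n → Bool => c < ⨆ t, |rad ε (w t)|).card : ℝ) ≤
      2 ^ n) :
    ∑ ε : Fin n → Bool, (⨆ t, |rad ε (w t)|) ≤ 2 ^ n * (4 * c) := by
  set m : (Fin n → Bool) → ℝ := fun ε => ⨆ t, |rad ε (w t)|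
  have hσ : ∀ t, ∑ i, w t i ^ 2 ≤ 2 * c ^ 2 := by
    intro t
    refine sum_sq_le_of_card _ c (le_trans ?_ h)
    have hsub : (Finset.univ.filter fun ε : Fin n → Bool => c < |rad ε (w t)|) ⊆
        Finset.univ.filter fun ε : Fin n → Bool => c < ⨆ t, |rad ε (w t)| := by
      refine Finset.monotone_filter_right _ fun ε _ h1 => ?_
      exact h1.trans_le (le_iSup_finite (fun t => |rad ε (w t)|) t)
    have := Finset.card_le_card hsub
    gcongr
  have hv := efron_stein_iSup w _ hσ
  change 2 ^ n * ∑ ε, m ε ^ 2 - (∑ ε, m ε) ^ 2 ≤ _ at hv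
  by_contra! hcon
  set E := (∑ ε, m ε) / 2 ^ n
  have hp : (0 : ℝ) < 2 ^ n := by positivity
  have hE : ∑ ε, m ε = 2 ^ n * E := by simp only [E]; field_simp
  change 2 ^ n * (4 * c) < ∑ ε, m ε at hcon
  rw [hE] at hcon hv
  have hE4 : 4 * c < E := lt_of_mul_lt_mul_left hcon hp.le
  -- If the mean exceeded `4c`, then on at least 11/12 of the cube `m` would be at least `3c` below
  -- its mean. The variance would be at least `(11/12) * 9c²`, whereas Efron–Stein allows at most
  -- `4c²`.
  have hpt : ∀ ε, 9 * c ^ 2 * (1 - if c < m ε then 1 else 0) ≤ (m ε - E) ^ 2 := by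
    intro ε
    split_ifs with h1
    · simpa using sq_nonneg (m ε - E)
    · nlinarith
  have hsum := Finset.sum_le_sum fun ε (_ : ε ∈ Finset.univ) => hpt ε
  rw [← Finset.mul_sum, Finset.sum_sub_distrib, Finset.sum_boole] at hsum
  have hvar : ∑ ε, (m ε - E) ^ 2 = ∑ ε, m ε ^ 2 - 2 ^ n * E ^ 2 := by
    have : ∀ ε, (m ε - E) ^ 2 = m ε ^ 2 - 2 * E * m ε + E ^ 2 := fun ε => by ring
    simp only [this, Finset.sum_add_distrib, Finset.sum_sub_distrib, ← Finset.mul_sum, hE]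
    simp
    ring
  rw [hvar] at hsum
  simp only [Finset.sum_const, Finset.card_univ, Fintype.card_fun, Fintype.card_bool,
      Fintype.card_fin, nsmul_eq_mul, Nat.cast_pow, Nat.cast_ofNat, mul_one] at hsum
  have hv2 : ∑ ε, m ε ^ 2 - 2 ^ n * E ^ 2 ≤ 2 ^ n * (2 * (2 * c ^ 2)) :=
    le_of_mul_le_mul_left (by nlinarith) hp
  change 12 * ((Finset.univ.filter fun ε : Fin n → Bool => c < m ε).card : ℝ) ≤ 2 ^ n at h
  nlinarith [mul_pos hp (pow_pos hc 2)]

open Classical in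
/-- Comparison of Rademacher suprema in probability, over an arbitrary set of vectors. -/
theorem card_exists_lt_rad_le {n : ℕ} (T : Set (Fin n → ℝ)) (φ : Fin n → ℝ → ℝ) {L c s : ℝ}
    (hc : 0 < c) (hL : 0 ≤ L) (hφ0 : ∀ i, φ i 0 = 0)
    (hφ : ∀ i a b, |φ i a - φ i b| ≤ L * |a - b|)
    (h : 12 * ((Finset.univ.filter fun ε : Fin n → Bool => ∃ t ∈ T, c < |rad ε t|).card : ℝ) ≤
      2 ^ n) :
    s * ((Finset.univ.filter fun ε : Fin n → Bool =>
      ∃ t ∈ T, s < |rad ε fun i => φ i (t i)|).card : ℝ) ≤ 2 ^ n * (8 * L * c) := by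
  have hrad0 : ∀ ε : Fin n → Bool, rad ε 0 = 0 := fun ε => by simp [rad]
  -- One witness per sign vector suffices, so the arbitrary set `T` is replaced by a finite family
  -- indexed by the cube itself. Zero stands in where no witness exists and cannot exceed the
  -- positive level `c`.
  have hch : ∀ ε : Fin n → Bool, ∃ t : Fin n → ℝ, (t ∈ T ∨ t = 0) ∧
      ((∃ t ∈ T, s < |rad ε fun i => φ i (t i)|) → s < |rad ε fun i => φ i (t i)|) := by
    intro ε
    by_cases hε : ∃ t ∈ T, s < |rad ε fun i => φ i (t i)|
    · obtain ⟨t, ht, hlt⟩ := hε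
      exact ⟨t, Or.inl ht, fun _ => hlt⟩
    · exact ⟨0, Or.inr rfl, fun h => absurd h hε⟩
  choose u hu hus using hch
  have h1 : ∑ ε : Fin n → Bool, (⨆ t, |rad ε (u t)|) ≤ 2 ^ n * (4 * c) := by
    refine sum_iSup_le_of_card u c hc (le_trans ?_ h)
    have hsub : (Finset.univ.filter fun ε : Fin n → Bool => c < ⨆ t, |rad ε (u t)|) ⊆
        Finset.univ.filter fun ε : Fin n → Bool => ∃ t ∈ T, c < |rad ε t| := by
      refine Finset.monotone_filter_right _ fun ε _ h1 => ?_
      obtain ⟨t, ht⟩ := exists_eq_ciSup_of_finite (f := fun t => |rad ε (u t)|)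
      rw [← ht] at h1
      rcases hu t with h2 | h2
      · exact ⟨u t, h2, h1⟩
      · rw [h2, hrad0, abs_zero] at h1
        exact absurd h1 (not_lt.2 hc.le)
    have := Finset.card_le_card hsub
    gcongr
  have h2 := contraction_abs (fun t i => φ i (u t i)) (fun t i => L * u t i)
    (fun t t' i => by
      rw [← mul_sub, abs_mul, abs_of_nonneg hL]
      exact hφ i _ _)
    (fun t i => by
      rw [abs_mul, abs_of_nonneg hL]
      simpa [hφ0] using hφ i (u t i) 0)
  have h3 : ∀ ε : Fin n → Bool, (⨆ t, |rad ε fun i => L * u t i|) = L * ⨆ t, |rad ε (u t)| := by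
    intro ε
    rw [Real.mul_iSup_of_nonneg hL]
    congr 1
    funext t
    rw [← abs_of_nonneg hL, ← abs_mul, abs_of_nonneg hL]
    congr 1
    simp only [rad, Finset.mul_sum]
    exact Finset.sum_congr rfl fun i _ => by ring
  simp only [h3, ← Finset.mul_sum] at h2
  have h4 : s * ((Finset.univ.filter fun ε : Fin n → Bool =>
      ∃ t ∈ T, s < |rad ε fun i => φ i (t i)|).card : ℝ) ≤
      ∑ ε : Fin n → Bool, ⨆ t, |rad ε fun i => φ i (u t i)| := by
    rw [← Finset.sum_boole, Finset.mul_sum]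
    refine Finset.sum_le_sum fun ε _ => ?_
    have h5 := le_iSup_finite (fun t => |rad ε fun i => φ i (u t i)|) ε
    split_ifs with h6
    · rw [mul_one]
      exact (hus ε h6).le.trans h5
    · rw [mul_zero]
      exact (abs_nonneg _).trans h5
  nlinarith [mul_le_mul_of_nonneg_left h1 hL]

/-- The number of unbalanced vectors of signs. -/
theorem card_unbalanced_le {n : ℕ} (hn : 0 < n) {K : ℝ} (hK : 0 < K) :
    ((Finset.univ.filter fun ε : Fin n → Bool => K * √(n : ℝ) < |∑ i, sgn (ε i)|).card : ℝ) ≤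
      2 ^ n / K ^ 2 := by
  have h1 := sum_rad_sq (n := n) fun _ => 1
  have hn' : (0 : ℝ) < n := by exact_mod_cast hn
  have h2 : ((Finset.univ.filter fun ε : Fin n → Bool =>
      K * √(n : ℝ) < |∑ i, sgn (ε i)|).card : ℝ) * (K ^ 2 * n) ≤
      ∑ ε : Fin n → Bool, rad ε (fun _ => 1) ^ 2 := by
    rw [← Finset.sum_boole, Finset.sum_mul]
    refine Finset.sum_le_sum fun ε _ => ?_
    split_ifs with h
    · have h3 : rad ε (fun _ => 1) = ∑ i, sgn (ε i) := by simp [rad]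
      rw [one_mul, h3, ← sq_abs (∑ i, sgn (ε i))]
      calc K ^ 2 * n = (K * √(n : ℝ)) ^ 2 := by rw [mul_pow, Real.sq_sqrt hn'.le]
        _ ≤ _ := pow_le_pow_left₀ (by positivity) h.le 2
    · rw [zero_mul]
      positivity
  rw [h1] at h2
  simp only [one_pow, Finset.sum_const, Finset.card_univ, Fintype.card_fin, nsmul_eq_mul,
    mul_one] at h2
  rw [le_div_iff₀ (by positivity)]
  refine le_of_mul_le_mul_right ?_ hn'
  linarith

theorem sum_sgn_eq {n : ℕ} (ε : Fin n → Bool) :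
    ∑ i, sgn (ε i) = 2 * ((Finset.univ.filter fun i => ε i = true).card : ℝ) - n ∧
      ∑ i, sgn (ε i) = n - 2 * ((Finset.univ.filter fun i => ¬ ε i = true).card : ℝ) := by
  have h1 : ((Finset.univ.filter fun i => ε i = true).card : ℝ) +
      ((Finset.univ.filter fun i => ¬ ε i = true).card : ℝ) = n := by
    rw [← Nat.cast_add, Finset.card_filter_add_card_filter_not]
    simp
  have h2 : ∑ i, sgn (ε i) = ((Finset.univ.filter fun i => ε i = true).card : ℝ) -
      ((Finset.univ.filter fun i => ¬ ε i = true).card : ℝ) := by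
    rw [← Finset.sum_boole, ← Finset.sum_boole, ← Finset.sum_sub_distrib]
    refine Finset.sum_congr rfl fun i _ => ?_
    cases ε i <;> simp [sgn]
  constructor <;> linarith

end GComp

namespace GComp

/-! ### Outer probabilities of suprema of empirical processes -/

/-- The law of `n` independent observations from `P`. -/
noncomputable abbrev sampleLaw {S : Type*} [MeasurableSpace S] (P : Measure S) (n : ℕ) :
    Measure (Fin n → S) :=
  Measure.pi fun _ : Fin n => P

/-- The empirical process `n^{-1/2} ∑ (h(x_i) - P h)` of a finite sample. -/
noncomputable def sampleProc {S : Type*} [MeasurableSpace S] (P : Measure S) (n : ℕ) (h : S → ℝ)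
    (x : Fin n → S) : ℝ :=
  (√(n : ℝ))⁻¹ * ∑ i, (h (x i) - ∫ y, h y ∂P)

/-- Tonelli for counting measure on the signs times `μ`: it passes between statements for each sign
vector and counting statements for fixed data. -/
theorem sum_measure_eq_lintegral_card {α β : Type*} [MeasurableSpace α] [Fintype β] (μ : Measure α)
    (B : β → Set α) (hB : ∀ b, MeasurableSet (B b)) [∀ x, DecidablePred fun b => x ∈ B b] :
    ∑ b, μ (B b) = ∫⁻ x, ((Finset.univ.filter fun b => x ∈ B b).card : ℝ≥0∞) ∂μ := by
  have e : ∀ x, ((Finset.univ.filter fun b => x ∈ B b).card : ℝ≥0∞) =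
      ∑ b, (B b).indicator 1 x := by
    intro x
    rw [← Finset.sum_boole]
    refine Finset.sum_congr rfl fun b _ => ?_
    by_cases h : x ∈ B b <;> simp [h]
  simp_rw [e]
  rw [lintegral_finsetSum _ fun b _ => measurable_one.indicator (hB b)]
  refine Finset.sum_congr rfl fun b _ => ?_
  rw [lintegral_indicator_one (hB b)]

theorem measurable_card_filter {α β : Type*} [MeasurableSpace α] [Fintype β]
    (B : β → Set α) (hB : ∀ b, MeasurableSet (B b)) [∀ x, DecidablePred fun b => x ∈ B b] :
    Measurable fun x => ((Finset.univ.filter fun b => x ∈ B b).card : ℝ≥0∞) := by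
  have e : ∀ x, ((Finset.univ.filter fun b => x ∈ B b).card : ℝ≥0∞) =
      ∑ b, (B b).indicator 1 x := by
    intro x
    rw [← Finset.sum_boole]
    refine Finset.sum_congr rfl fun b _ => ?_
    by_cases h : x ∈ B b <;> simp [h]
  simp_rw [e]
  exact Finset.measurable_sum _ fun b _ => measurable_one.indicator (hB b)

section Sample

variable {S : Type*} [MeasurableSpace S] (P : Measure S) [IsProbabilityMeasure P]

theorem measurePreserving_comp_injective {ι κ : Type*} [Fintype ι] [Fintype κ] (e : κ → ι)
    (he : Function.Injective e) :
    MeasurePreserving (fun (x : ι → S) (j : κ) => x (e j)) (Measure.pi fun _ => P)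
      (Measure.pi fun _ => P) := by
  refine ⟨by fun_prop, ?_⟩
  rw [← Measure.infinitePi_eq_pi, ← Measure.infinitePi_eq_pi]
  exact Measure.map_infinitePi_infinitePi_of_inj (P := fun _ : ι => P) he

theorem memLp_sampleProc {h : S → ℝ} (hh : MemLp h 2 P) (n : ℕ) :
    MemLp (sampleProc P n h) 2 (sampleLaw P n) := by
  unfold sampleProc
  refine MemLp.const_mul ?_ _
  refine memLp_finsetSum _ fun i _ => ?_
  exact (hh.comp_measurePreserving (measurePreserving_eval (fun _ : Fin n => P) i)).sub
    (memLp_const _)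

theorem integral_sampleProc {h : S → ℝ} (hh : MemLp h 2 P) (n : ℕ) :
    ∫ x, sampleProc P n h x ∂(sampleLaw P n) = 0 := by
  have hi : ∀ i : Fin n, Integrable (fun x : Fin n → S => h (x i)) (sampleLaw P n) := fun i =>
    (hh.comp_measurePreserving (measurePreserving_eval (fun _ : Fin n => P) i)).integrable (by simp)
  have hv : ∀ i : Fin n, ∫ x : Fin n → S, h (x i) ∂(sampleLaw P n) = ∫ y, h y ∂P := by
    intro i
    have hm := measurePreserving_eval (fun _ : Fin n => P) i
    have := integral_map (μ := sampleLaw P n) hm.measurable.aemeasurable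
      (f := h) (by rw [hm.map_eq]; exact hh.1)
    rw [hm.map_eq] at this
    exact this.symm
  unfold sampleProc
  have hi' : ∀ i : Fin n, Integrable (fun x : Fin n → S => h (x i) - ∫ y, h y ∂P) (sampleLaw P n) :=
    fun i => (hi i).sub (integrable_const _)
  rw [integral_const_mul, integral_finsetSum _ fun i _ => hi' i]
  simp [integral_sub (hi _) (integrable_const _), hv]

theorem variance_sampleProc_le {h : S → ℝ} (hh : MemLp h 2 P) (n : ℕ) :
    Var[sampleProc P n h; sampleLaw P n] ≤ ∫ y, h y ^ 2 ∂P := by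
  have hvar : Var[fun y => h y - ∫ y, h y ∂P; P] ≤ ∫ y, h y ^ 2 ∂P := by
    rw [variance_sub_const hh.1.aemeasurable.aestronglyMeasurable]
    exact variance_le_expectation_sq hh.1
  have hs := variance_sum_pi (μ := fun _ : Fin n => P) (X := fun _ y => h y - ∫ y, h y ∂P)
    fun _ => hh.sub (memLp_const _)
  have hnn : 0 ≤ ∫ y, h y ^ 2 ∂P := integral_nonneg fun y => sq_nonneg _
  have e : sampleProc P n h = fun x => (√(n : ℝ))⁻¹ *
      (∑ i, fun x : Fin n → S => h (x i) - ∫ y, h y ∂P) x := by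
    funext x
    simp [sampleProc]
  rw [e, variance_const_mul, hs]
  simp only [Finset.sum_const, Finset.card_univ, Fintype.card_fin, nsmul_eq_mul]
  rw [inv_pow, Real.sq_sqrt (Nat.cast_nonneg n)]
  rcases Nat.eq_zero_or_pos n with rfl | hn
  · simpa using hnn
  · rw [← mul_assoc, inv_mul_cancel₀ (by positivity), one_mul]
    exact hvar

theorem chebyshev_sampleProc {h : S → ℝ} (hh : MemLp h 2 P) (n : ℕ) {c : ℝ} (hc : 0 < c) :
    sampleLaw P n {x | c ≤ |sampleProc P n h x|} ≤ ENNReal.ofReal ((∫ y, h y ^ 2 ∂P) / c ^ 2) := by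
  have := meas_ge_le_variance_div_sq (memLp_sampleProc P hh n) hc
  rw [integral_sampleProc P hh n] at this
  simp only [sub_zero] at this
  refine this.trans (ENNReal.ofReal_le_ofReal ?_)
  gcongr
  exact variance_sampleProc_le P hh n

/-- Exchange of the coordinates with a `true` label between two samples. -/
def swapSample {ι : Type*} (ε : ι → Bool) (p : (ι → S) × (ι → S)) : (ι → S) × (ι → S) :=
  (fun i => if ε i then p.1 i else p.2 i, fun i => if ε i then p.2 i else p.1 i)

/-- Regrouped as a family of independent pairs, the exchange acts on each pair separately by the
identity or by the swap. -/
theorem measurePreserving_swapSample {ι : Type*} [Fintype ι] (ε : ι → Bool) :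
    MeasurePreserving (swapSample (S := S) ε)
      ((Measure.pi fun _ : ι => P).prod (Measure.pi fun _ : ι => P))
      ((Measure.pi fun _ : ι => P).prod (Measure.pi fun _ : ι => P)) := by
  have h1 := measurePreserving_arrowProdEquivProdArrow S S ι (fun _ => P) (fun _ => P)
  have h2 : MeasurePreserving (fun (x : ι → S × S) i => (if ε i then id else Prod.swap) (x i))
      (Measure.pi fun _ => P.prod P) (Measure.pi fun _ => P.prod P) := by
    refine measurePreserving_pi _ _ fun i => ?_
    by_cases hi : ε i
    · simpa [hi] using MeasurePreserving.id (P.prod P)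
    · simpa [hi] using Measure.measurePreserving_swap (μ := P) (ν := P)
  have h3 := (h1.comp h2).comp (h1.symm _)
  convert! h3 using 1
  funext p
  ext i
  · by_cases hi : ε i <;> simp [swapSample, hi, MeasurableEquiv.arrowProdEquivProdArrow,
      Equiv.arrowProdEquivProdArrow]
  · by_cases hi : ε i <;> simp [swapSample, hi, MeasurableEquiv.arrowProdEquivProdArrow,
      Equiv.arrowProdEquivProdArrow]

variable {Θ : Type*} (h : Θ → S → ℝ) (A : Set Θ)

/-- The coordinates in `I` form a smaller i.i.d. sample, and dividing by the square root of the full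
sample size only decreases the process. -/
theorem subsample_le {c : ℝ} {p : ℝ≥0∞} {n : ℕ} (I : Finset (Fin n))
    (hp : sampleLaw P I.card {x | ∃ θ ∈ A, c < |sampleProc P I.card (h θ) x|} ≤ p) :
    sampleLaw P n {x | ∃ θ ∈ A, c < |(√(n : ℝ))⁻¹ * ∑ i ∈ I, (h θ (x i) - ∫ y, h θ y ∂P)|} ≤ p := by
  set e : Fin I.card → Fin n := fun j => I.orderEmbOfFin rfl j
  have he : Function.Injective e := (I.orderEmbOfFin rfl).injective
  have hm := measurePreserving_comp_injective P e he
  refine le_trans (measure_mono ?_) ((Measure.le_map_apply hm.measurable.aemeasurable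
    {x | ∃ θ ∈ A, c < |sampleProc P I.card (h θ) x|}).trans (hm.map_eq.symm ▸ hp))
  rintro x ⟨θ, hθ, hx⟩
  refine ⟨θ, hθ, hx.trans_le ?_⟩
  have hsum : ∑ i ∈ I, (h θ (x i) - ∫ y, h θ y ∂P) =
      ∑ j : Fin I.card, (h θ (x (e j)) - ∫ y, h θ y ∂P) := by
    conv_lhs => rw [← I.map_orderEmbOfFin_univ rfl]
    rw [Finset.sum_map]
    rfl
  rw [sampleProc, hsum, abs_mul, abs_mul]
  rcases I.card.eq_zero_or_pos with h0 | h0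
  · rw [← hsum, Finset.card_eq_zero.1 h0]
    simp
  · refine mul_le_mul_of_nonneg_right ?_ (abs_nonneg _)
    have hle : I.card ≤ n := by simpa using I.card_le_univ
    rw [abs_of_nonneg (by positivity), abs_of_nonneg (by positivity)]
    gcongr

/-- Desymmetrization for a fixed balanced vector of signs. -/
theorem signed_le {c : ℝ} {p : ℝ≥0∞} {k₀ n : ℕ}
    (hp : ∀ k ≥ k₀, sampleLaw P k {x | ∃ θ ∈ A, c < |sampleProc P k (h θ) x|} ≤ p)
    (ε : Fin n → Bool) (h₁ : k₀ ≤ (Finset.univ.filter fun i => ε i = true).card)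
    (h₀ : k₀ ≤ (Finset.univ.filter fun i => ¬ ε i = true).card) :
    sampleLaw P n {x | ∃ θ ∈ A, 2 * c <
      |(√(n : ℝ))⁻¹ * rad ε fun i => h θ (x i) - ∫ y, h θ y ∂P|} ≤ 2 * p := by
  have a₁ := subsample_le P h A _ (hp _ h₁)
  have a₀ := subsample_le P h A _ (hp _ h₀)
  rw [two_mul p]
  refine le_trans (measure_mono ?_) ((measure_union_le _ _).trans (add_le_add a₁ a₀))
  rintro x ⟨θ, hθ, hx⟩
  have hsplit : rad ε (fun i => h θ (x i) - ∫ y, h θ y ∂P) =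
      (∑ i with ε i = true, (h θ (x i) - ∫ y, h θ y ∂P)) -
        ∑ i with ¬ ε i = true, (h θ (x i) - ∫ y, h θ y ∂P) := by
    rw [rad, ← Finset.sum_filter_add_sum_filter_not Finset.univ fun i => ε i = true, sub_eq_add_neg,
      ← Finset.sum_neg_distrib]
    congr 1 <;> refine Finset.sum_congr rfl fun i hi => ?_
    · simp [sgn, (Finset.mem_filter.1 hi).2]
    · simp [sgn, (Finset.mem_filter.1 hi).2]
  rw [hsplit, mul_sub] at hx
  by_contra hcon
  simp only [Set.mem_union, Set.mem_ofPred_eq, not_or, not_exists, not_and, not_lt] at hcon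
  have := abs_sub ((√(n : ℝ))⁻¹ * ∑ i with ε i = true, (h θ (x i) - ∫ y, h θ y ∂P))
    ((√(n : ℝ))⁻¹ * ∑ i with ¬ ε i = true, (h θ (x i) - ∫ y, h θ y ∂P))
  linarith [hcon.1 θ hθ, hcon.2 θ hθ]

/-- Symmetrization in outer probability. -/
theorem symmetrization {t : ℝ} {n : ℕ}
    (hcheb : ∀ θ ∈ A, sampleLaw P n {x | t ≤ |sampleProc P n (h θ) x|} ≤ 1 / 2) :
    2 ^ n * sampleLaw P n {x | ∃ θ ∈ A, 2 * t < |sampleProc P n (h θ) x|} ≤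
      4 * ∑ ε : Fin n → Bool,
        sampleLaw P n {x | ∃ θ ∈ A, t / 2 < |(√(n : ℝ))⁻¹ * rad ε fun i => h θ (x i)|} := by
  set Q := sampleLaw P n
  set C : Set ((Fin n → S) × (Fin n → S)) :=
    {p | ∃ θ ∈ A, t < |(√(n : ℝ))⁻¹ * ∑ i, (h θ (p.1 i) - h θ (p.2 i))|}
  have h1 : Q {x | ∃ θ ∈ A, 2 * t < |sampleProc P n (h θ) x|} ≤ 2 * (Q.prod Q) C := by
    -- Fubini requires a measurable set. Passing to the hull costs nothing: if the process exceeds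
    -- `2t` at `x`, then for at least half of the independent copies it stays below `t`, so the
    -- section at `x` already has measure at least 1/2.
    set C' := toMeasurable (Q.prod Q) C
    have hC' : MeasurableSet C' := measurableSet_toMeasurable _ _
    have hsub : {x | ∃ θ ∈ A, 2 * t < |sampleProc P n (h θ) x|} ⊆
        {x | 1 / 2 ≤ Q (Prod.mk x ⁻¹' C')} := by
      rintro x ⟨θ, hθ, hx⟩
      have hs : {x' | t ≤ |sampleProc P n (h θ) x'|}ᶜ ⊆ Prod.mk x ⁻¹' C' := by
        intro x' hx'
        refine subset_toMeasurable _ _ ⟨θ, hθ, ?_⟩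
        simp only [Set.mem_compl_iff, Set.mem_ofPred_eq, not_le] at hx'
        have e : (√(n : ℝ))⁻¹ * ∑ i, (h θ (x i) - h θ (x' i)) =
            sampleProc P n (h θ) x - sampleProc P n (h θ) x' := by
          rw [sampleProc, sampleProc, ← mul_sub, ← Finset.sum_sub_distrib]
          congr 1
          exact Finset.sum_congr rfl fun i _ => by ring
        simp only [e]
        have := abs_sub_abs_le_abs_sub (sampleProc P n (h θ) x) (sampleProc P n (h θ) x')
        linarith
      refine le_trans ?_ (measure_mono hs)
      have hone : (1 : ℝ≥0∞) ≤ Q {x' | t ≤ |sampleProc P n (h θ) x'|} +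
          Q {x' | t ≤ |sampleProc P n (h θ) x'|}ᶜ := by
        rw [← measure_univ (μ := Q), ← Set.union_compl_self {x' | t ≤ |sampleProc P n (h θ) x'|}]
        exact measure_union_le _ _
      have h2 := hone.trans (add_le_add_left (hcheb θ hθ) _)
      have h3 : (1 : ℝ≥0∞) - 1 / 2 = 1 / 2 := by
        rw [one_div, ENNReal.one_sub_inv_two]
      change 1 / 2 ≤ _
      rw [← h3]
      exact tsub_le_iff_left.2 h2
    have hmk := mul_meas_ge_le_lintegral (μ := Q)
      (measurable_measure_prodMk_left (ν := Q) hC') (1 / 2)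
    rw [← Measure.prod_apply hC', measure_toMeasurable] at hmk
    have h4 := (mul_le_mul_right (measure_mono (μ := Q) hsub) (1 / 2)).trans hmk
    calc _ = 2 * (1 / 2 * Q {x | ∃ θ ∈ A, 2 * t < |sampleProc P n (h θ) x|}) := by
          rw [← mul_assoc, one_div, ENNReal.mul_inv_cancel (by norm_num) (by norm_num), one_mul]
      _ ≤ _ := mul_le_mul_right h4 2
  have h2 : ∀ ε : Fin n → Bool, (Q.prod Q) C ≤
      2 * Q {x | ∃ θ ∈ A, t / 2 < |(√(n : ℝ))⁻¹ * rad ε fun i => h θ (x i)|} := by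
    intro ε
    set D : Set (Fin n → S) := {x | ∃ θ ∈ A, t / 2 < |(√(n : ℝ))⁻¹ * rad ε fun i => h θ (x i)|}
    have hsw := measurePreserving_swapSample P ε (ι := Fin n)
    -- After the exchange of coordinates the difference of the two samples becomes a difference of
    -- two signed sums, one of which must exceed half the level.
    have hsub : C ⊆ swapSample ε ⁻¹' (Prod.fst ⁻¹' D ∪ Prod.snd ⁻¹' D) := by
      rintro p ⟨θ, hθ, hp⟩
      by_contra hcon
      simp only [Set.mem_preimage, Set.mem_union, D, Set.mem_ofPred_eq, not_or, not_exists, not_and,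
        not_lt] at hcon
      have e : (√(n : ℝ))⁻¹ * ∑ i, (h θ (p.1 i) - h θ (p.2 i)) =
          (√(n : ℝ))⁻¹ * rad ε (fun i => h θ ((swapSample ε p).1 i)) -
            (√(n : ℝ))⁻¹ * rad ε (fun i => h θ ((swapSample ε p).2 i)) := by
        rw [← mul_sub, rad, rad, ← Finset.sum_sub_distrib]
        congr 1
        refine Finset.sum_congr rfl fun i _ => ?_
        by_cases hi : ε i <;> simp [swapSample, sgn, hi]
        ring
      rw [e] at hp
      have := abs_sub ((√(n : ℝ))⁻¹ * rad ε (fun i => h θ ((swapSample ε p).1 i)))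
        ((√(n : ℝ))⁻¹ * rad ε (fun i => h θ ((swapSample ε p).2 i)))
      linarith [hcon.1 θ hθ, hcon.2 θ hθ]
    have hfst : (Q.prod Q) (Prod.fst ⁻¹' D) ≤ Q D := by
      refine (Measure.le_map_apply measurable_fst.aemeasurable D).trans ?_
      rw [Measure.map_fst_prod]
      simp
    have hsnd : (Q.prod Q) (Prod.snd ⁻¹' D) ≤ Q D := by
      refine (Measure.le_map_apply measurable_snd.aemeasurable D).trans ?_
      rw [Measure.map_snd_prod]
      simp
    calc (Q.prod Q) C ≤ (Q.prod Q) (swapSample ε ⁻¹' (Prod.fst ⁻¹' D ∪ Prod.snd ⁻¹' D)) :=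
          measure_mono hsub
      _ ≤ (Q.prod Q) (Prod.fst ⁻¹' D ∪ Prod.snd ⁻¹' D) := by
          refine (Measure.le_map_apply hsw.measurable.aemeasurable _).trans ?_
          rw [hsw.map_eq]
      _ ≤ Q D + Q D := (measure_union_le _ _).trans (add_le_add hfst hsnd)
      _ = 2 * Q D := (two_mul _).symm
  have h3 := Finset.sum_le_sum fun ε (_ : ε ∈ (Finset.univ : Finset (Fin n → Bool))) => h2 ε
  simp only [Finset.sum_const, Finset.card_univ, Fintype.card_fun, Fintype.card_bool,
    Fintype.card_fin, nsmul_eq_mul, Nat.cast_pow, Nat.cast_ofNat, ← Finset.mul_sum] at h3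
  calc _ ≤ 2 ^ n * (2 * (Q.prod Q) C) := mul_le_mul_right h1 _
    _ = 2 * (2 ^ n * (Q.prod Q) C) := by ring
    _ ≤ 2 * (2 * _) := mul_le_mul_right h3 _
    _ = _ := by rw [← mul_assoc]; norm_num

end Sample

end GComp

/-! ### Comparison of symmetrized processes in outer probability. -/

namespace GComp

section Sample

variable {S : Type*} [MeasurableSpace S] (P : Measure S) [IsProbabilityMeasure P]
variable {Θ : Type*} (h : Θ → S → ℝ) (A : Set Θ)

theorem abs_rad_sub_le {n : ℕ} (ε : Fin n → Bool) (u v : Fin n → ℝ) {b : ℝ}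
    (huv : ∀ i, |u i - v i| ≤ b) : |rad ε u - rad ε v| ≤ n * b := by
  rw [rad, rad, ← Finset.sum_sub_distrib]
  refine (Finset.abs_sum_le_sum_abs _ _).trans ?_
  calc _ ≤ ∑ _i : Fin n, b := Finset.sum_le_sum fun i _ => by
        rw [← mul_sub, abs_mul, abs_sgn, one_mul]
        exact huv i
    _ = n * b := by simp

open Classical in
/-- The comparison principle for the symmetrized process, in outer probability. The values of the
class on the sample are discretized, so that measurable hulls of all the events involved can be
taken simultaneously. -/
theorem sum_rad_contraction_le (Φ : S → ℝ → ℝ) (hΦm : ∀ t, Measurable fun x => Φ x t)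
    {L c s : ℝ} (hL : 0 ≤ L) (hc : 0 < c) (hs : 0 < s) (hΦ0 : ∀ x, Φ x 0 = 0)
    (hΦ : ∀ x a b, |Φ x a - Φ x b| ≤ L * |a - b|) {n : ℕ} (hn : 0 < n)
    (hnc : (√(n : ℝ))⁻¹ ≤ c) (hns : L * (√(n : ℝ))⁻¹ ≤ s) (p r : ℝ≥0∞)
    (G : Finset (Fin n → Bool)) (hG : ∀ ε ∈ G, sampleLaw P n {x | ∃ θ ∈ A,
      c < |(√(n : ℝ))⁻¹ * rad ε fun i => h θ (x i)|} ≤ p) (hr : ((Gᶜ.card : ℕ) : ℝ≥0∞) ≤ 2 ^ n * r) :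
    ∑ ε : Fin n → Bool, sampleLaw P n {x | ∃ θ ∈ A,
      2 * s < |(√(n : ℝ))⁻¹ * rad ε fun i => Φ (x i) (h θ (x i))|} ≤
      2 ^ n * (12 * (p + r) + ENNReal.ofReal (16 * L * c / s)) := by
  set Q := sampleLaw P n
  have hn' : (0 : ℝ) < n := by exact_mod_cast hn
  have hrt : 0 < √(n : ℝ) := Real.sqrt_pos.2 hn'
  have habs : ∀ y : ℝ, |(√(n : ℝ))⁻¹ * y| = (√(n : ℝ))⁻¹ * |y| := fun y => by
    rw [abs_mul, abs_of_pos (inv_pos.2 hrt)]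
  have hnn : (n : ℝ) * (1 / n) = 1 := by field_simp
  set val : (Fin n → ℤ) → Fin n → ℝ := fun q i => q i / n
  -- With mesh `1/n` the rounding changes a sum of `n` signed terms by at most 1, negligible against
  -- the square root of `n`. Only countably many patterns `q` occur, and one family of hulls `H q`
  -- serves every sign vector, before and after applying `Φ`.
  set E : (Fin n → ℤ) → Set (Fin n → S) := fun q => {x | ∃ θ ∈ A, ∀ i, ⌊n * h θ (x i)⌋ = q i}
  set H : (Fin n → ℤ) → Set (Fin n → S) := fun q => toMeasurable Q (E q)
  have hH : ∀ q, MeasurableSet (H q) := fun q => measurableSet_toMeasurable _ _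
  have hval : ∀ (θ : Θ) (x : Fin n → S) (q : Fin n → ℤ), (∀ i, ⌊n * h θ (x i)⌋ = q i) →
      ∀ i, |h θ (x i) - val q i| ≤ 1 / n := by
    intro θ x q hq i
    have h1 := Int.floor_le (n * h θ (x i))
    have h2 := (Int.lt_floor_add_one (n * h θ (x i))).le
    rw [hq i] at h1 h2
    have e : h θ (x i) - val q i = (n * h θ (x i) - q i) / n := by
      simp only [val]
      field_simp
    rw [e, abs_div, abs_of_pos hn', abs_of_nonneg (by linarith)]
    gcongr
    linarith
  set B : (Fin n → Bool) → Set (Fin n → S) := fun ε =>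
    ⋃ q : {q : Fin n → ℤ // 2 * c * √(n : ℝ) < |rad ε (val q)|}, H q
  have hBm : ∀ ε, MeasurableSet (B ε) := fun ε => MeasurableSet.iUnion fun q => hH q
  have hB : ∀ ε ∈ G, Q (B ε) ≤ p := by
    intro ε hε
    refine le_trans ?_ (hG ε hε)
    simp only [B, H]
    -- A countable union of hulls has the same measure as the union of the original sets, so
    -- enlarging to the hulls does not increase the outer probability.
    rw [measure_iUnion_toMeasurable]
    refine measure_mono (Set.iUnion_subset fun q => ?_)
    rintro x ⟨θ, hθ, hx⟩
    refine ⟨θ, hθ, ?_⟩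
    have h1 := abs_rad_sub_le ε _ _ (hval θ x q hx)
    rw [hnn] at h1
    have h2 := abs_sub_abs_le_abs_sub (rad ε (val q)) (rad ε fun i => h θ (x i))
    rw [abs_sub_comm] at h2
    have h3 := q.2
    rw [habs, lt_inv_mul_iff₀ hrt]
    have h4 : 1 ≤ c * √(n : ℝ) := by
      rwa [inv_le_iff_one_le_mul₀ hrt] at hnc
    linarith
  have hBsum : ∑ ε, Q (B ε) ≤ 2 ^ n * (p + r) := by
    rw [← Finset.sum_add_sum_compl G]
    have h1 : ∑ ε ∈ G, Q (B ε) ≤ 2 ^ n * p := by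
      refine (Finset.sum_le_sum hB).trans ?_
      rw [Finset.sum_const, nsmul_eq_mul]
      gcongr
      have := G.card_le_univ
      simp only [Fintype.card_fun, Fintype.card_bool, Fintype.card_fin] at this
      exact_mod_cast this
    have h2 : ∑ ε ∈ Gᶜ, Q (B ε) ≤ 2 ^ n * r := by
      refine le_trans ?_ hr
      calc ∑ ε ∈ Gᶜ, Q (B ε) ≤ ∑ _ε ∈ Gᶜ, 1 := Finset.sum_le_sum fun ε _ => prob_le_one
        _ = _ := by simp
    rw [mul_add]
    exact add_le_add h1 h2
  -- The exceptional data: those for which too many sign vectors give a large supremum for the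
  -- quantile hypothesis of `card_exists_lt_rad_le` to be available. Markov's inequality bounds
  -- their probability.
  set N : Set (Fin n → S) :=
    {x | 2 ^ n ≤ 12 * ((Finset.univ.filter fun ε => x ∈ B ε).card : ℝ≥0∞)}
  have hcm := measurable_card_filter B hBm
  have hNm : MeasurableSet N := measurableSet_le measurable_const (hcm.const_mul 12)
  have hN : 2 ^ n * Q N ≤ 2 ^ n * (12 * (p + r)) := by
    have h1 := mul_meas_ge_le_lintegral (μ := Q) (hcm.const_mul 12) (2 ^ n)
    rw [lintegral_const_mul _ hcm, ← sum_measure_eq_lintegral_card Q B hBm] at h1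
    calc _ ≤ 12 * ∑ ε, Q (B ε) := h1
      _ ≤ 12 * (2 ^ n * (p + r)) := by gcongr
      _ = _ := by ring
  set D : (Fin n → Bool) → Set (Fin n → S) := fun ε =>
    ⋃ q : Fin n → ℤ, H q ∩ {x | s * √(n : ℝ) < |rad ε fun i => Φ (x i) (val q i)|}
  have hDm : ∀ ε, MeasurableSet (D ε) := by
    refine fun ε => MeasurableSet.iUnion fun q => (hH q).inter ?_
    refine measurableSet_lt measurable_const ?_
    refine Measurable.abs ?_
    unfold rad
    refine Finset.measurable_fun_sum _ fun i _ => ?_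
    exact ((hΦm (val q i)).comp (measurable_pi_apply i)).const_mul _
  have hDle : ∀ ε, Q {x | ∃ θ ∈ A,
      2 * s < |(√(n : ℝ))⁻¹ * rad ε fun i => Φ (x i) (h θ (x i))|} ≤ Q (D ε) := by
    refine fun ε => measure_mono ?_
    rintro x ⟨θ, hθ, hx⟩
    refine Set.mem_iUnion.2 ⟨fun i => ⌊n * h θ (x i)⌋, subset_toMeasurable _ _ ⟨θ, hθ, fun i => rfl⟩, ?_⟩
    have h1 := abs_rad_sub_le ε (fun i => Φ (x i) (h θ (x i)))
      (fun i => Φ (x i) (val (fun i => ⌊n * h θ (x i)⌋) i)) (b := L * (1 / n)) fun i =>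
        (hΦ _ _ _).trans (mul_le_mul_of_nonneg_left (hval θ x _ (fun _ => rfl) i) hL)
    rw [mul_left_comm, hnn, mul_one] at h1
    have h2 := abs_sub_abs_le_abs_sub (rad ε fun i => Φ (x i) (h θ (x i)))
      (rad ε fun i => Φ (x i) (val (fun i => ⌊n * h θ (x i)⌋) i))
    rw [habs, lt_inv_mul_iff₀ hrt] at hx
    have h4 : L ≤ s * √(n : ℝ) := by
      rwa [← div_eq_mul_inv, div_le_iff₀ hrt] at hns
    change s * √(n : ℝ) < |rad ε fun i => Φ (x i) (val (fun i => ⌊n * h θ (x i)⌋) i)|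
    linarith
  have hpt : ∀ x, ((Finset.univ.filter fun ε => x ∈ D ε).card : ℝ≥0∞) ≤
      2 ^ n * N.indicator 1 x + 2 ^ n * ENNReal.ofReal (16 * L * c / s) := by
    intro x
    by_cases hx : x ∈ N
    · refine le_add_right ?_
      rw [Set.indicator_of_mem hx, Pi.one_apply, mul_one]
      have := (Finset.univ.filter fun ε => x ∈ D ε).card_le_univ
      simp only [Fintype.card_fun, Fintype.card_bool, Fintype.card_fin] at this
      exact_mod_cast this
    · refine le_add_left ?_
      have hx' : 12 * ((Finset.univ.filter fun ε => x ∈ B ε).card : ℝ≥0∞) < 2 ^ n := not_le.1 hx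
      have hx2 : 12 * ((Finset.univ.filter fun ε => x ∈ B ε).card : ℝ) ≤ 2 ^ n := by
        have : 12 * (Finset.univ.filter fun ε => x ∈ B ε).card < 2 ^ n := by exact_mod_cast hx'
        exact_mod_cast this.le
      have hBe : ∀ ε, x ∈ B ε ↔ ∃ t ∈ val '' {q | x ∈ H q}, 2 * c * √(n : ℝ) < |rad ε t| := by
        intro ε
        simp only [B, Set.mem_iUnion, Subtype.exists, Set.exists_mem_image, Set.mem_ofPred_eq]
        exact ⟨fun ⟨q, h1, h2⟩ => ⟨q, h2, h1⟩, fun ⟨q, h1, h2⟩ => ⟨q, h2, h1⟩⟩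
      have hDe : ∀ ε, x ∈ D ε ↔
          ∃ t ∈ val '' {q | x ∈ H q}, s * √(n : ℝ) < |rad ε fun i => Φ (x i) (t i)| := by
        intro ε
        simp only [D, Set.mem_iUnion, Set.mem_inter_iff, Set.exists_mem_image, Set.mem_ofPred_eq]
      simp only [hBe] at hx2
      -- The data are fixed, and the comparison runs over all patterns whose hull contains `x`,
      -- including those contributed by the hulls alone.
      have h1 := card_exists_lt_rad_le (val '' {q | x ∈ H q}) (fun i => Φ (x i)) (L := L)
        (c := 2 * c * √(n : ℝ)) (s := s * √(n : ℝ)) (by positivity) hL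
        (fun i => hΦ0 _) (fun i => hΦ _) hx2
      simp only [← hDe] at h1
      have h2 : ((Finset.univ.filter fun ε => x ∈ D ε).card : ℝ) ≤ 2 ^ n * (16 * L * c / s) := by
        have h3 : (s * √(n : ℝ)) * ((Finset.univ.filter fun ε => x ∈ D ε).card : ℝ) ≤
            (s * √(n : ℝ)) * (2 ^ n * (16 * L * c / s)) := by
          refine h1.trans (le_of_eq ?_)
          field_simp
          ring
        exact le_of_mul_le_mul_left h3 (by positivity)
      have h4 := ENNReal.ofReal_le_ofReal h2
      rw [ENNReal.ofReal_natCast, ENNReal.ofReal_mul (by positivity),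
        ENNReal.ofReal_pow (by norm_num), ENNReal.ofReal_ofNat] at h4
      exact h4
  calc _ ≤ ∑ ε, Q (D ε) := Finset.sum_le_sum fun ε _ => hDle ε
    _ = ∫⁻ x, ((Finset.univ.filter fun ε => x ∈ D ε).card : ℝ≥0∞) ∂Q :=
        sum_measure_eq_lintegral_card Q D hDm
    _ ≤ ∫⁻ x, (2 ^ n * N.indicator 1 x + 2 ^ n * ENNReal.ofReal (16 * L * c / s)) ∂Q :=
        lintegral_mono hpt
    _ = 2 ^ n * Q N + 2 ^ n * ENNReal.ofReal (16 * L * c / s) := by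
        rw [lintegral_add_right _ measurable_const,
          lintegral_const_mul _ (measurable_one.indicator hNm), lintegral_indicator_one hNm]
        simp
    _ ≤ _ := by
        rw [mul_add]
        gcongr

end Sample

end GComp

/-! ### Stochastic equicontinuity and its permanence properties. -/

namespace GComp

variable {S : Type*} [MeasurableSpace S] (P : Measure S) [IsProbabilityMeasure P]
variable {Θ : Type*}

/-- Stochastic equicontinuity along a filter on the index set: the functions `h θ` are small in
`L₂(P)` and the empirical process is small uniformly over a neighbourhood, in outer probability. -/
structure StochEquicont (𝓛 : Filter Θ) (h : Θ → S → ℝ) : Prop where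
  memLp : ∀ᶠ θ in 𝓛, MemLp (h θ) 2 P
  small : Tendsto (fun θ => ∫ y, h θ y ^ 2 ∂P) 𝓛 (𝓝 0)
  equi : ∀ e : ℝ, 0 < e → ∃ A ∈ 𝓛, ∀ᶠ n in atTop,
    sampleLaw P n {x | ∃ θ ∈ A, e < |sampleProc P n (h θ) x|} ≤ ENNReal.ofReal e

variable {P} {𝓛 : Filter Θ} {h : Θ → S → ℝ}

theorem sq_integral_le {f : S → ℝ} (hf : MemLp f 2 P) : (∫ y, f y ∂P) ^ 2 ≤ ∫ y, f y ^ 2 ∂P := by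
  have h1 := variance_nonneg f P
  rw [variance_eq_sub hf] at h1
  simpa using h1

omit [IsProbabilityMeasure P] in
theorem memLp_comp_lipschitz {Φ : S → ℝ → ℝ} (hΦm : Measurable (Function.uncurry Φ)) {L : ℝ}
    (hΦ0 : ∀ x, Φ x 0 = 0) (hΦ : ∀ x a b, |Φ x a - Φ x b| ≤ L * |a - b|) {f : S → ℝ}
    (hf : MemLp f 2 P) : MemLp (fun x => Φ x (f x)) 2 P := by
  refine (hf.const_mul L).of_le_mul (c := 1) ?_ ?_
  · exact (hΦm.comp_aemeasurable
      (aemeasurable_id.prodMk hf.1.aemeasurable)).aestronglyMeasurable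
  · refine ae_of_all _ fun x => ?_
    have := hΦ x (f x) 0
    rw [hΦ0, sub_zero, sub_zero] at this
    rw [one_mul, Real.norm_eq_abs, Real.norm_eq_abs, abs_mul]
    exact this.trans (mul_le_mul_of_nonneg_right (le_abs_self L) (abs_nonneg _))

omit [IsProbabilityMeasure P] in
theorem integral_sq_comp_lipschitz_le {Φ : S → ℝ → ℝ} (hΦm : Measurable (Function.uncurry Φ))
    {L : ℝ} (hΦ0 : ∀ x, Φ x 0 = 0) (hΦ : ∀ x a b, |Φ x a - Φ x b| ≤ L * |a - b|) {f : S → ℝ}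
    (hf : MemLp f 2 P) : ∫ x, Φ x (f x) ^ 2 ∂P ≤ L ^ 2 * ∫ x, f x ^ 2 ∂P := by
  rw [← integral_const_mul]
  refine integral_mono (memLp_comp_lipschitz hΦm hΦ0 hΦ hf).integrable_sq
    (hf.integrable_sq.const_mul _) fun x => ?_
  have h1 := hΦ x (f x) 0
  rw [hΦ0, sub_zero, sub_zero] at h1
  have h2 := pow_le_pow_left₀ (abs_nonneg _) h1 2
  rwa [mul_pow, sq_abs, sq_abs] at h2

/-- Lipschitz transformations preserve stochastic equicontinuity. -/
theorem StochEquicont.contraction (hh : StochEquicont P 𝓛 h) {Φ : S → ℝ → ℝ}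
    (hΦm : Measurable (Function.uncurry Φ)) {L : ℝ} (hL : 0 ≤ L) (hΦ0 : ∀ x, Φ x 0 = 0)
    (hΦ : ∀ x a b, |Φ x a - Φ x b| ≤ L * |a - b|) :
    StochEquicont P 𝓛 fun θ x => Φ x (h θ x) := by
  refine ⟨hh.memLp.mono fun θ hθ => memLp_comp_lipschitz hΦm hΦ0 hΦ hθ, ?_, ?_⟩
  · refine squeeze_zero' (Eventually.of_forall fun θ => integral_nonneg fun y => sq_nonneg _)
      (hh.memLp.mono fun θ hθ => integral_sq_comp_lipschitz_le hΦm hΦ0 hΦ hθ) ?_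
    simpa using hh.small.const_mul (L ^ 2)
  intro e he
  -- Symmetrization at `t = e/2` leaves signed sums above `e/4 = 2s`. `K` makes the proportion of
  -- unbalanced sign vectors at most `e/100`, and `η` makes the remaining error terms add up to
  -- `e/2`; the total is `0.98 * e`.
  set s := e / 8 with hs_def
  have hs : 0 < s := by positivity
  set K := 10 / √e with hK_def
  have hse : 0 < √e := Real.sqrt_pos.2 he
  have hK : 0 < K := by positivity
  have hK2 : 1 / K ^ 2 = e / 100 := by
    rw [hK_def, div_pow, Real.sq_sqrt he.le]
    norm_num
  set η := e / (2 * (96 + 192 * L / s)) with hη_def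
  have hden : 0 < 96 + 192 * L / s := by positivity
  have hη : 0 < η := by positivity
  have hηe : η * (96 + 192 * L / s) = e / 2 := by
    rw [hη_def]
    field_simp
  obtain ⟨A₀, hA₀, hA₀n⟩ := hh.equi η hη
  obtain ⟨k₀, hk₀⟩ := eventually_atTop.1 hA₀n
  have hsmall : ∀ δ : ℝ, 0 < δ → ∀ᶠ θ in 𝓛, ∫ y, h θ y ^ 2 ∂P ≤ δ := fun δ hδ =>
    (hh.small.eventually_lt_const hδ).mono fun θ => le_of_lt
  -- The first bound makes the means, weighted by a balanced sum of signs, at most `η`; the second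
  -- makes Chebyshev's bound for the transformed functions at level `e/2` at most 1/2, as
  -- symmetrization requires.
  set A := {θ | θ ∈ A₀ ∧ MemLp (h θ) 2 P ∧ ∫ y, h θ y ^ 2 ∂P ≤ (η / K) ^ 2 ∧
    ∫ y, h θ y ^ 2 ∂P ≤ (e / 2) ^ 2 / (2 * (L ^ 2 + 1))}
  have hA : A ∈ 𝓛 := by
    filter_upwards [hA₀, hh.memLp, hsmall _ (by positivity : 0 < (η / K) ^ 2),
      hsmall _ (by positivity : 0 < (e / 2) ^ 2 / (2 * (L ^ 2 + 1)))] with θ h1 h2 h3 h4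
    exact ⟨h1, h2, h3, h4⟩
  refine ⟨A, hA, ?_⟩
  have hsq : Tendsto (fun n : ℕ => √(n : ℝ)) atTop atTop :=
    Real.tendsto_sqrt_atTop.comp tendsto_natCast_atTop_atTop
  -- The first size condition leaves at least `k₀` observations of either sign in a balanced vector;
  -- the other two absorb the rounding errors of the discretization.
  filter_upwards [eventually_gt_atTop 0, hsq.eventually_ge_atTop (K + 2 * k₀ + 1),
    hsq.eventually_ge_atTop (1 / (3 * η)), hsq.eventually_ge_atTop (L / s)] with n hn hn1 hn2 hn3
  have hn' : (0 : ℝ) < n := by exact_mod_cast hn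
  have hrt : 0 < √(n : ℝ) := Real.sqrt_pos.2 hn'
  have hmul : √(n : ℝ) * √(n : ℝ) = n := Real.mul_self_sqrt hn'.le
  set G : Finset (Fin n → Bool) := Finset.univ.filter fun ε => ¬ K * √(n : ℝ) < |∑ i, sgn (ε i)|
  have hG : ∀ ε ∈ G, sampleLaw P n {x | ∃ θ ∈ A,
      3 * η < |(√(n : ℝ))⁻¹ * rad ε fun i => h θ (x i)|} ≤ 2 * ENNReal.ofReal η := by
    intro ε hε
    have hbal : |∑ i, sgn (ε i)| ≤ K * √(n : ℝ) := not_lt.1 (Finset.mem_filter.1 hε).2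
    obtain ⟨hs1, hs2⟩ := sum_sgn_eq ε
    have hb := abs_le.1 hbal
    have hbig : 2 * (k₀ : ℝ) ≤ n - K * √(n : ℝ) := by
      have h1 : 1 ≤ √(n : ℝ) := by
        have : (0 : ℝ) ≤ k₀ := Nat.cast_nonneg _
        linarith
      nlinarith [(Nat.cast_nonneg k₀ : (0 : ℝ) ≤ k₀)]
    have hc1 : k₀ ≤ (Finset.univ.filter fun i => ε i = true).card := by
      have : (k₀ : ℝ) ≤ ((Finset.univ.filter fun i => ε i = true).card : ℝ) := by linarith [hb.1]
      exact_mod_cast this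
    have hc0 : k₀ ≤ (Finset.univ.filter fun i => ¬ ε i = true).card := by
      have : (k₀ : ℝ) ≤ ((Finset.univ.filter fun i => ¬ ε i = true).card : ℝ) := by
        linarith [hb.2]
      exact_mod_cast this
    refine le_trans (measure_mono ?_) (signed_le P h A₀ hk₀ ε hc1 hc0)
    rintro x ⟨θ, ⟨hθ0, hθL, hθs, -⟩, hx⟩
    refine ⟨θ, hθ0, ?_⟩
    have hmean : |∫ y, h θ y ∂P| ≤ η / K :=
      abs_le_of_sq_le_sq ((sq_integral_le hθL).trans hθs) (by positivity)
    -- Desymmetrization concerns centred functions, the comparison uncentred ones. The centring term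
    -- costs `η`, hence the level `3η` instead of `2η`.
    have e1 : (√(n : ℝ))⁻¹ * rad ε (fun i => h θ (x i) - ∫ y, h θ y ∂P) =
        (√(n : ℝ))⁻¹ * rad ε (fun i => h θ (x i)) -
          (√(n : ℝ))⁻¹ * ((∑ i, sgn (ε i)) * ∫ y, h θ y ∂P) := by
      rw [← mul_sub, Finset.sum_mul, rad, rad, ← Finset.sum_sub_distrib]
      congr 1
      exact Finset.sum_congr rfl fun i _ => by ring
    have e2 : |(√(n : ℝ))⁻¹ * ((∑ i, sgn (ε i)) * ∫ y, h θ y ∂P)| ≤ η := by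
      rw [abs_mul, abs_mul, abs_of_pos (inv_pos.2 hrt), inv_mul_le_iff₀ hrt]
      calc _ ≤ (K * √(n : ℝ)) * (η / K) :=
            mul_le_mul hbal hmean (abs_nonneg _) (by positivity)
        _ = √(n : ℝ) * η := by field_simp
    rw [e1]
    have e3 := abs_sub_abs_le_abs_sub ((√(n : ℝ))⁻¹ * rad ε (fun i => h θ (x i)))
      ((√(n : ℝ))⁻¹ * ((∑ i, sgn (ε i)) * ∫ y, h θ y ∂P))
    linarith
  have hGc : ((Gᶜ.card : ℕ) : ℝ≥0∞) ≤ 2 ^ n * ENNReal.ofReal (1 / K ^ 2) := by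
    have h1 := card_unbalanced_le hn hK
    have h2 : Gᶜ = Finset.univ.filter fun ε : Fin n → Bool =>
        K * √(n : ℝ) < |∑ i, sgn (ε i)| := by
      ext ε
      simp [G]
    rw [← h2, div_eq_mul_one_div] at h1
    have h3 := ENNReal.ofReal_le_ofReal h1
    rwa [ENNReal.ofReal_natCast, ENNReal.ofReal_mul (by positivity),
      ENNReal.ofReal_pow (by norm_num), ENNReal.ofReal_ofNat] at h3
  have hcore := sum_rad_contraction_le P h A Φ (fun t => hΦm.comp measurable_prodMk_right) hL
    (c := 3 * η) (by positivity) hs hΦ0 hΦ hn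
    (by
      rw [inv_le_iff_one_le_mul₀ hrt]
      rwa [div_le_iff₀ (by positivity), mul_comm] at hn2)
    (by
      rw [← div_eq_mul_inv, div_le_iff₀ hrt]
      rwa [div_le_iff₀ hs, mul_comm] at hn3)
    (2 * ENNReal.ofReal η) (ENNReal.ofReal (1 / K ^ 2)) G hG hGc
  have hcheb : ∀ θ ∈ A, sampleLaw P n {x | e / 2 ≤ |sampleProc P n (fun x => Φ x (h θ x)) x|} ≤
      1 / 2 := by
    rintro θ ⟨-, hθL, -, hθs⟩
    refine (chebyshev_sampleProc P (memLp_comp_lipschitz hΦm hΦ0 hΦ hθL) n (by positivity)).trans ?_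
    have h1 := integral_sq_comp_lipschitz_le hΦm hΦ0 hΦ hθL
    rw [show (1 / 2 : ℝ≥0∞) = ENNReal.ofReal (1 / 2) by
      rw [ENNReal.ofReal_div_of_pos (by norm_num)]; simp]
    refine ENNReal.ofReal_le_ofReal ?_
    rw [div_le_iff₀ (by positivity)]
    rw [le_div_iff₀ (by positivity)] at hθs
    have h2 : 0 ≤ ∫ y, h θ y ^ 2 ∂P := integral_nonneg fun y => sq_nonneg _
    nlinarith
  have hsym := symmetrization P (fun θ x => Φ x (h θ x)) A hcheb
  have he2 : 2 * (e / 2) = e := by ring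
  have he4 : e / 2 / 2 = 2 * s := by rw [hs_def]; ring
  rw [he2, he4] at hsym
  have hfin := hsym.trans (mul_le_mul_right hcore 4)
  have hreal : 4 * (12 * (2 * ENNReal.ofReal η + ENNReal.ofReal (1 / K ^ 2)) +
      ENNReal.ofReal (16 * L * (3 * η) / s)) ≤ ENNReal.ofReal e := by
    rw [show (2 : ℝ≥0∞) = ENNReal.ofReal 2 by simp, show (12 : ℝ≥0∞) = ENNReal.ofReal 12 by simp,
      show (4 : ℝ≥0∞) = ENNReal.ofReal 4 by simp, ← ENNReal.ofReal_mul (by norm_num),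
      ← ENNReal.ofReal_add (by positivity) (by positivity), ← ENNReal.ofReal_mul (by norm_num),
      ← ENNReal.ofReal_add (by positivity) (by positivity), ← ENNReal.ofReal_mul (by norm_num)]
    refine ENNReal.ofReal_le_ofReal ?_
    rw [hK2]
    have : 16 * L * (3 * η) / s = η * (192 * L / s) / 4 := by ring
    rw [this]
    linarith
  have h2n : (2 : ℝ≥0∞) ^ n ≠ 0 := by positivity
  have h2t : (2 : ℝ≥0∞) ^ n ≠ ∞ := ENNReal.pow_ne_top (by norm_num)
  refine (ENNReal.mul_le_mul_iff_right h2n h2t).1 (hfin.trans ?_)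
  rw [mul_left_comm]
  gcongr

omit [IsProbabilityMeasure P] in
theorem sampleProc_add {f g : S → ℝ} (hf : Integrable f P) (hg : Integrable g P) (n : ℕ)
    (x : Fin n → S) :
    sampleProc P n (fun y => f y + g y) x = sampleProc P n f x + sampleProc P n g x := by
  rw [sampleProc, sampleProc, sampleProc, ← mul_add, ← Finset.sum_add_distrib,
    integral_add hf hg]
  congr 1
  exact Finset.sum_congr rfl fun i _ => by ring

theorem StochEquicont.add (hh : StochEquicont P 𝓛 h) {k : Θ → S → ℝ}
    (hk : StochEquicont P 𝓛 k) : StochEquicont P 𝓛 fun θ x => h θ x + k θ x := by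
  refine ⟨?_, ?_, ?_⟩
  · filter_upwards [hh.memLp, hk.memLp] with θ h1 h2 using h1.add h2
  · refine squeeze_zero' (Eventually.of_forall fun θ => integral_nonneg fun y => sq_nonneg _)
      (g := fun θ => 2 * ∫ y, h θ y ^ 2 ∂P + 2 * ∫ y, k θ y ^ 2 ∂P) ?_ ?_
    · filter_upwards [hh.memLp, hk.memLp] with θ h1 h2
      rw [← integral_const_mul, ← integral_const_mul,
        ← integral_add (h1.integrable_sq.const_mul _) (h2.integrable_sq.const_mul _)]
      refine integral_mono (h1.add h2).integrable_sq
        ((h1.integrable_sq.const_mul _).add (h2.integrable_sq.const_mul _)) fun y => ?_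
      nlinarith [sq_nonneg (h θ y - k θ y)]
    · simpa using (hh.small.const_mul 2).add (hk.small.const_mul 2)
  · intro e he
    obtain ⟨A, hA, hAn⟩ := hh.equi (e / 2) (by positivity)
    obtain ⟨B, hB, hBn⟩ := hk.equi (e / 2) (by positivity)
    refine ⟨{θ | θ ∈ A ∧ θ ∈ B ∧ MemLp (h θ) 2 P ∧ MemLp (k θ) 2 P}, ?_, ?_⟩
    · filter_upwards [hA, hB, hh.memLp, hk.memLp] with θ h1 h2 h3 h4 using ⟨h1, h2, h3, h4⟩
    filter_upwards [hAn, hBn] with n h1 h2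
    rw [← add_halves e, ENNReal.ofReal_add (by positivity) (by positivity), add_halves]
    refine le_trans (measure_mono ?_) ((measure_union_le _ _).trans (add_le_add h1 h2))
    rintro x ⟨θ, ⟨hθA, hθB, m1, m2⟩, hx⟩
    rw [sampleProc_add (m1.integrable (by simp)) (m2.integrable (by simp))] at hx
    by_contra hcon
    simp only [Set.mem_union, Set.mem_ofPred_eq, not_or, not_exists, not_and, not_lt] at hcon
    have := abs_add_le (sampleProc P n (h θ) x) (sampleProc P n (k θ) x)
    linarith [hcon.1 θ hθA, hcon.2 θ hθB]

/-- Multiplication by a fixed bounded function. -/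
theorem StochEquicont.mul_left (hh : StochEquicont P 𝓛 h) {w : S → ℝ} (hw : Measurable w) {C : ℝ}
    (hC : ∀ x, |w x| ≤ C) : StochEquicont P 𝓛 fun θ x => w x * h θ x := by
  have hC0 : ∀ x : S, 0 ≤ C := fun x => (abs_nonneg _).trans (hC x)
  refine hh.contraction (Φ := fun x t => w x * t) (L := max C 0) ?_ (le_max_right _ _)
    (fun x => mul_zero _) fun x a b => ?_
  · exact (hw.comp measurable_fst).mul measurable_snd
  · rw [← mul_sub, abs_mul]
    exact mul_le_mul_of_nonneg_right ((hC x).trans (le_max_left _ _)) (abs_nonneg _)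

/-! ### Truncation and products of bounded families. -/

/-- The truncation of a real number to the interval `[a, b]`. -/
def clip (a b u : ℝ) : ℝ := max a (min b u)

theorem abs_clip_sub_le (a b u v : ℝ) : |clip a b u - clip a b v| ≤ |u - v| := by
  have h1 := abs_max_sub_max_le_max a (min b u) a (min b v)
  have h2 := abs_min_sub_min_le_max b u b v
  simp only [sub_self, abs_zero] at h1 h2
  rw [max_eq_right (abs_nonneg (min b u - min b v))] at h1
  rw [max_eq_right (abs_nonneg (u - v))] at h2
  exact h1.trans h2

theorem measurable_clip (a b : ℝ) : Measurable (clip a b) :=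
  measurable_const.max (measurable_const.min measurable_id)

theorem le_clip (a b u : ℝ) : a ≤ clip a b u := le_max_left _ _

theorem clip_le {a b : ℝ} (hab : a ≤ b) (u : ℝ) : clip a b u ≤ b := max_le hab (min_le_left _ _)

theorem clip_eq {a b u : ℝ} (ha : a ≤ u) (hb : u ≤ b) : clip a b u = u := by
  rw [clip, min_eq_right hb, max_eq_right ha]

theorem abs_clip_le {C : ℝ} (hC : 0 ≤ C) (u : ℝ) : |clip (-C) C u| ≤ C :=
  abs_le.2 ⟨le_clip _ _ _, clip_le (by linarith) _⟩

/-- The increment of `T` from the base point `f₀ x` is a Lipschitz function of the difference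
vanishing at zero; this is why the contraction admits maps that depend on `x`. -/
theorem StochEquicont.comp_sub {f : Θ → S → ℝ} {f₀ : S → ℝ} (hf₀ : Measurable f₀)
    (hh : StochEquicont P 𝓛 fun θ x => f θ x - f₀ x) {T : ℝ → ℝ} (hT : Measurable T) {L : ℝ}
    (hL : 0 ≤ L) (hTL : ∀ a b, |T a - T b| ≤ L * |a - b|) :
    StochEquicont P 𝓛 fun θ x => T (f θ x) - T (f₀ x) := by
  have h1 := hh.contraction (Φ := fun x t => T (f₀ x + t) - T (f₀ x)) (L := L)
    ((hT.comp ((hf₀.comp measurable_fst).add measurable_snd)).sub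
      (hT.comp (hf₀.comp measurable_fst))) hL (fun x => by simp) fun x a b => by
        rw [sub_sub_sub_cancel_right]
        simpa using hTL (f₀ x + a) (f₀ x + b)
  simpa using h1

/-- Polarization reduces the product to squares of `p + q` and `p - q`. Both are bounded by `2C`, so
the square may be truncated there, where it is Lipschitz with constant `4C`. -/
theorem StochEquicont.mul_of_bounded {p q : Θ → S → ℝ} (hp : StochEquicont P 𝓛 p)
    (hq : StochEquicont P 𝓛 q) {C : ℝ} (hC : 0 ≤ C) (hpC : ∀ θ x, |p θ x| ≤ C)
    (hqC : ∀ θ x, |q θ x| ≤ C) : StochEquicont P 𝓛 fun θ x => p θ x * q θ x := by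
  have hsq : ∀ {k : Θ → S → ℝ}, StochEquicont P 𝓛 k → ∀ c : ℝ,
      StochEquicont P 𝓛 fun θ x => c * clip (-(2 * C)) (2 * C) (k θ x) ^ 2 := by
    intro k hk c
    have hc0 : clip (-(2 * C)) (2 * C) 0 = 0 := clip_eq (by linarith) (by linarith)
    refine hk.contraction (Φ := fun _ t => c * clip (-(2 * C)) (2 * C) t ^ 2)
      (L := |c| * (4 * C)) ?_ (by positivity) (fun x => by simp [hc0]) fun x a b => ?_
    · exact (((measurable_clip _ _).comp measurable_snd).pow_const 2).const_mul c
    · rw [← mul_sub, abs_mul, sq_sub_sq, abs_mul, mul_assoc |c|]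
      refine mul_le_mul_of_nonneg_left (mul_le_mul ?_ (abs_clip_sub_le _ _ _ _) (abs_nonneg _)
        (by positivity)) (abs_nonneg _)
      have h1 := abs_clip_le (C := 2 * C) (by positivity) a
      have h2 := abs_clip_le (C := 2 * C) (by positivity) b
      refine (abs_add_le _ _).trans (by linarith)
  have hneg := hq.mul_left (w := fun _ => -1) (C := 1) measurable_const (by simp)
  have h1 := (hsq (hp.add hq) (1 / 4)).add (hsq (hp.add hneg) (-(1 / 4)))
  convert h1 using 3 with θ x
  have hb1 := abs_le.1 ((abs_add_le (p θ x) (q θ x)).trans (add_le_add (hpC θ x) (hqC θ x)))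
  have hb2 := abs_le.1 ((abs_sub (p θ x) (q θ x)).trans (add_le_add (hpC θ x) (hqC θ x)))
  rw [clip_eq (by linarith [hb1.1]) (by linarith [hb1.2]),
    clip_eq (by linarith [hb2.1]) (by linarith [hb2.2])]
  ring

/-- Products of uniformly bounded stochastically equicontinuous families. -/
theorem StochEquicont.mul_sub {u v : Θ → S → ℝ} {u₀ v₀ : S → ℝ}
    (hu : StochEquicont P 𝓛 fun θ x => u θ x - u₀ x)
    (hv : StochEquicont P 𝓛 fun θ x => v θ x - v₀ x) (hu₀ : Measurable u₀) (hv₀ : Measurable v₀)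
    {C : ℝ} (hC : 0 ≤ C) (huC : ∀ θ x, |u θ x| ≤ C) (hvC : ∀ θ x, |v θ x| ≤ C)
    (hu₀C : ∀ x, |u₀ x| ≤ C) (hv₀C : ∀ x, |v₀ x| ≤ C) :
    StochEquicont P 𝓛 fun θ x => u θ x * v θ x - u₀ x * v₀ x := by
  -- Expansion of the product around `u₀ * v₀`: two linear terms and a product of differences.
  have h1 := ((hu.mul_left hv₀ hv₀C).add (hv.mul_left hu₀ hu₀C)).add
    (hu.mul_of_bounded hv (C := 2 * C) (by positivity)
      (fun θ x => (abs_sub _ _).trans (by linarith [huC θ x, hu₀C x]))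
      (fun θ x => (abs_sub _ _).trans (by linarith [hvC θ x, hv₀C x])))
  convert h1 using 3 with θ x
  ring

end GComp

/-! ### From Donsker classes to stochastic equicontinuity. -/

namespace GComp

variable {S : Type*} [MeasurableSpace S] {P : Measure S} [IsProbabilityMeasure P]

/-- Replacement of the first `n` terms of a sequence. -/
def splice {n : ℕ} (p : (Fin n → S) × (ℕ → S)) (i : ℕ) : S :=
  if h : i < n then p.1 ⟨i, h⟩ else p.2 i

omit [MeasurableSpace S] in
theorem splice_lt {n : ℕ} (p : (Fin n → S) × (ℕ → S)) {i : ℕ} (h : i < n) :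
    splice p i = p.1 ⟨i, h⟩ := dif_pos h

omit [MeasurableSpace S] in
theorem splice_ge {n : ℕ} (p : (Fin n → S) × (ℕ → S)) {i : ℕ} (h : ¬ i < n) :
    splice p i = p.2 i := dif_neg h

/-- Splits an infinite sample into its first `n` terms and an independent sequence, so that Fubini
applies to hulls of cylinders over non-measurable bases. -/
theorem measurePreserving_splice (n : ℕ) :
    MeasurePreserving (splice (S := S) (n := n))
      ((sampleLaw P n).prod (Measure.infinitePi fun _ : ℕ => P))
      (Measure.infinitePi fun _ : ℕ => P) := by
  have hm : Measurable (splice (S := S) (n := n)) := by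
    refine measurable_pi_lambda _ fun i => ?_
    by_cases h : i < n
    · simp only [splice, h, dif_pos]
      fun_prop
    · simp only [splice, h, dif_neg, not_false_eq_true]
      fun_prop
  refine ⟨hm, Measure.eq_infinitePi _ fun s t ht => ?_⟩
  classical
  rw [Measure.map_apply hm (MeasurableSet.pi s.countable_toSet fun i _ => ht i)]
  have hpre : splice (n := n) ⁻¹' (Set.pi s t) =
      (Set.pi Set.univ fun i : Fin n => if (i : ℕ) ∈ s then t i else Set.univ) ×ˢ
        (Set.pi (s.filter fun i => ¬ i < n) t) := by
    ext p
    simp only [Set.mem_preimage, Set.mem_pi, Set.mem_prod, Set.mem_univ, true_imp_iff,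
      Finset.mem_coe, Finset.mem_filter]
    constructor
    · intro hp
      refine ⟨fun i => ?_, fun i hi => ?_⟩
      · split_ifs with his
        · simpa [splice_lt p i.2] using hp i his
        · trivial
      · simpa [splice_ge p hi.2] using hp i hi.1
    · rintro ⟨h1, h2⟩ i hi
      by_cases hin : i < n
      · simpa [splice_lt p hin, hi] using h1 ⟨i, hin⟩
      · simpa [splice_ge p hin] using h2 i ⟨hi, hin⟩
  rw [hpre, Measure.prod_prod, Measure.pi_pi, Measure.infinitePi_pi _ fun i _ => ht i]
  have h1 : ∏ i : Fin n, P (if (i : ℕ) ∈ s then t i else Set.univ) =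
      ∏ i ∈ s.filter fun i => i < n, P (t i) := by
    rw [← Finset.prod_range fun i => P (if i ∈ s then t i else Set.univ)]
    have h2 : ∀ i, P (if i ∈ s then t i else Set.univ) = if i ∈ s then P (t i) else 1 := by
      intro i
      split_ifs <;> simp
    simp only [h2]
    rw [← Finset.prod_filter]
    refine Finset.prod_congr ?_ fun _ _ => rfl
    ext i
    simp [and_comm]
  rw [h1, Finset.prod_filter_mul_prod_filter_not]

/-- The outer measure of a cylinder is at least that of its base. -/
theorem sampleLaw_le_infinitePi (n : ℕ) (B : Set (Fin n → S)) :
    sampleLaw P n B ≤ Measure.infinitePi (fun _ : ℕ => P) {s | (fun i : Fin n => s i) ∈ B} := by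
  set μ := Measure.infinitePi fun _ : ℕ => P
  set C := toMeasurable μ {s | (fun i : Fin n => s i) ∈ B}
  have hs := measurePreserving_splice (P := P) n
  have hC : MeasurableSet C := measurableSet_toMeasurable _ _
  have hC' : MeasurableSet (splice (n := n) ⁻¹' C) := hs.measurable hC
  -- Over a point of `B` every continuation lies in the cylinder, so the section of the hull is the
  -- whole space.
  have hsub : B ⊆ {x | 1 ≤ μ (Prod.mk x ⁻¹' (splice (n := n) ⁻¹' C))} := by
    intro x hx
    have : Prod.mk x ⁻¹' (splice (n := n) ⁻¹' C) = Set.univ := by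
      refine Set.eq_univ_of_forall fun s => subset_toMeasurable _ _ ?_
      change (fun i : Fin n => splice (x, s) i) ∈ B
      simpa [splice_lt] using hx
    simp only [Set.mem_ofPred_eq, this]
    simp
  have hmk := mul_meas_ge_le_lintegral (μ := sampleLaw P n)
    (measurable_measure_prodMk_left (ν := μ) hC') 1
  rw [← Measure.prod_apply hC', one_mul, hs.measure_preimage hC.nullMeasurableSet,
    measure_toMeasurable] at hmk
  exact (measure_mono hsub).trans hmk

omit [IsProbabilityMeasure P] in
theorem empProc_eq_sampleProc (s : ℕ → S) (n : ℕ) (f : S → ℝ) :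
    empProc P s n f = sampleProc P n f fun i => s i := by
  rw [empProc, empMean, sampleProc, Finset.sum_sub_distrib,
    Finset.sum_range fun i => f (s i)]
  simp only [Finset.sum_const, Finset.card_univ, Fintype.card_fin, nsmul_eq_mul]
  rcases Nat.eq_zero_or_pos n with rfl | hn
  · simp
  · have hn' : (0 : ℝ) < n := by exact_mod_cast hn
    have h1 : √(n : ℝ) * √(n : ℝ) = n := Real.mul_self_sqrt hn'.le
    have h2 : 0 < √(n : ℝ) := Real.sqrt_pos.2 hn'
    set r := √(n : ℝ)
    rw [← h1]
    field_simp

/-- The empirical process of a Donsker class is close to a finite set of functions. -/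
theorem IsDonsker.exists_finite_net {F : Set (S → ℝ)} (hF : IsDonsker P F) {η ε : ℝ} (hη : 0 < η)
    (hε : 0 < ε) : ∃ t : Set (Linf F), t.Finite ∧ ∀ᶠ n in atTop,
      Measure.infinitePi (fun _ : ℕ => P)
        {s | ¬ ∃ z ∈ t, ∀ f : F, |empProc P s n (f : S → ℝ) - z f| ≤ η} ≤ ENNReal.ofReal ε := by
  obtain ⟨-, hbd, L, hL1, hLt, hconv⟩ := hF
  let _ : MeasurableSpace (Linf F) := borel (Linf F)
  have : BorelSpace (Linf F) := ⟨rfl⟩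
  have : IsProbabilityMeasure L := ⟨hL1⟩
  set μ := Measure.infinitePi fun _ : ℕ => P
  -- Being below 1, it forces the compact set `K` to be nonempty, so that `Metric.infDist` to it is
  -- meaningful.
  set ε' := min ε 1 / 2
  have hε' : 0 < ε' := by positivity
  have hε'1 : ε' < 1 := by
    have := min_le_right ε 1
    simp only [ε']
    linarith
  have hε'ε : ε' < ε := by
    have := min_le_left ε 1
    simp only [ε']
    linarith
  obtain ⟨K, hK, hKL⟩ := isTightMeasureSet_iff_exists_isCompact_measure_compl_le.1 hLt
    (ENNReal.ofReal ε') (by simpa using hε')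
  have hKc : L Kᶜ ≤ ENNReal.ofReal ε' := hKL L rfl
  have hKne : K.Nonempty := by
    by_contra hcon
    rw [Set.not_nonempty_iff_eq_empty.1 hcon, Set.compl_empty, hL1] at hKc
    have := ENNReal.one_le_ofReal.1 hKc
    linarith
  obtain ⟨t, -, htfin, htK⟩ := hK.finite_cover_balls (half_pos hη)
  refine ⟨t, htfin, ?_⟩
  -- A continuous test function that vanishes on `K` and equals 1 at distance at least `η/2`. Weak
  -- convergence bounds its outer expectation, and Markov for a measurable majorant bounds the
  -- probability of being far from `K`.
  have hcont : Continuous fun z : Linf F => min 1 (Metric.infDist z K / (η / 2)) :=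
    continuous_const.min ((Metric.continuous_infDist_pt K).div_const _)
  have hpos : ∀ z : Linf F, 0 ≤ min 1 (Metric.infDist z K / (η / 2)) := fun z =>
    le_min zero_le_one (div_nonneg Metric.infDist_nonneg (by positivity))
  set φ : BoundedContinuousFunction (Linf F) ℝ :=
    BoundedContinuousFunction.ofNormedAddCommGroup _ hcont 1 fun z => by
      rw [Real.norm_eq_abs, abs_of_nonneg (hpos z)]
      exact min_le_left _ _
  have hφ : ∀ z, φ z = min 1 (Metric.infDist z K / (η / 2)) := fun z => rfl
  have hint : ∫ z, φ z ∂L ≤ ε' := by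
    have hKm : MeasurableSet Kᶜ := hK.isClosed.measurableSet.compl
    calc ∫ z, φ z ∂L ≤ ∫ z, Kᶜ.indicator 1 z ∂L := by
          refine integral_mono (φ.integrable L) ((integrable_const 1).indicator hKm) fun z => ?_
          by_cases hz : z ∈ K
          · rw [Set.indicator_of_notMem (by simpa using hz), hφ, Metric.infDist_zero_of_mem hz]
            simp
          · rw [Set.indicator_of_mem (by simpa using hz), hφ]
            exact min_le_left _ _
      _ = L.real Kᶜ := integral_indicator_one hKm
      _ ≤ ε' := ENNReal.toReal_le_of_le_ofReal hε'.le hKc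
  have hev := (hconv φ).eventually_lt_const (hint.trans_lt hε'ε)
  filter_upwards [hev] with n hn
  obtain ⟨c, ⟨U, hUm, hUi, hUle, rfl⟩, hc⟩ := exists_lt_of_csInf_lt
    (by
      refine ⟨_, fun _ => 1, measurable_const, integrable_const 1, ae_of_all _ fun s => ?_, rfl⟩
      exact min_le_left _ _) hn
  have hU0 : 0 ≤ᵐ[μ] U := by
    filter_upwards [hUle] with s hs
    exact (hpos _).trans hs
  have hmarkov := mul_meas_ge_le_integral_of_nonneg hU0 hUi 1
  rw [one_mul] at hmarkov
  have hprob : μ {s | 1 ≤ U s} ≤ ENNReal.ofReal ε := by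
    rw [← ENNReal.ofReal_toReal (measure_ne_top μ {s | 1 ≤ U s})]
    exact ENNReal.ofReal_le_ofReal (hmarkov.trans hc.le)
  refine (measure_mono_ae ?_).trans hprob
  filter_upwards [hUle, hbd n] with s hs hsb hbad
  by_contra hlt
  have hlt' : U s < 1 := not_le.1 hlt
  set z := toLinf F fun f : F => empProc P s n (f : S → ℝ)
  have h1 : φ z < 1 := hs.trans_lt hlt'
  rw [hφ, min_lt_iff] at h1
  have h2 : Metric.infDist z K < η / 2 := by
    rcases h1 with h1 | h1
    · exact absurd h1 (lt_irrefl _)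
    · rwa [div_lt_one (by positivity)] at h1
  obtain ⟨y, hyK, hy⟩ := (Metric.infDist_lt_iff hKne).1 h2
  obtain ⟨w, hw, hyw⟩ := Set.mem_iUnion₂.1 (htK hyK)
  refine hbad ⟨w, hw, fun f => ?_⟩
  have hzf : z f = empProc P s n (f : S → ℝ) := by
    simp only [z, toLinf, dif_pos hsb]
  have h3 : dist z w ≤ η := by
    have := dist_triangle z y w
    have := Metric.mem_ball.1 hyw
    linarith
  rw [← hzf, ← Real.norm_eq_abs]
  refine le_trans ?_ h3
  rw [dist_eq_norm]
  exact lp.norm_apply_le_norm ENNReal.top_ne_zero (z - w) f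

/-- A Donsker class yields a stochastically equicontinuous family at any square integrable
function. -/
theorem IsDonsker.stochEquicont {F : Set (S → ℝ)} (hF : IsDonsker P F) {Θ : Type*} {𝓛 : Filter Θ}
    {f : Θ → S → ℝ} {f₀ : S → ℝ} (hf₀ : MemLp f₀ 2 P) (hf : ∀ᶠ θ in 𝓛, f θ ∈ F)
    (hsmall : Tendsto (fun θ => ∫ y, (f θ y - f₀ y) ^ 2 ∂P) 𝓛 (𝓝 0)) :
    StochEquicont P 𝓛 fun θ x => f θ x - f₀ x := by
  refine ⟨hf.mono fun θ hθ => (hF.1 _ hθ).2.sub hf₀, hsmall, fun e he => ?_⟩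
  set η := e / 7 with hη_def
  have hη : 0 < η := by positivity
  obtain ⟨t, htfin, ht⟩ := hF.exists_finite_net hη (half_pos he)
  have : Fintype t := htfin.fintype
  -- The class is partitioned by its values under the finitely many elements of the net. These
  -- vectors are bounded in finite dimension, so finitely many cells of radius `η` suffice; inside a
  -- cell the empirical process varies by at most `4η` on the good event.
  set vec : F → t → ℝ := fun g z => (z : Linf F) g
  have hbdd : Bornology.IsBounded (Set.range vec) := by
    rw [isBounded_iff_forall_norm_le]
    obtain ⟨C, hC⟩ := htfin.isBounded.exists_norm_le
    refine ⟨max C 0, ?_⟩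
    rintro _ ⟨g, rfl⟩
    rw [pi_norm_le_iff_of_nonneg (le_max_right _ _)]
    intro z
    exact (lp.norm_apply_le_norm ENNReal.top_ne_zero (z : Linf F) g).trans
      ((hC z z.2).trans (le_max_left _ _))
  obtain ⟨c, hcfin, hc⟩ := Metric.totallyBounded_iff.1
    (hbdd.isCompact_closure.totallyBounded.subset subset_closure) η hη
  set cell : (t → ℝ) → F → Prop := fun v g => dist (vec g) v < η
  set τ := η ^ 2 * (e / 2) / (hcfin.toFinset.card + 1) with hτ_def
  have hτ : 0 < τ := by positivity
  have hrep : ∀ v : t → ℝ, ∃ δ > 0, ∃ k : S → ℝ, MemLp k 2 P ∧ ∫ y, (k y - f₀ y) ^ 2 ∂P ≤ τ ∧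
      ∀ g : F, cell v g → ∫ y, ((g : S → ℝ) y - f₀ y) ^ 2 ∂P < δ → ∃ g' : F, k = g' ∧ cell v g' := by
    intro v
    by_cases hex : ∃ g : F, cell v g ∧ ∫ y, ((g : S → ℝ) y - f₀ y) ^ 2 ∂P < τ
    · obtain ⟨g, hg, hgτ⟩ := hex
      exact ⟨1, one_pos, g, (hF.1 _ g.2).2, hgτ.le, fun _ _ _ => ⟨g, rfl, hg⟩⟩
    · refine ⟨τ, hτ, f₀, hf₀, by simpa using hτ.le, fun g hg hgτ => absurd ⟨g, hg, hgτ⟩ hex⟩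
  choose δ hδ k hkL hkτ hk using hrep
  refine ⟨{θ | f θ ∈ F ∧ ∀ v ∈ c, ∫ y, (f θ y - f₀ y) ^ 2 ∂P < δ v}, ?_, ?_⟩
  · filter_upwards [hf, (eventually_all_finite hcfin).2 fun v _ =>
      hsmall.eventually_lt_const (hδ v)] with θ h1 h2 using ⟨h1, h2⟩
  filter_upwards [ht] with n hn
  set μ := Measure.infinitePi fun _ : ℕ => P
  set W : (t → ℝ) → Set (Fin n → S) :=
    fun v => {x | η ≤ |sampleProc P n (fun y => k v y - f₀ y) x|}
  have hW : ∀ v, μ {s | (fun i : Fin n => s i) ∈ W v} ≤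
      ENNReal.ofReal ((e / 2) / (hcfin.toFinset.card + 1)) := by
    intro v
    have hmp : MeasurePreserving (fun (s : ℕ → S) (i : Fin n) => s i) μ (sampleLaw P n) := by
      refine ⟨by fun_prop, ?_⟩
      rw [sampleLaw, ← Measure.infinitePi_eq_pi]
      exact Measure.map_infinitePi_infinitePi_of_inj (P := fun _ : ℕ => P) Fin.val_injective
    refine (Measure.le_map_apply hmp.measurable.aemeasurable (W v)).trans ?_
    rw [hmp.map_eq]
    refine (chebyshev_sampleProc P ((hkL v).sub hf₀) n hη).trans (ENNReal.ofReal_le_ofReal ?_)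
    rw [div_le_iff₀ (by positivity)]
    refine (hkτ v).trans (le_of_eq ?_)
    rw [hτ_def]
    ring
  refine (sampleLaw_le_infinitePi n _).trans ?_
  calc _ ≤ μ ({s | ¬ ∃ z ∈ t, ∀ f : F, |empProc P s n (f : S → ℝ) - z f| ≤ η} ∪
        ⋃ v ∈ hcfin.toFinset, {s | (fun i : Fin n => s i) ∈ W v}) := measure_mono ?_
    _ ≤ ENNReal.ofReal (e / 2) + ENNReal.ofReal (e / 2) := by
        refine (measure_union_le _ _).trans (add_le_add hn ?_)
        refine (measure_biUnion_finset_le _ _).trans ?_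
        refine (Finset.sum_le_sum fun v _ => hW v).trans ?_
        rw [Finset.sum_const, nsmul_eq_mul, ← ENNReal.ofReal_natCast,
          ← ENNReal.ofReal_mul (by positivity)]
        refine ENNReal.ofReal_le_ofReal ?_
        rw [mul_div_assoc', div_le_iff₀ (by positivity)]
        nlinarith
    _ = ENNReal.ofReal e := by
        rw [← ENNReal.ofReal_add (by positivity) (by positivity), add_halves]
  rintro s ⟨θ, ⟨hθF, hθδ⟩, hθ⟩
  by_contra hcon
  obtain ⟨z, hz, hzf⟩ : ∃ z ∈ t, ∀ f : F, |empProc P s n (f : S → ℝ) - z f| ≤ η := by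
    by_contra hno
    exact hcon (Or.inl hno)
  have hWs : ∀ v ∈ c, (fun i : Fin n => s i) ∉ W v := fun v hv hw =>
    hcon (Or.inr (Set.mem_biUnion (hcfin.mem_toFinset.2 hv) hw))
  obtain ⟨v, hv, hgv⟩ := Set.mem_iUnion₂.1 (hc ⟨⟨f θ, hθF⟩, rfl⟩)
  obtain ⟨g', hg'k, hg'v⟩ := hk v ⟨f θ, hθF⟩ hgv (hθδ v hv)
  have hWv : |sampleProc P n (fun y => k v y - f₀ y) (fun i => s i)| < η := not_le.1 (hWs v hv)
  have hd : ∀ g : F, cell v g → |(z : Linf F) g - v ⟨z, hz⟩| < η := by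
    intro g hg
    have := (dist_le_pi_dist (vec g) v ⟨z, hz⟩).trans_lt hg
    rwa [Real.dist_eq] at this
  have h1 := hd _ hgv
  have h2 := hd _ hg'v
  have h3 := hzf ⟨f θ, hθF⟩
  have h4 := hzf g'
  have hi : ∀ {u : S → ℝ}, MemLp u 2 P → Integrable u P := fun hu => hu.integrable (by simp)
  have hsplit : sampleProc P n (fun y => f θ y - f₀ y) (fun i => s i) =
      (empProc P s n (f θ) - empProc P s n g') +
        sampleProc P n (fun y => k v y - f₀ y) (fun i => s i) := by
    rw [empProc_eq_sampleProc, empProc_eq_sampleProc, ← hg'k]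
    have e1 := sampleProc_add (hi ((hF.1 _ hθF).2.sub hf₀)) (hi hf₀) n fun i : Fin n => s i
    have e2 := sampleProc_add (hi ((hkL v).sub hf₀)) (hi hf₀) n fun i : Fin n => s i
    simp only [Pi.sub_apply, sub_add_cancel] at e1 e2
    change sampleProc P n (f θ) _ = sampleProc P n (fun y => f θ y - f₀ y) _ + _ at e1
    change sampleProc P n (k v) _ = sampleProc P n (fun y => k v y - f₀ y) _ + _ at e2
    rw [e1, e2]
    ring
  change e < |sampleProc P n (fun y => f θ y - f₀ y) (fun i => s i)| at hθ
  rw [hsplit] at hθ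
  have he7 : e = 7 * η := by rw [hη_def]; ring
  rw [abs_le] at h3 h4
  rw [abs_lt] at h1 h2 hWv
  rw [lt_abs, he7] at hθ
  simp only at h3
  rcases hθ with hθ | hθ <;> linarith [h1.1, h1.2, h2.1, h2.2, h3.1, h3.2, h4.1, h4.2, hWv.1, hWv.2]

end GComp

namespace GComp

/-! ### Convergence in outer probability as convergence along a filter -/

variable {Ω : Type*} [MeasurableSpace Ω]

/-- The filter of the sequences of events whose complements have outer probability tending to
zero. -/
def probFilter (Pr : Measure Ω) : Filter (ℕ × Ω) where
  sets := {E | Tendsto (fun n => Pr {ω | (n, ω) ∉ E}) atTop (𝓝 0)}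
  univ_sets := by simp
  sets_of_superset {E E'} hE hsub := by
    refine tendsto_of_tendsto_of_tendsto_of_le_of_le tendsto_const_nhds hE (fun _ => zero_le)
      fun n => measure_mono fun ω h1 h2 => h1 (hsub h2)
  inter_sets {E E'} hE hE' := by
    have h := hE.add hE'
    rw [add_zero] at h
    refine tendsto_of_tendsto_of_tendsto_of_le_of_le tendsto_const_nhds h (fun _ => zero_le)
      fun n => (measure_mono fun ω h1 => ?_).trans (measure_union_le _ _)
    by_cases h2 : (n, ω) ∈ E
    · exact Or.inr fun h3 => h1 ⟨h2, h3⟩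
    · exact Or.inl h2

variable {Pr : Measure Ω}

theorem eventually_probFilter {q : ℕ × Ω → Prop} :
    (∀ᶠ p in probFilter Pr, q p) ↔ Tendsto (fun n => Pr {ω | ¬ q (n, ω)}) atTop (𝓝 0) := Iff.rfl

theorem WithProbTendstoOne.eventually {E : ℕ → Set Ω} (h : WithProbTendstoOne Pr E) :
    ∀ᶠ p in probFilter Pr, p.2 ∈ E p.1 := eventually_probFilter.2 h

theorem eventually_probFilter_of_ae {q : ℕ × Ω → Prop} (h : ∀ n, ∀ᵐ ω ∂Pr, q (n, ω)) :
    ∀ᶠ p in probFilter Pr, q p := by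
  refine eventually_probFilter.2 ?_
  have : ∀ n, Pr {ω | ¬ q (n, ω)} = 0 := fun n => ae_iff.1 (h n)
  simp [this]

theorem tendsto_fst_probFilter : Tendsto Prod.fst (probFilter Pr) (atTop : Filter ℕ) := by
  intro E hE
  refine eventually_probFilter.2 (tendsto_const_nhds.congr' ?_)
  filter_upwards [hE] with n hn
  simp [hn]

theorem OuterLittleOOne.tendsto {N : ℕ → Ω → ℝ≥0∞} (h : OuterLittleOOne Pr N) :
    Tendsto (fun p : ℕ × Ω => N p.1 p.2) (probFilter Pr) (𝓝 0) := by
  rw [ENNReal.tendsto_nhds_zero]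
  intro ε hε
  refine eventually_probFilter.2 (tendsto_of_tendsto_of_tendsto_of_le_of_le tendsto_const_nhds
    (h ε hε) (fun _ => zero_le) fun n => measure_mono fun ω hω => ?_)
  exact (not_le.1 hω).le

theorem outerLittleORootN_iff {R : ℕ → Ω → ℝ} : OuterLittleORootN Pr R ↔
    Tendsto (fun p : ℕ × Ω => √(p.1 : ℝ) * R p.1 p.2) (probFilter Pr) (𝓝 0) := by
  have habs : ∀ p : ℕ × Ω, |√(p.1 : ℝ) * R p.1 p.2| = √(p.1 : ℝ) * |R p.1 p.2| := fun p => by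
    rw [abs_mul, abs_of_nonneg (Real.sqrt_nonneg _)]
  rw [tendsto_zero_iff_abs_tendsto_zero]
  simp only [Function.comp_def, habs]
  constructor
  · intro h
    have h1 := (ENNReal.tendsto_toReal ENNReal.zero_ne_top).comp (OuterLittleOOne.tendsto h)
    refine h1.congr fun p => ?_
    exact ENNReal.toReal_ofReal (by positivity)
  · intro h ε hε
    have h1 := ENNReal.tendsto_ofReal h
    rw [ENNReal.ofReal_zero] at h1
    have h2 := eventually_probFilter.1 (h1.eventually_lt_const hε)
    simpa only [not_lt] using h2

section IID

variable {S : Type*} [MeasurableSpace S] {P : Measure S} {X : ℕ → Ω → S}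

theorem measurePreserving_sample [IsProbabilityMeasure Pr] (hXmeas : ∀ i, Measurable (X i))
    (hXindep : iIndepFun X Pr) (hXlaw : ∀ i, Pr.map (X i) = P) (n : ℕ) :
    MeasurePreserving (fun ω (i : Fin n) => X i ω) Pr (sampleLaw P n) := by
  refine ⟨measurable_pi_lambda _ fun i => hXmeas i, ?_⟩
  have h := hXindep.precomp (g := fun i : Fin n => (i : ℕ)) Fin.val_injective
  rw [(iIndepFun_iff_map_fun_eq_pi_map fun i : Fin n => (hXmeas i).aemeasurable).1 h]
  simp [hXlaw]

variable (hS : ∀ n, MeasurePreserving (fun ω (i : Fin n) => X i ω) Pr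
  (sampleLaw P n))

-- The filter lives on the index set itself, so the random function at `(n, ω)` is one of the
-- functions over which the uniform bound is taken as soon as `(n, ω)` lies in `A`, which has
-- probability tending to one.
include hS in
theorem StochEquicont.tendsto {h : ℕ × Ω → S → ℝ} (hh : StochEquicont P (probFilter Pr) h) :
    Tendsto (fun p : ℕ × Ω => empProc P (fun i => X i p.2) p.1 (h p)) (probFilter Pr) (𝓝 0) := by
  rw [Metric.tendsto_nhds]
  intro e he
  refine eventually_probFilter.2 (ENNReal.tendsto_nhds_zero.2 fun δ hδ => ?_)
  -- The one parameter of `equi` serves both as level and as probability, so it must lie below both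
  -- targets.
  obtain ⟨e', he', he'δ⟩ : ∃ e' : ℝ, 0 < e' ∧ e' < e ∧ ENNReal.ofReal e' ≤ δ / 2 := by
    rcases eq_or_ne δ ∞ with rfl | hδt
    · exact ⟨e / 2, by positivity, by linarith, by
        rw [ENNReal.top_div_of_ne_top (by norm_num)]
        exact le_top⟩
    · have h2 : 0 < (δ / 2).toReal :=
        ENNReal.toReal_pos (ENNReal.half_pos hδ.ne').ne' (ENNReal.div_ne_top hδt (by norm_num))
      refine ⟨min (e / 2) (δ / 2).toReal, by positivity,
        (min_le_left _ _).trans_lt (by linarith), ?_⟩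
      exact (ENNReal.ofReal_le_ofReal (min_le_right _ _)).trans ENNReal.ofReal_toReal_le
  obtain ⟨A, hA, hAn⟩ := hh.equi e' he'
  have hA' : ∀ᶠ n in atTop, Pr {ω | (n, ω) ∉ A} ≤ δ / 2 :=
    ENNReal.tendsto_nhds_zero.1 hA _ (ENNReal.half_pos hδ.ne')
  filter_upwards [hAn, hA'] with n h1 h2
  have h3 := (Measure.le_map_apply (hS n).measurable.aemeasurable
    {x | ∃ θ ∈ A, e' < |sampleProc P n (h θ) x|}).trans ((hS n).map_eq.symm ▸ h1)
  rw [← ENNReal.add_halves δ]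
  refine le_trans (measure_mono ?_) ((measure_union_le _ _).trans
    (add_le_add h2 (h3.trans he'δ.2)))
  intro ω hω
  by_cases h4 : (n, ω) ∈ A
  · refine Or.inr ⟨(n, ω), h4, ?_⟩
    simp only [Set.mem_ofPred_eq, dist_zero_right, Real.norm_eq_abs, not_lt,
      empProc_eq_sampleProc] at hω
    exact he'δ.1.trans_le hω
  · exact Or.inl h4

include hS in
/-- The empirical process at a fixed function is bounded in probability. -/
theorem tendsto_empProc_mul [IsProbabilityMeasure P] {f : S → ℝ} (hf : MemLp f 2 P) {r : ℕ × Ω → ℝ}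
    (hr : Tendsto r (probFilter Pr) (𝓝 0)) :
    Tendsto (fun p : ℕ × Ω => empProc P (fun i => X i p.2) p.1 f * r p) (probFilter Pr)
      (𝓝 0) := by
  rw [Metric.tendsto_nhds]
  intro e he
  refine eventually_probFilter.2 (ENNReal.tendsto_nhds_zero.2 fun δ hδ => ?_)
  -- Chebyshev's bound does not depend on `n`, so one level `k` works for all sample sizes.
  have hlim : Tendsto (fun k : ℝ => ENNReal.ofReal ((∫ y, f y ^ 2 ∂P) / k ^ 2)) atTop (𝓝 0) := by
    rw [← ENNReal.ofReal_zero]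
    exact ENNReal.tendsto_ofReal (tendsto_const_nhds.div_atTop (tendsto_pow_atTop (by norm_num)))
  obtain ⟨k, hk, hk0⟩ := ((ENNReal.tendsto_nhds_zero.1 hlim (δ / 2)
    (ENNReal.half_pos hδ.ne')).and (eventually_gt_atTop 0)).exists
  have hr' := eventually_probFilter.1 (Metric.tendsto_nhds.1 hr (e / k) (by positivity))
  filter_upwards [ENNReal.tendsto_nhds_zero.1 hr' _ (ENNReal.half_pos hδ.ne')] with n hn
  have h3 := (Measure.le_map_apply (hS n).measurable.aemeasurable
    {x | k ≤ |sampleProc P n f x|}).trans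
      ((hS n).map_eq.symm ▸ (chebyshev_sampleProc P hf n hk0).trans hk)
  rw [← ENNReal.add_halves δ]
  refine le_trans (measure_mono ?_) ((measure_union_le _ _).trans (add_le_add hn h3))
  intro ω hω
  simp only [Set.mem_ofPred_eq, dist_zero_right, Real.norm_eq_abs, not_lt,
      empProc_eq_sampleProc] at hω
  by_contra hcon
  simp only [Set.mem_union, Set.mem_ofPred_eq, not_or, dist_zero_right, Real.norm_eq_abs, not_lt,
    not_le, Set.mem_preimage] at hcon
  have h4 : |sampleProc P n f (fun i => X i ω) * r (n, ω)| < k * (e / k) := by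
    rw [abs_mul]
    exact mul_lt_mul'' hcon.2 hcon.1 (abs_nonneg _) (abs_nonneg _)
  rw [mul_div_cancel₀ _ hk0.ne'] at h4
  linarith

theorem tendsto_inv_sqrt_probFilter :
    Tendsto (fun p : ℕ × Ω => (√(p.1 : ℝ))⁻¹) (probFilter Pr) (𝓝 0) :=
  (tendsto_inv_atTop_zero.comp (Real.tendsto_sqrt_atTop.comp tendsto_natCast_atTop_atTop)).comp
    tendsto_fst_probFilter

theorem empMean_eq (s : ℕ → S) {n : ℕ} (hn : 0 < n) (f : S → ℝ) :
    empMean s n f = empProc P s n f * (√(n : ℝ))⁻¹ + ∫ y, f y ∂P := by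
  have h2 : 0 < √(n : ℝ) := Real.sqrt_pos.2 (by exact_mod_cast hn)
  rw [empProc]
  field_simp
  ring

include hS in
/-- The weak law of large numbers. -/
theorem tendsto_empMean [IsProbabilityMeasure P] {f : S → ℝ} (hf : MemLp f 2 P) :
    Tendsto (fun p : ℕ × Ω => empMean (fun i => X i p.2) p.1 f) (probFilter Pr)
      (𝓝 (∫ y, f y ∂P)) := by
  have h1 := (tendsto_empProc_mul hS hf tendsto_inv_sqrt_probFilter).add_const (∫ y, f y ∂P)
  rw [zero_add] at h1
  refine h1.congr' ?_
  filter_upwards [tendsto_fst_probFilter.eventually (eventually_gt_atTop 0)] with p hp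
  exact (empMean_eq _ hp f).symm

include hS in
theorem StochEquicont.tendsto_empMean [IsProbabilityMeasure P] {h : ℕ × Ω → S → ℝ}
    (hh : StochEquicont P (probFilter Pr) h) :
    Tendsto (fun p : ℕ × Ω => empMean (fun i => X i p.2) p.1 (h p)) (probFilter Pr) (𝓝 0) := by
  have hmean : Tendsto (fun p => ∫ y, h p y ∂P) (probFilter Pr) (𝓝 0) := by
    have h1 : Tendsto (fun p => (∫ y, h p y ∂P) ^ 2) (probFilter Pr) (𝓝 0) :=
      squeeze_zero' (Eventually.of_forall fun p => sq_nonneg _)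
        (hh.memLp.mono fun p hp => sq_integral_le hp) hh.small
    have h2 := (Real.continuous_sqrt.tendsto 0).comp h1
    rw [Real.sqrt_zero] at h2
    rw [tendsto_zero_iff_abs_tendsto_zero]
    exact h2.congr fun p => Real.sqrt_sq_eq_abs _
  have h1 := ((hh.tendsto hS).mul tendsto_inv_sqrt_probFilter).add hmean
  rw [zero_mul, zero_add] at h1
  refine h1.congr' ?_
  filter_upwards [tendsto_fst_probFilter.eventually (eventually_gt_atTop 0)] with p hp
  exact (empMean_eq _ hp (h p)).symm

end IID

end GComp

namespace GComp

/-! ### Identities in the observational model -/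

section Model

variable {d : ℕ} (P : Measure (Obs d)) [IsProbabilityMeasure P]

theorem measurable_treated : Measurable (treated (d := d)) :=
  Measurable.ite (measurable_snd.fst (measurableSet_singleton true)) measurable_const
    measurable_const

theorem measurable_control : Measurable (control (d := d)) :=
  Measurable.ite (measurable_snd.fst (measurableSet_singleton true)) measurable_const
    measurable_const

theorem control_eq (x : Obs d) : control x = 1 - treated x := by
  rw [control, treated]
  split_ifs <;> simp

theorem abs_treated_le (x : Obs d) : |treated x| ≤ 1 := by
  rw [treated]
  split_ifs <;> simp

theorem abs_control_le (x : Obs d) : |control x| ≤ 1 := by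
  rw [control]
  split_ifs <;> simp

theorem measurable_propensity : Measurable (propensity P) :=
  (Kernel.measurable_coe _ (measurableSet_singleton true)).ennreal_toReal

theorem measurable_outcomeReg : Measurable (outcomeReg P) := by
  have h : StronglyMeasurable fun p : Bool × (Fin d → ℝ) =>
      ∫ y, y ∂(condDistrib (fun x : Obs d => x.1) (fun x : Obs d => x.2) P p) :=
    StronglyMeasurable.integral_kernel (f := fun y : ℝ => y) stronglyMeasurable_id
  exact h.measurable.comp (measurable_const.prodMk measurable_id)

/-- The tower property, by disintegrating the law of the treatment over the covariates. -/
theorem integral_treated_mul {v : (Fin d → ℝ) → ℝ} (hv : Measurable v) {C : ℝ}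
    (hC : ∀ᵐ x ∂P, |v x.2.2| ≤ C) :
    ∫ x, treated x * v x.2.2 ∂P = ∫ x, propensity P x.2.2 * v x.2.2 ∂P := by
  have hZ : Measurable fun x : Obs d => x.2.2 := by fun_prop
  have hA : Measurable fun x : Obs d => x.2.1 := by fun_prop
  set f : (Fin d → ℝ) × Bool → ℝ := fun p => (if p.2 = true then 1 else 0) * v p.1
  have hf : Measurable f := (Measurable.ite (measurable_snd (measurableSet_singleton true))
    measurable_const measurable_const).mul (hv.comp measurable_fst)
  have hcomp := compProd_map_condDistrib (mβ := inferInstance) (X := fun x : Obs d => x.2.2) (μ := P)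
    hA.aemeasurable
  have hi : Integrable f ((P.map fun x : Obs d => x.2.2) ⊗ₘ
      condDistrib (fun x : Obs d => x.2.1) (fun x : Obs d => x.2.2) P) := by
    rw [hcomp]
    refine (integrable_map_measure hf.aestronglyMeasurable (hZ.prodMk hA).aemeasurable).2 ?_
    refine Integrable.of_bound (hf.comp (hZ.prodMk hA)).aestronglyMeasurable C ?_
    filter_upwards [hC] with x hx
    simp only [Function.comp, f, Real.norm_eq_abs, abs_mul]
    refine (mul_le_of_le_one_left (abs_nonneg _) ?_).trans hx
    split_ifs <;> simp
  have h1 := Measure.integral_compProd hi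
  rw [hcomp, integral_map (hZ.prodMk hA).aemeasurable hf.aestronglyMeasurable] at h1
  change ∫ x, f (x.2.2, x.2.1) ∂P = _ at h1
  change ∫ x, f (x.2.2, x.2.1) ∂P = _
  rw [h1]
  have h2 : ∀ z, ∫ b, f (z, b) ∂(condDistrib (fun x : Obs d => x.2.1)
      (fun x : Obs d => x.2.2) P z) = propensity P z * v z := by
    intro z
    simp only [f]
    rw [integral_mul_const]
    congr 1
    rw [propensity, ← integral_indicator_one (measurableSet_singleton true)]
    refine integral_congr_ae (ae_of_all _ fun b => ?_)
    cases b <;> simp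
  simp only [h2]
  exact integral_map hZ.aemeasurable ((measurable_propensity P).mul hv).aestronglyMeasurable

/-- The tower property over the pair of treatment and covariates. The factor `control` kills the
treated stratum, so only the regression at `false` enters. -/
theorem integral_control_mul {v : (Fin d → ℝ) → ℝ} (hv : Measurable v) {C : ℝ}
    (hC : ∀ᵐ x ∂P, |v x.2.2| ≤ C) (hY : Integrable (fun x : Obs d => x.1) P) :
    ∫ x, control x * x.1 * v x.2.2 ∂P = ∫ x, control x * outcomeReg P x.2.2 * v x.2.2 ∂P := by
  have hZ : Measurable fun x : Obs d => x.2 := by fun_prop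
  have hA : Measurable fun x : Obs d => x.1 := by fun_prop
  set c : Bool × (Fin d → ℝ) → ℝ := fun p => (if p.1 = true then 0 else 1) * v p.2
  have hc : Measurable c := (Measurable.ite (measurable_fst (measurableSet_singleton true))
    measurable_const measurable_const).mul (hv.comp measurable_snd)
  set f : (Bool × (Fin d → ℝ)) × ℝ → ℝ := fun p => c p.1 * p.2
  have hf : Measurable f := (hc.comp measurable_fst).mul measurable_snd
  have hcomp := compProd_map_condDistrib (mβ := inferInstance) (X := fun x : Obs d => x.2) (μ := P)
    hA.aemeasurable
  have hi : Integrable f ((P.map fun x : Obs d => x.2) ⊗ₘ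
      condDistrib (fun x : Obs d => x.1) (fun x : Obs d => x.2) P) := by
    rw [hcomp]
    refine (integrable_map_measure hf.aestronglyMeasurable (hZ.prodMk hA).aemeasurable).2 ?_
    refine hY.bdd_mul (c := C) (hc.comp hZ).aestronglyMeasurable ?_
    filter_upwards [hC] with x hx
    simp only [c, Real.norm_eq_abs, abs_mul]
    refine (mul_le_of_le_one_left (abs_nonneg _) ?_).trans hx
    split_ifs <;> simp
  have h1 := Measure.integral_compProd hi
  rw [hcomp, integral_map (hZ.prodMk hA).aemeasurable hf.aestronglyMeasurable] at h1
  change ∫ x : Obs d, f (x.2, x.1) ∂P = _ at h1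
  have h0 : ∀ x : Obs d, control x * x.1 * v x.2.2 = f (x.2, x.1) := fun x => by
    simp only [f, c, control]
    ring
  simp only [h0]
  rw [h1]
  have h2 : ∀ p, ∫ y, f (p, y) ∂(condDistrib (fun x : Obs d => x.1)
      (fun x : Obs d => x.2) P p) = c p * outcomeReg P p.2 := by
    rintro ⟨b, z⟩
    simp only [f]
    rw [integral_const_mul]
    cases b
    · rfl
    · simp [c]
  simp only [h2]
  have hm : Measurable fun p : Bool × (Fin d → ℝ) => c p * outcomeReg P p.2 :=
    hc.mul ((measurable_outcomeReg P).comp measurable_snd)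
  rw [integral_map hZ.aemeasurable hm.aestronglyMeasurable]
  refine integral_congr_ae (ae_of_all _ fun x => ?_)
  simp only [c, control]
  ring

omit [IsProbabilityMeasure P] in
theorem integral_treated : ∫ x, treated x ∂P = treatProb P := by
  have hs : MeasurableSet {x : Obs d | x.2.1 = true} :=
    measurable_snd.fst (measurableSet_singleton true)
  rw [treatProb, ← integral_indicator_one hs]
  refine integral_congr_ae (ae_of_all _ fun x => ?_)
  by_cases h : x.2.1 = true <;> simp [treated, h]

theorem integral_propensity : ∫ x, propensity P x.2.2 ∂P = treatProb P := by
  have h := integral_treated_mul P (v := fun _ => 1) measurable_const (C := 1) (by simp)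
  simp only [mul_one] at h
  rw [← h, integral_treated]

theorem treatProb_mul_gMean (h0 : treatProb P ≠ 0) :
    treatProb P * gMean P = ∫ x, treated x * outcomeReg P x.2.2 ∂P := by
  have hs : MeasurableSet {x : Obs d | x.2.1 = true} :=
    measurable_snd.fst (measurableSet_singleton true)
  rw [gMean, ProbabilityTheory.cond, integral_smul_measure, ENNReal.toReal_inv, smul_eq_mul]
  change treatProb P * ((treatProb P)⁻¹ * _) = _
  rw [← mul_assoc, mul_inv_cancel₀ h0, one_mul, ← integral_indicator hs]
  refine integral_congr_ae (ae_of_all _ fun x => ?_)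
  by_cases h : x.2.1 = true <;> simp [treated, h]

theorem le_treatProb {a : ℝ} (hint : Integrable (fun x : Obs d => propensity P x.2.2) P)
    (h : ∀ᵐ x ∂P, a ≤ propensity P x.2.2) : a ≤ treatProb P := by
  rw [← integral_propensity]
  calc a = ∫ _x : Obs d, a ∂P := by simp
    _ ≤ _ := integral_mono_ae (integrable_const _) hint h

end Model

/-! ### Lipschitz bounds for the odds and second-moment convergence. -/

/-- The odds `u / (1 - u)`. -/
noncomputable def odds (u : ℝ) : ℝ := u / (1 - u)

theorem odds_sub {u v : ℝ} (hu : u < 1) (hv : v < 1) :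
    odds u - odds v = (u - v) / ((1 - u) * (1 - v)) := by
  have h1 : 1 - u ≠ 0 := by linarith
  have h2 : 1 - v ≠ 0 := by linarith
  rw [odds, odds]
  field_simp
  ring

theorem abs_odds_sub_le {b u v : ℝ} (hb : b < 1) (hu : u ≤ b) (hv : v ≤ b) :
    |odds u - odds v| ≤ ((1 - b) ^ 2)⁻¹ * |u - v| := by
  have h0 : 0 < 1 - b := by linarith
  have h1 : 1 - b ≤ 1 - u := by linarith
  have h2 : 1 - b ≤ 1 - v := by linarith
  rw [odds_sub (by linarith) (by linarith), abs_div, div_eq_inv_mul,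
    abs_of_pos (mul_pos (h0.trans_le h1) (h0.trans_le h2))]
  refine mul_le_mul_of_nonneg_right (inv_anti₀ (by positivity) ?_) (abs_nonneg _)
  rw [sq]
  exact mul_le_mul h1 h2 h0.le (h0.le.trans h1)

theorem abs_odds_le {b u : ℝ} (hb : b < 1) (hu0 : 0 ≤ u) (hu : u ≤ b) :
    |odds u| ≤ (1 - b)⁻¹ := by
  have h0 : 0 < 1 - b := by linarith
  rw [odds, abs_of_nonneg (div_nonneg hu0 (by linarith)), div_le_iff₀ (by linarith),
    inv_mul_eq_div, le_div_iff₀ h0]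
  nlinarith

theorem measurable_odds : Measurable odds := measurable_id.div (measurable_const.sub measurable_id)

section L2

variable {S : Type*} [MeasurableSpace S] {P : Measure S}

theorem integral_sq_eq_eLpNorm {f : S → ℝ} (hf : MemLp f 2 P) :
    ∫ x, f x ^ 2 ∂P = (eLpNorm f 2 P).toReal ^ 2 := by
  have h0 : 0 ≤ ∫ x, f x ^ 2 ∂P := integral_nonneg fun x => sq_nonneg _
  rw [hf.eLpNorm_eq_integral_rpow_norm (by norm_num) (by norm_num)]
  simp only [ENNReal.toReal_ofNat, Real.rpow_ofNat, Real.norm_eq_abs, sq_abs]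
  rw [ENNReal.toReal_ofReal (Real.rpow_nonneg h0 _), ← Real.rpow_natCast, ← Real.rpow_mul h0]
  norm_num

theorem eventually_memLp {Θ : Type*} {𝓛 : Filter Θ} {f : Θ → S → ℝ}
    (hf : ∀ᶠ θ in 𝓛, AEStronglyMeasurable (f θ) P)
    (h : Tendsto (fun θ => eLpNorm (f θ) 2 P) 𝓛 (𝓝 0)) : ∀ᶠ θ in 𝓛, MemLp (f θ) 2 P := by
  filter_upwards [hf, h.eventually_lt_const ENNReal.zero_lt_top] with θ h1 h2 using ⟨h1, h2⟩

theorem tendsto_integral_sq {Θ : Type*} {𝓛 : Filter Θ} {f : Θ → S → ℝ}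
    (hf : ∀ᶠ θ in 𝓛, AEStronglyMeasurable (f θ) P)
    (h : Tendsto (fun θ => eLpNorm (f θ) 2 P) 𝓛 (𝓝 0)) :
    Tendsto (fun θ => ∫ x, f θ x ^ 2 ∂P) 𝓛 (𝓝 0) := by
  have h1 := ((ENNReal.tendsto_toReal ENNReal.zero_ne_top).comp h).pow 2
  simp only [ENNReal.toReal_zero, ne_eq, OfNat.ofNat_ne_zero, not_false_eq_true, zero_pow] at h1
  exact h1.congr' ((eventually_memLp hf h).mono fun θ hθ => (integral_sq_eq_eLpNorm hθ).symm)

end L2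

end GComp

namespace GComp

section L2

variable {S : Type*} [MeasurableSpace S] {P : Measure S}

/-- An `L₂` limit of functions bounded by `M` is bounded by `M`. -/
theorem ae_abs_le_of_tendsto {Θ : Type*} {𝓛 : Filter Θ} [𝓛.NeBot] {f : Θ → S → ℝ} {f₀ : S → ℝ}
    {M : ℝ} (hf₀ : Measurable f₀) (hL : ∀ᶠ θ in 𝓛, MemLp (fun x => f θ x - f₀ x) 2 P)
    (hlim : Tendsto (fun θ => ∫ x, (f θ x - f₀ x) ^ 2 ∂P) 𝓛 (𝓝 0))
    (hM : ∀ᶠ θ in 𝓛, ∀ᵐ x ∂P, |f θ x| ≤ M) : ∀ᵐ x ∂P, |f₀ x| ≤ M := by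
  -- The overshoot of `f₀` above `M` is dominated by the distance to any function bounded by `M`, so
  -- its square has integral zero.
  set k : S → ℝ := fun x => max (|f₀ x| - M) 0
  have hkm : Measurable k := (hf₀.abs.sub_const M).max measurable_const
  have hle : ∀ θ, (∀ᵐ x ∂P, |f θ x| ≤ M) → ∀ᵐ x ∂P, k x ^ 2 ≤ (f θ x - f₀ x) ^ 2 := by
    intro θ hθ
    filter_upwards [hθ] with x hx
    have h1 : k x ≤ |f θ x - f₀ x| := by
      refine max_le ?_ (abs_nonneg _)
      have := abs_sub_abs_le_abs_sub (f₀ x) (f θ x)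
      rw [abs_sub_comm] at this
      linarith
    rw [← sq_abs (f θ x - f₀ x)]
    exact pow_le_pow_left₀ (le_max_right _ _) h1 2
  obtain ⟨θ, hθL, hθM⟩ := (hL.and hM).exists
  have hint : Integrable (fun x => k x ^ 2) P := by
    refine hθL.integrable_sq.mono' (hkm.pow_const 2).aestronglyMeasurable ?_
    filter_upwards [hle θ hθM] with x hx
    rwa [Real.norm_eq_abs, abs_of_nonneg (sq_nonneg _)]
  have hzero : ∫ x, k x ^ 2 ∂P = 0 := by
    refine le_antisymm (ge_of_tendsto hlim ?_) (integral_nonneg fun x => sq_nonneg _)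
    filter_upwards [hL, hM] with θ h1 h2
    exact integral_mono_ae hint h1.integrable_sq (hle θ h2)
  filter_upwards [(integral_eq_zero_iff_of_nonneg (fun x => sq_nonneg (k x)) hint).1 hzero] with x hx
  have h1 : k x = 0 := by simpa using hx
  have h2 : |f₀ x| - M ≤ k x := le_max_left _ _
  linarith

theorem exists_integral_tail_lt {Y : S → ℝ} (hY : MemLp Y 2 P) (hYm : Measurable Y) {e : ℝ}
    (he : 0 < e) : ∃ K : ℝ, 0 ≤ K ∧ ∫ x, {x | K < |Y x|}.indicator (fun x => Y x ^ 2) x ∂P < e := by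
  have h1 : Tendsto (fun n : ℕ => ∫ x, {x | (n : ℝ) < |Y x|}.indicator (fun x => Y x ^ 2) x ∂P)
      atTop (𝓝 (∫ _x, (0 : ℝ) ∂P)) := by
    refine tendsto_integral_of_dominated_convergence (fun x => Y x ^ 2)
      (fun n => ((hYm.pow_const 2).indicator
        (measurableSet_lt measurable_const hYm.abs)).aestronglyMeasurable)
      hY.integrable_sq (fun n => ae_of_all _ fun x => ?_) (ae_of_all _ fun x => ?_)
    · refine (norm_indicator_le_norm_self _ _).trans ?_
      rw [Real.norm_eq_abs, abs_of_nonneg (sq_nonneg _)]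
    · refine tendsto_const_nhds.congr' ?_
      filter_upwards [tendsto_natCast_atTop_atTop.eventually_ge_atTop |Y x|] with n hn
      rw [Set.indicator_of_notMem]
      exact not_lt.2 hn
  rw [integral_zero] at h1
  obtain ⟨n, hn⟩ := (h1.eventually_lt_const he).exists
  exact ⟨n, Nat.cast_nonneg n, hn⟩

end L2

section Model

variable {d : ℕ} {P : Measure (Obs d)}

theorem weightedOutcome_eq (g : (Fin d → ℝ) → ℝ) (x : Obs d) :
    weightedOutcome g x = control x * x.1 * odds (g x.2.2) := mul_div_assoc _ _ _

theorem measurable_weightedOutcome {g : (Fin d → ℝ) → ℝ} (hg : Measurable g) :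
    Measurable (weightedOutcome g) := by
  have : weightedOutcome g = fun x : Obs d => control x * x.1 * odds (g x.2.2) :=
    funext fun x => weightedOutcome_eq g x
  rw [this]
  exact (measurable_control.mul measurable_fst).mul
    (measurable_odds.comp (hg.comp (by fun_prop)))

theorem memLp_weightedOutcome {g : (Fin d → ℝ) → ℝ} (hg : Measurable g) {a b : ℝ} (ha : 0 < a)
    (hb : b < 1) (hgb : ∀ᵐ x ∂P, g x.2.2 ∈ Set.Ioo a b)
    (hY : MemLp (fun x : Obs d => x.1) 2 P) : MemLp (weightedOutcome g) 2 P := by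
  refine hY.of_le_mul (c := (1 - b)⁻¹) (measurable_weightedOutcome hg).aestronglyMeasurable ?_
  filter_upwards [hgb] with x hx
  rw [weightedOutcome_eq, Real.norm_eq_abs, Real.norm_eq_abs, abs_mul, abs_mul, mul_comm]
  have h1 := abs_odds_le hb (ha.le.trans hx.1.le) hx.2.le
  have h2 : |control x| * |x.1| ≤ |x.1| := mul_le_of_le_one_left (abs_nonneg _) (abs_control_le x)
  exact mul_le_mul h1 h2 (by positivity) ((abs_nonneg _).trans h1)

/-- The outcome is unbounded, so it is cut at a level `K`: below `K` the odds are Lipschitz and the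
outcome costs a factor `K²`; above it the propensity scores differ by at most 1 and the tail of the
squared outcome is small. -/
theorem tendsto_weightedOutcome {Θ : Type*} {𝓛 : Filter Θ} {γ : Θ → (Fin d → ℝ) → ℝ}
    {g₀ : (Fin d → ℝ) → ℝ} {a b : ℝ} (ha : 0 < a) (hb : b < 1)
    (hγ : ∀ᶠ θ in 𝓛, ∀ᵐ x ∂P, γ θ x.2.2 ∈ Set.Ioo a b) (hg₀ : ∀ᵐ x ∂P, g₀ x.2.2 ∈ Set.Ioo a b)
    (hY : MemLp (fun x : Obs d => x.1) 2 P)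
    (hL : ∀ᶠ θ in 𝓛, MemLp (fun x : Obs d => γ θ x.2.2 - g₀ x.2.2) 2 P)
    (hlim : Tendsto (fun θ => ∫ x : Obs d, (γ θ x.2.2 - g₀ x.2.2) ^ 2 ∂P) 𝓛 (𝓝 0)) :
    Tendsto (fun θ => ∫ x : Obs d, (weightedOutcome (γ θ) x - weightedOutcome g₀ x) ^ 2 ∂P) 𝓛
      (𝓝 0) := by
  set Λ := ((1 - b) ^ 2)⁻¹
  have hΛ : 0 < Λ := by
    have : 0 < 1 - b := by linarith
    positivity
  rw [Metric.tendsto_nhds]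
  intro e he
  obtain ⟨K, hK0, hK⟩ := exists_integral_tail_lt hY measurable_fst
    (show 0 < e / (2 * Λ ^ 2) by positivity)
  set tail : Obs d → ℝ := {x | K < |x.1|}.indicator fun x => x.1 ^ 2
  have htail : Integrable tail P :=
    hY.integrable_sq.indicator (measurableSet_lt measurable_const measurable_fst.abs)
  have hev := hlim.eventually_lt_const (show 0 < e / (2 * Λ ^ 2 * (K ^ 2 + 1)) by positivity)
  filter_upwards [hγ, hL, hev] with θ h1 h2 h3
  rw [dist_zero_right, Real.norm_eq_abs, abs_of_nonneg (integral_nonneg fun x => sq_nonneg _)]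
  have hpt : ∀ᵐ x ∂P, (weightedOutcome (γ θ) x - weightedOutcome g₀ x) ^ 2 ≤
      Λ ^ 2 * (K ^ 2 * (γ θ x.2.2 - g₀ x.2.2) ^ 2 + tail x) := by
    filter_upwards [h1, hg₀] with x hx hx0
    have e1 : |weightedOutcome (γ θ) x - weightedOutcome g₀ x| ≤
        Λ * (|x.1| * |γ θ x.2.2 - g₀ x.2.2|) := by
      rw [weightedOutcome_eq, weightedOutcome_eq, ← mul_sub, abs_mul, abs_mul, mul_assoc]
      calc _ ≤ 1 * (|x.1| * (Λ * |γ θ x.2.2 - g₀ x.2.2|)) :=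
            mul_le_mul (abs_control_le x) (mul_le_mul_of_nonneg_left
              (abs_odds_sub_le hb hx.2.le hx0.2.le) (abs_nonneg _)) (by positivity) zero_le_one
        _ = _ := by ring
    have e2 := pow_le_pow_left₀ (abs_nonneg _) e1 2
    rw [sq_abs, mul_pow, mul_pow, sq_abs, sq_abs] at e2
    refine e2.trans (mul_le_mul_of_nonneg_left ?_ (by positivity))
    have e3 : (γ θ x.2.2 - g₀ x.2.2) ^ 2 ≤ 1 := by
      rw [sq_le_one_iff_abs_le_one, abs_le]
      constructor <;> linarith [hx.1, hx.2, hx0.1, hx0.2]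
    by_cases hxK : K < |x.1|
    · have : tail x = x.1 ^ 2 := Set.indicator_of_mem (s := {x : Obs d | K < |x.1|}) hxK _
      rw [this]
      nlinarith [sq_nonneg x.1, sq_nonneg (γ θ x.2.2 - g₀ x.2.2), sq_nonneg K]
    · have : tail x = 0 := Set.indicator_of_notMem (s := {x : Obs d | K < |x.1|}) hxK _
      rw [this, add_zero]
      refine mul_le_mul_of_nonneg_right ?_ (sq_nonneg _)
      rw [← sq_abs x.1]
      exact pow_le_pow_left₀ (abs_nonneg _) (not_lt.1 hxK) 2
  have hint : Integrable (fun x : Obs d => K ^ 2 * (γ θ x.2.2 - g₀ x.2.2) ^ 2) P :=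
    h2.integrable_sq.const_mul _
  have hbound : Integrable (fun x : Obs d =>
      Λ ^ 2 * (K ^ 2 * (γ θ x.2.2 - g₀ x.2.2) ^ 2 + tail x)) P := (hint.add htail).const_mul _
  have hmono := integral_mono_of_nonneg (ae_of_all _ fun x => sq_nonneg _) hbound hpt
  rw [integral_const_mul, integral_add hint htail, integral_const_mul] at hmono
  refine hmono.trans_lt ?_
  have h4 : K ^ 2 * ∫ x : Obs d, (γ θ x.2.2 - g₀ x.2.2) ^ 2 ∂P ≤ e / (2 * Λ ^ 2) := by
    have h5 : 0 ≤ ∫ x : Obs d, (γ θ x.2.2 - g₀ x.2.2) ^ 2 ∂P := integral_nonneg fun x => sq_nonneg _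
    rw [lt_div_iff₀ (by positivity)] at h3
    rw [le_div_iff₀ (by positivity)]
    nlinarith [mul_nonneg h5 (sq_nonneg Λ)]
  calc _ < Λ ^ 2 * (e / (2 * Λ ^ 2) + e / (2 * Λ ^ 2)) :=
        mul_lt_mul_of_pos_left (add_lt_add_of_le_of_lt h4 hK) (by positivity)
    _ = e := by field_simp; ring

end Model

/-! ### The estimating function and its bias. -/

/-- The estimating function `I(a=0) g/(1-g) (y-μ) + I(a=1) μ`, not centred or normalized. -/
noncomputable def score {d : ℕ} (m γ : (Fin d → ℝ) → ℝ) (x : Obs d) : ℝ :=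
  weightedOutcome γ x - control x * (odds (γ x.2.2) * m x.2.2) + treated x * m x.2.2

theorem infl_eq {d : ℕ} (m γ : (Fin d → ℝ) → ℝ) (π ψ : ℝ) (x : Obs d) :
    infl m γ π ψ x = π⁻¹ * (score m γ x - ψ * treated x) := by
  simp only [infl, score, weightedOutcome, odds, div_eq_mul_inv, mul_inv]
  ring

theorem empMean_sub {S : Type*} (s : ℕ → S) (n : ℕ) (f h : S → ℝ) :
    empMean s n (fun x => f x - h x) = empMean s n f - empMean s n h := by
  simp [empMean, Finset.sum_sub_distrib, sub_div]

theorem empMean_congr {S : Type*} {s : ℕ → S} {n : ℕ} {f h : S → ℝ}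
    (H : ∀ i < n, f (s i) = h (s i)) : empMean s n f = empMean s n h := by
  rw [empMean, empMean, Finset.sum_congr rfl fun i hi => H i (Finset.mem_range.1 hi)]

theorem empMean_infl_eq {d : ℕ} (m γ : (Fin d → ℝ) → ℝ) (π ψ : ℝ) (s : ℕ → Obs d) (n : ℕ) :
    empMean s n (infl m γ π ψ) = π⁻¹ * (empMean s n (score m γ) - ψ * piBar s n) := by
  rw [piBar, ← empMean_mul, ← empMean_sub, ← empMean_mul]
  congr 1
  funext x
  exact infl_eq m γ π ψ x

theorem estEq_eq {d : ℕ} (m γ : (Fin d → ℝ) → ℝ) (s : ℕ → Obs d) (n : ℕ) :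
    estEq m γ s n = (piBar s n)⁻¹ * empMean s n (score m γ) := by
  rw [estEq, ← empMean_mul]
  congr 1
  funext x
  simp only [score, weightedOutcome, odds, div_eq_mul_inv, mul_inv]
  ring

theorem plugIn_eq {d : ℕ} (m γ : (Fin d → ℝ) → ℝ) (s : ℕ → Obs d) (n : ℕ) :
    plugIn m γ s n = (piHat γ s n)⁻¹ * empMean s n fun x => γ x.2.2 * m x.2.2 := by
  rw [plugIn, ← empMean_mul]
  congr 1
  funext x
  ring

theorem plugInTreated_eq {d : ℕ} (m γ : (Fin d → ℝ) → ℝ) (s : ℕ → Obs d) (n : ℕ) :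
    plugInTreated m γ s n = (piHat γ s n)⁻¹ * empMean s n fun x => treated x * m x.2.2 := by
  rw [plugInTreated, ← empMean_mul]
  congr 1
  funext x
  simp only [div_eq_mul_inv]
  ring

section Score

variable {d : ℕ} {P : Measure (Obs d)} [IsProbabilityMeasure P]

theorem memLp_score {m γ : (Fin d → ℝ) → ℝ} (hm : Measurable m) (hγ : Measurable γ) {a b M : ℝ}
    (ha : 0 < a) (hb : b < 1) (hγb : ∀ᵐ x ∂P, γ x.2.2 ∈ Set.Ioo a b)
    (hmM : ∀ᵐ x ∂P, |m x.2.2| ≤ M) (hY : MemLp (fun x : Obs d => x.1) 2 P) :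
    MemLp (score m γ) 2 P := by
  have hZ : Measurable fun x : Obs d => x.2.2 := by fun_prop
  refine ((memLp_weightedOutcome hγ ha hb hγb hY).sub (MemLp.of_bound
    (measurable_control.mul ((measurable_odds.comp (hγ.comp hZ)).mul
      (hm.comp hZ))).aestronglyMeasurable ((1 - b)⁻¹ * M) ?_)).add (MemLp.of_bound
    (measurable_treated.mul (hm.comp hZ)).aestronglyMeasurable M ?_)
  · filter_upwards [hγb, hmM] with x h1 h2
    rw [Pi.mul_apply, Real.norm_eq_abs, abs_mul]
    refine (mul_le_of_le_one_left (abs_nonneg _) (abs_control_le x)).trans ?_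
    simp only [Pi.mul_apply, Function.comp, abs_mul]
    have h3 := abs_odds_le hb (ha.le.trans h1.1.le) h1.2.le
    exact mul_le_mul h3 h2 (abs_nonneg _) ((abs_nonneg _).trans h3)
  · filter_upwards [hmM] with x h2
    rw [Real.norm_eq_abs, abs_mul]
    exact (mul_le_of_le_one_left (abs_nonneg _) (abs_treated_le x)).trans h2

/-- The bias of the estimating function is a product of the errors of the nuisance parameters. -/
theorem integral_score {m γ : (Fin d → ℝ) → ℝ} (hm : Measurable m) (hγ : Measurable γ) {a b M : ℝ}
    (ha : 0 < a) (hb : b < 1) (hγb : ∀ᵐ x ∂P, γ x.2.2 ∈ Set.Ioo a b)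
    (hmM : ∀ᵐ x ∂P, |m x.2.2| ≤ M) (hY : MemLp (fun x : Obs d => x.1) 2 P)
    (hg₀ : ∀ᵐ x ∂P, propensity P x.2.2 ∈ Set.Ioo a b) (hμ₀ : ∀ᵐ x ∂P, |outcomeReg P x.2.2| ≤ M) :
    ∫ x, score m γ x ∂P = treatProb P * gMean P -
      ∫ x, (γ x.2.2 - propensity P x.2.2) * (m x.2.2 - outcomeReg P x.2.2) / (1 - γ x.2.2) ∂P := by
  have hZ : Measurable fun x : Obs d => x.2.2 := by fun_prop
  have hμ₀m := measurable_outcomeReg P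
  have hg₀m := measurable_propensity P
  have hbd : ∀ {f : Obs d → ℝ} {C : ℝ}, Measurable f → (∀ᵐ x ∂P, |f x| ≤ C) → Integrable f P :=
    fun hf hC => Integrable.of_bound hf.aestronglyMeasurable _ hC
  have hg₀i : Integrable (fun x : Obs d => propensity P x.2.2) P := by
    refine hbd (C := 1) (hg₀m.comp hZ) ?_
    filter_upwards [hg₀] with x hx
    rw [abs_of_pos (ha.trans hx.1)]
    linarith [hx.2]
  have hπ : 0 < treatProb P := ha.trans_le (le_treatProb P hg₀i (hg₀.mono fun x hx => hx.1.le))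
  have hodds : ∀ᵐ x ∂P, |odds (γ x.2.2)| ≤ (1 - b)⁻¹ := by
    filter_upwards [hγb] with x hx using abs_odds_le hb (ha.le.trans hx.1.le) hx.2.le
  have hom : Measurable fun z => odds (γ z) := measurable_odds.comp hγ
  -- Once the outcome is replaced by its regression and `control` by `1 - treated`, the treatment
  -- enters only through `treated * v`. Conditioning on the covariates then turns it into the
  -- propensity score, and the rest is algebra in the nuisance functions.
  set v : (Fin d → ℝ) → ℝ := fun z => m z - odds (γ z) * (outcomeReg P z - m z)
  have hvm : Measurable v := hm.sub (hom.mul (hμ₀m.sub hm))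
  have hprod : ∀ᵐ x ∂P, |odds (γ x.2.2) * (outcomeReg P x.2.2 - m x.2.2)| ≤
      (1 - b)⁻¹ * (M + M) := by
    filter_upwards [hodds, hμ₀, hmM] with x h1 h2 h3
    rw [abs_mul]
    exact mul_le_mul h1 ((abs_sub _ _).trans (add_le_add h2 h3)) (abs_nonneg _)
      ((abs_nonneg _).trans h1)
  have hvb : ∀ᵐ x ∂P, |v x.2.2| ≤ M + (1 - b)⁻¹ * (M + M) := by
    filter_upwards [hprod, hmM] with x h1 h2
    exact (abs_sub _ _).trans (add_le_add h2 h1)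
  have hwi : Integrable (weightedOutcome γ) P :=
    (memLp_weightedOutcome hγ ha hb hγb hY).integrable (by simp)
  have hwc : Integrable (fun x : Obs d => control x * outcomeReg P x.2.2 * odds (γ x.2.2)) P := by
    refine hbd (C := M * (1 - b)⁻¹) ((measurable_control.mul (hμ₀m.comp hZ)).mul (hom.comp hZ)) ?_
    filter_upwards [hodds, hμ₀] with x h1 h2
    rw [abs_mul, abs_mul]
    exact mul_le_mul ((mul_le_of_le_one_left (abs_nonneg _) (abs_control_le x)).trans h2) h1
      (abs_nonneg _) ((abs_nonneg _).trans h2)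
  have hpi : Integrable (fun x : Obs d => odds (γ x.2.2) * (outcomeReg P x.2.2 - m x.2.2)) P :=
    hbd ((hom.mul (hμ₀m.sub hm)).comp hZ) hprod
  have htv : Integrable (fun x : Obs d => treated x * v x.2.2) P := by
    refine hbd (measurable_treated.mul (hvm.comp hZ)) ?_ (C := M + (1 - b)⁻¹ * (M + M))
    filter_upwards [hvb] with x h1
    rw [abs_mul]
    exact (mul_le_of_le_one_left (abs_nonneg _) (abs_treated_le x)).trans h1
  have hgb : ∀ᵐ x ∂P, |propensity P x.2.2| ≤ 1 := by
    filter_upwards [hg₀] with x hx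
    rw [abs_of_pos (ha.trans hx.1)]
    linarith [hx.2]
  have hgmul : ∀ {u : (Fin d → ℝ) → ℝ} {C : ℝ}, Measurable u → (∀ᵐ x ∂P, |u x.2.2| ≤ C) →
      Integrable (fun x : Obs d => propensity P x.2.2 * u x.2.2) P := by
    intro u C hu hC
    refine hbd (C := C) ((hg₀m.mul hu).comp hZ) ?_
    filter_upwards [hgb, hC] with x h1 h2
    rw [abs_mul]
    exact (mul_le_of_le_one_left (abs_nonneg _) h1).trans h2
  have h1 : ∫ x, weightedOutcome γ x ∂P =
      ∫ x, control x * outcomeReg P x.2.2 * odds (γ x.2.2) ∂P := by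
    simp only [weightedOutcome_eq]
    exact integral_control_mul P hom hodds (hY.integrable (by simp))
  have hscore : ∀ x : Obs d, score m γ x = (weightedOutcome γ x -
      control x * outcomeReg P x.2.2 * odds (γ x.2.2)) +
      (odds (γ x.2.2) * (outcomeReg P x.2.2 - m x.2.2) + treated x * v x.2.2) := by
    intro x
    simp only [score, v, control_eq]
    ring
  have hd : Integrable (fun x : Obs d => weightedOutcome γ x -
      control x * outcomeReg P x.2.2 * odds (γ x.2.2)) P := hwi.sub hwc
  have hs : Integrable (fun x : Obs d => odds (γ x.2.2) * (outcomeReg P x.2.2 - m x.2.2) +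
      treated x * v x.2.2) P := hpi.add htv
  have hq : Integrable (fun x : Obs d => odds (γ x.2.2) * (outcomeReg P x.2.2 - m x.2.2) +
      propensity P x.2.2 * v x.2.2) P := hpi.add (hgmul hvm hvb)
  simp only [hscore]
  rw [integral_add hd hs, integral_sub hwi hwc, h1, sub_self, zero_add,
    integral_add hpi htv, integral_treated_mul P hvm hvb, ← integral_add hpi (hgmul hvm hvb),
    treatProb_mul_gMean P hπ.ne', integral_treated_mul P hμ₀m hμ₀, eq_sub_iff_add_eq]
  have hRi : Integrable (fun x : Obs d => (γ x.2.2 - propensity P x.2.2) *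
      (m x.2.2 - outcomeReg P x.2.2) / (1 - γ x.2.2)) P := by
    refine ((hgmul hμ₀m hμ₀).sub hq).congr ?_
    filter_upwards [hγb] with x hx
    have h2 : 1 - γ x.2.2 ≠ 0 := by linarith [hx.2]
    simp only [Pi.sub_apply, v, odds]
    field_simp
    ring
  rw [← integral_add hq hRi]
  refine integral_congr_ae ?_
  filter_upwards [hγb] with x hx
  have h2 : 1 - γ x.2.2 ≠ 0 := by linarith [hx.2]
  simp only [v, odds]
  field_simp
  ring

end Score

end GComp

/-! ### Asymptotic expansions under regular nuisance estimation. -/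

namespace GComp

/-- Needed in `ae_abs_le_of_tendsto`, where a deterministic conclusion is drawn from limits along
this filter. -/
instance probFilter_neBot {Ω : Type*} [MeasurableSpace Ω] (Pr : Measure Ω)
    [IsProbabilityMeasure Pr] : (probFilter Pr).NeBot := by
  rw [neBot_iff]
  intro h
  have h1 : (∅ : Set (ℕ × Ω)) ∈ probFilter Pr := by simp [h]
  have h2 : Tendsto (fun n : ℕ => Pr {ω | (n, ω) ∉ (∅ : Set (ℕ × Ω))}) atTop (𝓝 0) := h1
  simp at h2

/-- Nuisance estimators `m`, `γ` of the outcome regression and of the propensity score that satisfy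
the regularity conditions for asymptotic linearity. -/
structure RegularNuisance {d : ℕ} (P : Measure (Obs d)) [IsProbabilityMeasure P] {Ω : Type*}
    [MeasurableSpace Ω] (Pr : Measure Ω) (X : ℕ → Ω → Obs d) (m γ : ℕ × Ω → (Fin d → ℝ) → ℝ)
    (a b M : ℝ) : Prop where
  sample : ∀ n, MeasurePreserving (fun ω (i : Fin n) => X i ω) Pr (sampleLaw P n)
  pos : 0 < a
  lt : a < b
  lt_one : b < 1
  outcome_memLp : MemLp (fun x : Obs d => x.1) 2 P
  measurable_m : ∀ p, Measurable (m p)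
  measurable_γ : ∀ p, Measurable (γ p)
  stoch_m : StochEquicont P (probFilter Pr) fun p x => m p x.2.2 - outcomeReg P x.2.2
  stoch_γ : StochEquicont P (probFilter Pr) fun p x => γ p x.2.2 - propensity P x.2.2
  stoch_weighted : StochEquicont P (probFilter Pr) fun p x =>
    weightedOutcome (γ p) x - weightedOutcome (propensity P) x
  propensity_mem : ∀ᵐ x ∂P, propensity P x.2.2 ∈ Set.Ioo a b
  outcomeReg_le : ∀ᵐ x ∂P, |outcomeReg P x.2.2| ≤ M
  γ_mem : ∀ᶠ p in probFilter Pr, (∀ᵐ x ∂P, γ p x.2.2 ∈ Set.Ioo a b) ∧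
    ∀ i < p.1, γ p (X i p.2).2.2 ∈ Set.Ioo a b
  m_le : ∀ᶠ p in probFilter Pr, (∀ᵐ x ∂P, |m p x.2.2| ≤ M) ∧
    ∀ i < p.1, |m p (X i p.2).2.2| ≤ M
  product_rate : Tendsto (fun p : ℕ × Ω => √(p.1 : ℝ) *
    ∫ x, (γ p x.2.2 - propensity P x.2.2) * (m p x.2.2 - outcomeReg P x.2.2) /
      (1 - γ p x.2.2) ∂P) (probFilter Pr) (𝓝 0)

/-- The estimating function with truncated nuisance parameters. -/
noncomputable def clipScore {d : ℕ} (a b M : ℝ) (m γ : (Fin d → ℝ) → ℝ) (x : Obs d) : ℝ :=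
  weightedOutcome γ x - control x * (odds (clip a b (γ x.2.2)) * clip (-M) M (m x.2.2)) +
    treated x * clip (-M) M (m x.2.2)

theorem clip_eq_of_abs_le {M u : ℝ} (h : |u| ≤ M) : clip (-M) M u = u :=
  clip_eq (abs_le.1 h).1 (abs_le.1 h).2

theorem clip_eq_of_mem {a b u : ℝ} (h : u ∈ Set.Ioo a b) : clip a b u = u :=
  clip_eq h.1.le h.2.le

theorem clipScore_eq {d : ℕ} {a b M : ℝ} {m γ : (Fin d → ℝ) → ℝ} {x : Obs d}
    (hγ : γ x.2.2 ∈ Set.Ioo a b) (hm : |m x.2.2| ≤ M) : clipScore a b M m γ x = score m γ x := by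
  rw [clipScore, score, clip_eq_of_mem hγ, clip_eq_of_abs_le hm]

namespace RegularNuisance

variable {d : ℕ} {P : Measure (Obs d)} [IsProbabilityMeasure P] {Ω : Type*} [MeasurableSpace Ω]
  {Pr : Measure Ω} {X : ℕ → Ω → Obs d} {m γ : ℕ × Ω → (Fin d → ℝ) → ℝ} {a b M : ℝ}

theorem bound_nonneg (R : RegularNuisance P Pr X m γ a b M) : 0 ≤ M := by
  obtain ⟨x, hx⟩ := R.outcomeReg_le.exists
  exact (abs_nonneg _).trans hx

theorem ae_sample (R : RegularNuisance P Pr X m γ a b M) {q : Obs d → Prop} (hq : ∀ᵐ x ∂P, q x) :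
    ∀ᶠ p in probFilter Pr, ∀ i < p.1, q (X i p.2) := by
  refine eventually_probFilter_of_ae fun n => ?_
  have h1 : ∀ᵐ x ∂(sampleLaw P n), ∀ i : Fin n, q (x i) := ae_all_iff.2 fun i =>
    (measurePreserving_eval (fun _ : Fin n => P) i).quasiMeasurePreserving.ae hq
  filter_upwards [(R.sample n).quasiMeasurePreserving.ae h1] with ω hω i hi using hω ⟨i, hi⟩

theorem stoch_clip_m (R : RegularNuisance P Pr X m γ a b M) :
    StochEquicont P (probFilter Pr) fun p x =>
      clip (-M) M (m p x.2.2) - clip (-M) M (outcomeReg P x.2.2) :=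
  R.stoch_m.comp_sub (f := fun p x => m p x.2.2)
    ((measurable_outcomeReg P).comp (by fun_prop : Measurable fun x : Obs d => x.2.2))
    (measurable_clip _ _) zero_le_one fun u v => by
      rw [one_mul]
      exact abs_clip_sub_le _ _ _ _

theorem stoch_clip_γ (R : RegularNuisance P Pr X m γ a b M) :
    StochEquicont P (probFilter Pr) fun p x =>
      clip a b (γ p x.2.2) - clip a b (propensity P x.2.2) :=
  R.stoch_γ.comp_sub (f := fun p x => γ p x.2.2)
    ((measurable_propensity P).comp (by fun_prop : Measurable fun x : Obs d => x.2.2))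
    (measurable_clip _ _) zero_le_one fun u v => by
      rw [one_mul]
      exact abs_clip_sub_le _ _ _ _

theorem stoch_odds (R : RegularNuisance P Pr X m γ a b M) :
    StochEquicont P (probFilter Pr) fun p x =>
      odds (clip a b (γ p x.2.2)) - odds (clip a b (propensity P x.2.2)) := by
  refine R.stoch_γ.comp_sub (f := fun p x => γ p x.2.2) (T := fun u => odds (clip a b u))
    (L := ((1 - b) ^ 2)⁻¹)
    ((measurable_propensity P).comp (by fun_prop : Measurable fun x : Obs d => x.2.2))
    (measurable_odds.comp (measurable_clip _ _)) (by positivity) fun u v => ?_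
  refine (abs_odds_sub_le R.lt_one (clip_le R.lt.le u) (clip_le R.lt.le v)).trans ?_
  exact mul_le_mul_of_nonneg_left (abs_clip_sub_le _ _ _ _) (by positivity)

theorem stoch_treated (R : RegularNuisance P Pr X m γ a b M) :
    StochEquicont P (probFilter Pr) fun p x =>
      treated x * (clip (-M) M (m p x.2.2) - clip (-M) M (outcomeReg P x.2.2)) :=
  R.stoch_clip_m.mul_left measurable_treated abs_treated_le

theorem stoch_mul (R : RegularNuisance P Pr X m γ a b M) :
    StochEquicont P (probFilter Pr) fun p x => clip a b (γ p x.2.2) * clip (-M) M (m p x.2.2) -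
      clip a b (propensity P x.2.2) * clip (-M) M (outcomeReg P x.2.2) := by
  have hZ : Measurable fun x : Obs d => x.2.2 := by fun_prop
  have hγ : ∀ u, |clip a b u| ≤ max M 1 := fun u => by
    rw [abs_of_nonneg (R.pos.le.trans (le_clip _ _ _))]
    exact ((clip_le R.lt.le u).trans R.lt_one.le).trans (le_max_right _ _)
  have hm : ∀ u, |clip (-M) M u| ≤ max M 1 := fun u =>
    (abs_clip_le R.bound_nonneg u).trans (le_max_left _ _)
  exact R.stoch_clip_γ.mul_sub R.stoch_clip_m (u := fun p x => clip a b (γ p x.2.2))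
    (v := fun p x => clip (-M) M (m p x.2.2))
    ((measurable_clip _ _).comp ((measurable_propensity P).comp hZ))
    ((measurable_clip _ _).comp ((measurable_outcomeReg P).comp hZ)) (C := max M 1)
    (zero_le_one.trans (le_max_right _ _)) (fun _ _ => hγ _) (fun _ _ => hm _) (fun _ => hγ _)
    (fun _ => hm _)

/-- Truncation makes the factors bounded everywhere, as the product rule demands, although the
estimators are bounded only almost everywhere and at the sample. The weighted outcome is left as it
is: multiplication by the unbounded outcome is not a Lipschitz map with a common constant, and this
term has its own Donsker condition. -/
theorem stoch_clipScore (R : RegularNuisance P Pr X m γ a b M) :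
    StochEquicont P (probFilter Pr) fun p x =>
      clipScore a b M (m p) (γ p) x - clipScore a b M (outcomeReg P) (propensity P) x := by
  have hZ : Measurable fun x : Obs d => x.2.2 := by fun_prop
  have hb : 0 < 1 - b := by linarith [R.lt_one]
  have hγ : ∀ u, |odds (clip a b u)| ≤ max M (1 - b)⁻¹ := fun u =>
    (abs_odds_le R.lt_one (R.pos.le.trans (le_clip _ _ _)) (clip_le R.lt.le u)).trans
      (le_max_right _ _)
  have hm : ∀ u, |clip (-M) M u| ≤ max M (1 - b)⁻¹ := fun u =>
    (abs_clip_le R.bound_nonneg u).trans (le_max_left _ _)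
  have h1 := R.stoch_odds.mul_sub R.stoch_clip_m (u := fun p x => odds (clip a b (γ p x.2.2)))
    (v := fun p x => clip (-M) M (m p x.2.2))
    (measurable_odds.comp ((measurable_clip _ _).comp ((measurable_propensity P).comp hZ)))
    ((measurable_clip _ _).comp ((measurable_outcomeReg P).comp hZ)) (C := max M (1 - b)⁻¹)
    (R.bound_nonneg.trans (le_max_left _ _)) (fun _ _ => hγ _) (fun _ _ => hm _) (fun _ => hγ _)
    (fun _ => hm _)
  have h2 := h1.mul_left (w := fun x => -control x) (C := 1) measurable_control.neg
    fun x => by simpa using abs_control_le x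
  convert (R.stoch_weighted.add h2).add R.stoch_treated using 3 with p x
  simp only [clipScore, Function.comp]
  ring

theorem memLp_score (R : RegularNuisance P Pr X m γ a b M) :
    MemLp (score (outcomeReg P) (propensity P)) 2 P :=
  GComp.memLp_score (measurable_outcomeReg P) (measurable_propensity P) R.pos R.lt_one
    R.propensity_mem R.outcomeReg_le R.outcome_memLp

theorem integral_score_true (R : RegularNuisance P Pr X m γ a b M) :
    ∫ x, score (outcomeReg P) (propensity P) x ∂P = treatProb P * gMean P := by
  rw [integral_score (measurable_outcomeReg P) (measurable_propensity P) R.pos R.lt_one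
    R.propensity_mem R.outcomeReg_le R.outcome_memLp R.propensity_mem R.outcomeReg_le]
  simp

theorem memLp_propensity (R : RegularNuisance P Pr X m γ a b M) :
    MemLp (fun x : Obs d => propensity P x.2.2) 2 P := by
  refine MemLp.of_bound ((measurable_propensity P).comp
    (by fun_prop : Measurable fun x : Obs d => x.2.2)).aestronglyMeasurable 1 ?_
  filter_upwards [R.propensity_mem] with x hx
  rw [Real.norm_eq_abs, abs_of_pos (R.pos.trans hx.1)]
  linarith [hx.2, R.lt_one]

theorem treatProb_pos (R : RegularNuisance P Pr X m γ a b M) : 0 < treatProb P :=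
  R.pos.trans_le (le_treatProb P (R.memLp_propensity.integrable (by simp))
    (R.propensity_mem.mono fun _ hx => hx.1.le))

theorem memLp_treated : MemLp (treated (d := d)) 2 P :=
  MemLp.of_bound measurable_treated.aestronglyMeasurable 1 (ae_of_all _ abs_treated_le)

/-- Replacing the nuisance parameters by their estimators changes the empirical mean of the
estimating function by `o(n^{-1/2})`. -/
theorem tendsto_remainder (R : RegularNuisance P Pr X m γ a b M) :
    Tendsto (fun p : ℕ × Ω => √(p.1 : ℝ) *
      (empMean (fun i => X i p.2) p.1 (score (m p) (γ p)) -
        empMean (fun i => X i p.2) p.1 (score (outcomeReg P) (propensity P))))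
      (probFilter Pr) (𝓝 0) := by
  have h1 := (R.stoch_clipScore.tendsto R.sample).sub R.product_rate
  rw [sub_zero] at h1
  refine h1.congr' ?_
  filter_upwards [R.γ_mem, R.m_le, R.ae_sample R.propensity_mem, R.ae_sample R.outcomeReg_le]
    with p hγ hm hg₀ hμ₀
  -- The mean of the increment is minus the product bias, so subtracting the scaled bias from the
  -- empirical process leaves the scaled difference of empirical means.
  have e1 : ∫ x, (clipScore a b M (m p) (γ p) x -
      clipScore a b M (outcomeReg P) (propensity P) x) ∂P =
      -∫ x, (γ p x.2.2 - propensity P x.2.2) * (m p x.2.2 - outcomeReg P x.2.2) /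
        (1 - γ p x.2.2) ∂P := by
    have e2 : ∫ x, (clipScore a b M (m p) (γ p) x -
        clipScore a b M (outcomeReg P) (propensity P) x) ∂P =
        ∫ x, (score (m p) (γ p) x - score (outcomeReg P) (propensity P) x) ∂P := by
      refine integral_congr_ae ?_
      filter_upwards [hγ.1, hm.1, R.propensity_mem, R.outcomeReg_le] with x x1 x2 x3 x4
      rw [clipScore_eq x1 x2, clipScore_eq x3 x4]
    rw [e2, integral_sub ((GComp.memLp_score (R.measurable_m p) (R.measurable_γ p) R.pos R.lt_one
      hγ.1 hm.1 R.outcome_memLp).integrable (by simp)) (R.memLp_score.integrable (by simp)),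
      R.integral_score_true, integral_score (R.measurable_m p) (R.measurable_γ p) R.pos R.lt_one
      hγ.1 hm.1 R.outcome_memLp R.propensity_mem R.outcomeReg_le]
    ring
  have e3 : empMean (fun i => X i p.2) p.1 (fun x => clipScore a b M (m p) (γ p) x -
      clipScore a b M (outcomeReg P) (propensity P) x) =
      empMean (fun i => X i p.2) p.1 (score (m p) (γ p)) -
        empMean (fun i => X i p.2) p.1 (score (outcomeReg P) (propensity P)) := by
    rw [← empMean_sub]
    refine empMean_congr fun i hi => ?_
    rw [clipScore_eq (hγ.2 i hi) (hm.2 i hi), clipScore_eq (hg₀ i hi) (hμ₀ i hi)]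
  rw [empProc, e1, e3]
  ring

theorem tendsto_piBar (R : RegularNuisance P Pr X m γ a b M) :
    Tendsto (fun p : ℕ × Ω => piBar (fun i => X i p.2) p.1) (probFilter Pr)
      (𝓝 (treatProb P)) := by
  rw [← integral_treated]
  exact tendsto_empMean R.sample memLp_treated

theorem tendsto_piHat (R : RegularNuisance P Pr X m γ a b M) :
    Tendsto (fun p : ℕ × Ω => piHat (γ p) (fun i => X i p.2) p.1) (probFilter Pr)
      (𝓝 (treatProb P)) := by
  have h := (R.stoch_γ.tendsto_empMean R.sample).add
    (tendsto_empMean R.sample R.memLp_propensity)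
  rw [zero_add, integral_propensity] at h
  refine h.congr fun p => ?_
  rw [← empMean_add]
  simp [piHat]

theorem memLp_outcomeReg (R : RegularNuisance P Pr X m γ a b M) {w : Obs d → ℝ}
    (hw : Measurable w) (hw1 : ∀ᵐ x ∂P, |w x| ≤ 1) :
    MemLp (fun x => w x * outcomeReg P x.2.2) 2 P := by
  refine MemLp.of_bound (hw.mul ((measurable_outcomeReg P).comp
    (by fun_prop : Measurable fun x : Obs d => x.2.2))).aestronglyMeasurable M ?_
  filter_upwards [hw1, R.outcomeReg_le] with x h1 h2
  rw [Real.norm_eq_abs, abs_mul]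
  exact (mul_le_of_le_one_left (abs_nonneg _) h1).trans h2

theorem tendsto_inv_mul (R : RegularNuisance P Pr X m γ a b M) {u : ℕ × Ω → ℝ}
    (hu : Tendsto u (probFilter Pr) (𝓝 (treatProb P * gMean P))) :
    Tendsto (fun p : ℕ × Ω => (piHat (γ p) (fun i => X i p.2) p.1)⁻¹ * u p) (probFilter Pr)
      (𝓝 (gMean P)) := by
  have h := (R.tendsto_piHat.inv₀ R.treatProb_pos.ne').mul hu
  rwa [← mul_assoc, inv_mul_cancel₀ R.treatProb_pos.ne', one_mul] at h

/-- Only consistency, without a rate: it makes the cross term between the error of the preliminary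
estimator and that of `piBar` negligible in the one-step expansion. -/
theorem tendsto_plugIn (R : RegularNuisance P Pr X m γ a b M) :
    Tendsto (fun p : ℕ × Ω => plugIn (m p) (γ p) (fun i => X i p.2) p.1) (probFilter Pr)
      (𝓝 (gMean P)) := by
  have h := (R.stoch_mul.tendsto_empMean R.sample).add (tendsto_empMean R.sample
    (R.memLp_outcomeReg ((measurable_propensity P).comp
      (by fun_prop : Measurable fun x : Obs d => x.2.2)) (by
        filter_upwards [R.propensity_mem] with x hx
        rw [Function.comp, abs_of_pos (R.pos.trans hx.1)]
        linarith [hx.2, R.lt_one])))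
  rw [zero_add] at h
  have hlim : ∫ x : Obs d, (propensity P ∘ fun x : Obs d => x.2.2) x * outcomeReg P x.2.2 ∂P =
      treatProb P * gMean P := by
    rw [treatProb_mul_gMean P R.treatProb_pos.ne',
      integral_treated_mul P (measurable_outcomeReg P) R.outcomeReg_le]
    rfl
  rw [hlim] at h
  have h2 := R.tendsto_inv_mul h
  refine h2.congr' ?_
  filter_upwards [R.γ_mem, R.m_le, R.ae_sample R.propensity_mem, R.ae_sample R.outcomeReg_le]
    with p hγ hm hg₀ hμ₀
  rw [plugIn_eq, ← empMean_add]
  congr 1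
  refine empMean_congr fun i hi => ?_
  simp only [Function.comp]
  rw [clip_eq_of_mem (hγ.2 i hi), clip_eq_of_abs_le (hm.2 i hi), clip_eq_of_mem (hg₀ i hi),
    clip_eq_of_abs_le (hμ₀ i hi)]
  ring

theorem tendsto_plugInTreated (R : RegularNuisance P Pr X m γ a b M) :
    Tendsto (fun p : ℕ × Ω => plugInTreated (m p) (γ p) (fun i => X i p.2) p.1) (probFilter Pr)
      (𝓝 (gMean P)) := by
  have h := (R.stoch_treated.tendsto_empMean R.sample).add (tendsto_empMean R.sample
    (R.memLp_outcomeReg measurable_treated (ae_of_all _ abs_treated_le)))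
  rw [zero_add, ← treatProb_mul_gMean P R.treatProb_pos.ne'] at h
  have h2 := R.tendsto_inv_mul h
  refine h2.congr' ?_
  filter_upwards [R.m_le, R.ae_sample R.outcomeReg_le] with p hm hμ₀
  rw [plugInTreated_eq, ← empMean_add]
  congr 1
  refine empMean_congr fun i hi => ?_
  rw [clip_eq_of_abs_le (hm.2 i hi), clip_eq_of_abs_le (hμ₀ i hi)]
  ring

/-- The influence function, up to the factor `π₀`. -/
theorem inflAt_eq (x : Obs d) : inflAt P x = (treatProb P)⁻¹ *
    (score (outcomeReg P) (propensity P) x - gMean P * treated x) := infl_eq _ _ _ _ _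

theorem memLp_centred (R : RegularNuisance P Pr X m γ a b M) :
    MemLp (fun x => score (outcomeReg P) (propensity P) x - gMean P * treated x) 2 P :=
  R.memLp_score.sub (memLp_treated.const_mul _)

theorem integral_centred (R : RegularNuisance P Pr X m γ a b M) :
    ∫ x, (score (outcomeReg P) (propensity P) x - gMean P * treated x) ∂P = 0 := by
  rw [integral_sub (R.memLp_score.integrable (by simp))
    ((memLp_treated.integrable (by simp)).const_mul _), R.integral_score_true, integral_const_mul,
    integral_treated]
  ring

theorem asympLinear_of_tendsto (R : RegularNuisance P Pr X m γ a b M) {T : ℕ → Ω → ℝ}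
    (h : Tendsto (fun p : ℕ × Ω => √(p.1 : ℝ) * (T p.1 p.2 - (gMean P +
      empMean (fun i => X i p.2) p.1 (inflAt P)))) (probFilter Pr) (𝓝 0)) :
    AsympLinear Pr P X T (gMean P) (inflAt P) := by
  have e : inflAt P = fun x => (treatProb P)⁻¹ *
      (score (outcomeReg P) (propensity P) x - gMean P * treated x) := funext inflAt_eq
  refine ⟨?_, ?_, outerLittleORootN_iff.2 h⟩
  · rw [e]
    exact R.memLp_centred.const_mul _
  · rw [e, integral_const_mul, R.integral_centred, mul_zero]

theorem empMean_inflAt (s : ℕ → Obs d) (n : ℕ) : empMean s n (inflAt P) = (treatProb P)⁻¹ *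
    (empMean s n (score (outcomeReg P) (propensity P)) - gMean P * piBar s n) :=
  empMean_infl_eq _ _ _ _ _ _

/-- An estimated normalization is asymptotically negligible. -/
theorem tendsto_normalization (R : RegularNuisance P Pr X m γ a b M) {q : ℕ × Ω → ℝ}
    (hq : Tendsto q (probFilter Pr) (𝓝 (treatProb P))) :
    Tendsto (fun p : ℕ × Ω => √(p.1 : ℝ) * ((q p)⁻¹ * (empMean (fun i => X i p.2) p.1
      (score (m p) (γ p)) - gMean P * piBar (fun i => X i p.2) p.1) -
        empMean (fun i => X i p.2) p.1 (inflAt P))) (probFilter Pr) (𝓝 0) := by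
  have hinv := hq.inv₀ R.treatProb_pos.ne'
  have h0 := hinv.sub_const (treatProb P)⁻¹
  rw [sub_self] at h0
  -- The error of the normalization multiplies the empirical process at a fixed mean-zero function,
  -- which is bounded in probability, so consistency of `q` suffices without any rate.
  have h1 := (tendsto_empProc_mul R.sample R.memLp_centred h0).add (R.tendsto_remainder.mul hinv)
  rw [zero_mul, add_zero] at h1
  refine h1.congr fun p => ?_
  rw [empProc, R.integral_centred, empMean_inflAt, empMean_sub, empMean_mul]
  change √(p.1 : ℝ) * (_ - gMean P * piBar _ _ - 0) * _ + _ = _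
  ring

/-- With the normalization `piBar`, the centred estimator is exactly the expression of
`tendsto_normalization`; no further error term arises, hence no additional rate condition. -/
theorem asympLinear_estEq (R : RegularNuisance P Pr X m γ a b M) :
    AsympLinear Pr P X (fun n ω => estEq (m (n, ω)) (γ (n, ω)) (fun i => X i ω) n) (gMean P)
      (inflAt P) := by
  refine R.asympLinear_of_tendsto ((R.tendsto_normalization R.tendsto_piBar).congr' ?_)
  filter_upwards [R.tendsto_piBar.eventually_ne R.treatProb_pos.ne'] with p hp
  rw [estEq_eq]
  field_simp
  ring

/-- Beyond the normalized score, the error contains `(t - ψ₀)(π_n - \bar π_n)/π_n`. Inserting π₀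
between the two proportions leaves the product assumed in `hrate` and the empirical process at
`treated` times a consistent error. -/
theorem asympLinear_oneStep (R : RegularNuisance P Pr X m γ a b M) {t : ℕ × Ω → ℝ}
    (ht : Tendsto t (probFilter Pr) (𝓝 (gMean P)))
    (hrate : Tendsto (fun p : ℕ × Ω => √(p.1 : ℝ) *
      ((piHat (γ p) (fun i => X i p.2) p.1 - treatProb P) * (t p - gMean P)))
      (probFilter Pr) (𝓝 0)) :
    AsympLinear Pr P X (fun n ω => t (n, ω) + empMean (fun i => X i ω) n
      (infl (m (n, ω)) (γ (n, ω)) (piHat (γ (n, ω)) (fun i => X i ω) n) (t (n, ω)))) (gMean P)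
      (inflAt P) := by
  have hd := ht.sub_const (gMean P)
  rw [sub_self] at hd
  have h1 := (hrate.sub (tendsto_empProc_mul R.sample memLp_treated hd)).mul
    (R.tendsto_piHat.inv₀ R.treatProb_pos.ne')
  rw [sub_zero, zero_mul] at h1
  have h2 := h1.add (R.tendsto_normalization R.tendsto_piHat)
  rw [add_zero] at h2
  refine R.asympLinear_of_tendsto (h2.congr' ?_)
  filter_upwards [R.tendsto_piHat.eventually_ne R.treatProb_pos.ne'] with p hp
  rw [empMean_infl_eq, empProc, integral_treated]
  change (_ - √(p.1 : ℝ) * (piBar _ _ - _) * _) * _ + _ = _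
  field_simp
  ring

end RegularNuisance

end GComp

/-! ### The main theorem: verification of the regularity conditions. -/

theorem proposition8 {d : ℕ} (P₀ : Measure (Obs d)) [IsProbabilityMeasure P₀]
    -- an IID sample from `P₀`
    {Ω : Type*} [MeasurableSpace Ω] (Pr : Measure Ω) [IsProbabilityMeasure Pr]
    (X : ℕ → Ω → Obs d) (hXmeas : ∀ i, Measurable (X i)) (hXindep : iIndepFun X Pr)
    (hXlaw : ∀ i, Pr.map (X i) = P₀)
    -- the nuisance estimators `μ_n`, `g_n`: random measurable functions of `z`
    (μ g : ℕ → Ω → (Fin d → ℝ) → ℝ)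
    (hμmeas : ∀ n ω, Measurable (μ n ω)) (hgmeas : ∀ n ω, Measurable (g n ω))
    -- Donsker conditions
    (Fμ Fg Fw : Set (Obs d → ℝ))
    (hFμ : IsDonsker P₀ Fμ) (hFg : IsDonsker P₀ Fg) (hFw : IsDonsker P₀ Fw)
    (hμF : WithProbTendstoOne Pr fun n => {ω | (fun x : Obs d => μ n ω x.2.2) ∈ Fμ})
    (hgF : WithProbTendstoOne Pr fun n => {ω | (fun x : Obs d => g n ω x.2.2) ∈ Fg})
    (hwF : WithProbTendstoOne Pr fun n => {ω | weightedOutcome (g n ω) ∈ Fw})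
    -- `E₀(Y²) < ∞`
    (hY : MemLp (fun x : Obs d => x.1) 2 P₀)
    -- boundedness, at almost every `z` and at the observed covariates
    (a b M : ℝ) (ha : 0 < a) (hab : a < b) (hb : b < 1)
    (hg₀ : ∀ᵐ x ∂P₀, propensity P₀ x.2.2 ∈ Set.Ioo a b)
    (hgbd : ∀ n, ∀ᵐ ω ∂Pr, (∀ᵐ x ∂P₀, g n ω x.2.2 ∈ Set.Ioo a b) ∧
      ∀ i < n, g n ω (X i ω).2.2 ∈ Set.Ioo a b)
    (hμbd : ∀ n, ∀ᵐ ω ∂Pr, (∀ᵐ x ∂P₀, |μ n ω x.2.2| ≤ M) ∧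
      ∀ i < n, |μ n ω (X i ω).2.2| ≤ M)
    -- consistency in `L₂(P₀)`
    (hgcons : OuterLittleOOne Pr fun n ω =>
      eLpNorm (fun x : Obs d => g n ω x.2.2 - propensity P₀ x.2.2) 2 P₀)
    (hμcons : OuterLittleOOne Pr fun n ω =>
      eLpNorm (fun x : Obs d => μ n ω x.2.2 - outcomeReg P₀ x.2.2) 2 P₀)
    -- product rate
    (hprod : OuterLittleORootN Pr fun n ω =>
      ∫ x, (g n ω x.2.2 - propensity P₀ x.2.2) * (μ n ω x.2.2 - outcomeReg P₀ x.2.2) /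
        (1 - g n ω x.2.2) ∂P₀) :
    -- the estimating equations-based estimator
    AsympLinear Pr P₀ X (fun n ω => estEq (μ n ω) (g n ω) (fun i => X i ω) n)
      (gMean P₀) (inflAt P₀) ∧
    -- the one-step estimator `ψ_n + ℙ_n φ_n` with `ψ_n = ∫ μ_n g_n π_n⁻¹ dQ_n`
    ((OuterLittleORootN Pr fun n ω =>
        (piHat (g n ω) (fun i => X i ω) n - treatProb P₀) *
          (plugIn (μ n ω) (g n ω) (fun i => X i ω) n - gMean P₀)) →
      AsympLinear Pr P₀ X (fun n ω => oneStep (μ n ω) (g n ω) (fun i => X i ω) n)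
        (gMean P₀) (inflAt P₀)) ∧
    -- the closed-form one-step estimator, for which `ψ_n = n⁻¹ ∑ I(A_i = 1) μ_n(Z_i) / π_n`
    ((OuterLittleORootN Pr fun n ω =>
        (piHat (g n ω) (fun i => X i ω) n - treatProb P₀) *
          (plugInTreated (μ n ω) (g n ω) (fun i => X i ω) n - gMean P₀)) →
      AsympLinear Pr P₀ X (fun n ω => oneStepTreated (μ n ω) (g n ω) (fun i => X i ω) n)
        (gMean P₀) (inflAt P₀)) := by
  have hZ : Measurable fun x : Obs d => x.2.2 := by fun_prop
  have hg₀m : Measurable fun x : Obs d => propensity P₀ x.2.2 := (measurable_propensity P₀).comp hZ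
  have hμ₀m : Measurable fun x : Obs d => outcomeReg P₀ x.2.2 := (measurable_outcomeReg P₀).comp hZ
  have hγ : ∀ᶠ p in probFilter Pr, (∀ᵐ x ∂P₀, g p.1 p.2 x.2.2 ∈ Set.Ioo a b) ∧
      ∀ i < p.1, g p.1 p.2 (X i p.2).2.2 ∈ Set.Ioo a b := by
    refine eventually_probFilter_of_ae fun n => ?_
    filter_upwards [hgbd n] with ω hω using hω
  have hm : ∀ᶠ p in probFilter Pr, (∀ᵐ x ∂P₀, |μ p.1 p.2 x.2.2| ≤ M) ∧
      ∀ i < p.1, |μ p.1 p.2 (X i p.2).2.2| ≤ M := by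
    refine eventually_probFilter_of_ae fun n => ?_
    filter_upwards [hμbd n] with ω hω using hω
  have hgm : ∀ᶠ p in probFilter Pr, AEStronglyMeasurable
      (fun x : Obs d => g p.1 p.2 x.2.2 - propensity P₀ x.2.2) P₀ := Eventually.of_forall fun p =>
    (((hgmeas p.1 p.2).comp hZ).sub hg₀m).aestronglyMeasurable
  have hmm : ∀ᶠ p in probFilter Pr, AEStronglyMeasurable
      (fun x : Obs d => μ p.1 p.2 x.2.2 - outcomeReg P₀ x.2.2) P₀ := Eventually.of_forall fun p =>
    (((hμmeas p.1 p.2).comp hZ).sub hμ₀m).aestronglyMeasurable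
  have hgL := eventually_memLp hgm hgcons.tendsto
  have hgI := tendsto_integral_sq hgm hgcons.tendsto
  have hmL := eventually_memLp hmm hμcons.tendsto
  have hmI := tendsto_integral_sq hmm hμcons.tendsto
  -- Boundedness of the true regression is not assumed; it is inherited from the estimators through
  -- their L₂ consistency.
  have hμ₀ : ∀ᵐ x ∂P₀, |outcomeReg P₀ x.2.2| ≤ M :=
    ae_abs_le_of_tendsto (f := fun (p : ℕ × Ω) (x : Obs d) => μ p.1 p.2 x.2.2) hμ₀m hmL hmI (hm.mono fun _ h => h.1)
  have hg₀L : MemLp (fun x : Obs d => propensity P₀ x.2.2) 2 P₀ := by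
    refine MemLp.of_bound hg₀m.aestronglyMeasurable 1 ?_
    filter_upwards [hg₀] with x hx
    rw [Real.norm_eq_abs, abs_of_pos (ha.trans hx.1)]
    exact (hx.2.trans hb).le
  have hμ₀L : MemLp (fun x : Obs d => outcomeReg P₀ x.2.2) 2 P₀ :=
    MemLp.of_bound hμ₀m.aestronglyMeasurable M hμ₀
  have hmF : ∀ᶠ p : ℕ × Ω in probFilter Pr, (fun x : Obs d => μ p.1 p.2 x.2.2) ∈ Fμ := by
    filter_upwards [hμF.eventually] with p hp using hp
  have hγF : ∀ᶠ p : ℕ × Ω in probFilter Pr, (fun x : Obs d => g p.1 p.2 x.2.2) ∈ Fg := by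
    filter_upwards [hgF.eventually] with p hp using hp
  have hγF' : ∀ᶠ p : ℕ × Ω in probFilter Pr, weightedOutcome (g p.1 p.2) ∈ Fw := by
    filter_upwards [hwF.eventually] with p hp using hp
  have hrate := outerLittleORootN_iff.1 hprod
  have R : RegularNuisance P₀ Pr X (fun p => μ p.1 p.2) (fun p => g p.1 p.2) a b M :=
    { sample := measurePreserving_sample hXmeas hXindep hXlaw
      pos := ha
      lt := hab
      lt_one := hb
      outcome_memLp := hY
      measurable_m := fun p => hμmeas p.1 p.2
      measurable_γ := fun p => hgmeas p.1 p.2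
      stoch_m := hFμ.stochEquicont (f := fun (p : ℕ × Ω) (x : Obs d) => μ p.1 p.2 x.2.2) hμ₀L hmF hmI
      stoch_γ := hFg.stochEquicont (f := fun (p : ℕ × Ω) (x : Obs d) => g p.1 p.2 x.2.2) hg₀L hγF hgI
      stoch_weighted := hFw.stochEquicont (f := fun p : ℕ × Ω => weightedOutcome (g p.1 p.2))
        (memLp_weightedOutcome (measurable_propensity P₀) ha hb hg₀ hY) hγF'
        (tendsto_weightedOutcome ha hb (hγ.mono fun _ h => h.1) hg₀ hY hgL hgI)
      propensity_mem := hg₀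
      outcomeReg_le := hμ₀
      γ_mem := hγ
      m_le := hm
      product_rate := hrate }
  refine ⟨R.asympLinear_estEq, fun h => ?_, fun h => ?_⟩
  · have h1 := outerLittleORootN_iff.1 h
    have h2 := R.asympLinear_oneStep
      (t := fun p => plugIn (μ p.1 p.2) (g p.1 p.2) (fun i => X i p.2) p.1) R.tendsto_plugIn h1
    simp only [oneStep]
    exact h2
  · have h1 := outerLittleORootN_iff.1 h
    have h2 := R.asympLinear_oneStep
      (t := fun p => plugInTreated (μ p.1 p.2) (g p.1 p.2) (fun i => X i p.2) p.1)
      R.tendsto_plugInTreated h1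
    simp only [oneStepTreated_eq]
    exact h2
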